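/- **Setting.** Let $\mathcal S^d$ be the space of real symmetric $d\times d$ matrices with $\langle A,B\rangle=\operatorname{trace}(AB)$, write $Q[x]=x^tQx$, and let $\tilde{\mathcal S}^d_{\ge 0}$ be its rational closure: the set of all $Q$ for which some $U\in \mathsf{GL}_d(\mathbb Z)$ satisfies $U^tQU=\begin{pmatrix}0&0\\0&Q'\end{pmatrix}$ with $Q'$ positive definite. Fix a standard periodic set $\Lambda=\bigcup_{i=1}^m(t_i+\mathbb Z^d)$, $m\ge 1$. A Delone polyhedron of $Q$ is a set $\operatorname{conv}V$, $\emptyset\ne V\subseteq\Lambda$, such that for some $c\in\mathbb R^d$, $r\in\mathbb R$ we have $Q[c-v]=r^2$ for $v\in V$ and $Q[c-v]>r^2$ for $v\in\Lambda\setminus V$; the Delone subdivision $\mathrm{Del}(Q)$ of $Q\in\tilde{\mathcal S}^d_{\ge0}$ is the set of all its Delone polyhedra. For a linear subspace $T\subseteq\mathcal S^d$ the $T$-secondary cone of $\mathcal D$ is $\mathbf\Delta_T(\mathcal D)=\{Q\in\tilde{\mathcal S}^d_{\ge 0}\cap T:\mathrm{Del}(Q)=\mathcal D\}$; $\mathcal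 D$ is a $T$-generic Delone subdivision if this cone is nonempty and $\dim\mathbf\Delta_T(\mathcal D)=\dim T$. The vertex-set of a polyhedron $P$ is $\operatorname{vert}P=\Lambda\cap P$. For $d+1$ affinely independent points $V$ and $w\in\mathbb R^d$ let $N_{V,w}=ww^t-\sum_{v\in V}\alpha_v vv^t$, where $w=\sum_{v\in V}\alpha_v v$ and $\sum_{v\in V}\alpha_v=1$. Let $U_{\mathcal D}$ be the space of all $Q\in\mathcal S^d$ with $\langle N_{V,w},Q\rangle=0$ for all $d$-dimensional $P\in\mathcal D$, all affinely independent $V\subseteq\operatorname{vert}P$ with $|V|=d+1$ and all $w\in\operatorname{vert}P$. For a $(d-1)$-dimensional $F=P\cap P'\in\mathcal D$, with $P,P'\in\mathcal D$ of dimension $d$, let $N_{\mathcal D,F}\in U_{\mathcal D}$ be the form with $\langle N_{\mathcal D,F},N_{\mathcal D,F}\rangle=1$ of which the orthogonal projection of $N_{V\cup\{w\},w'}$ onto $U_{\mathcal D}$ is a positive multiple, where $V\subseteq\operatorname{vert}F$ consists of $d$ affinely independent points, $w\in\operatorname{vert}P\setminus F$ and $w'\in\operatorname{vert}P'\setminus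 F$ (these choices do not matter). Let $\mathcal F$ be a common facet of $\overline{\mathbf\Delta_T(\mathcal D)}$ and $\overline{\mathbf\Delta_T(\mathcal D')}$ for two distinct $T$-generic Delone subdivisions $\mathcal D,\mathcal D'$. Let $N_{\mathcal F}\in T$ be the form with $\langle N_{\mathcal F},N_{\mathcal F}\rangle=1$ for which $\langle N_{\mathcal F},\cdot\rangle$ is zero on $\mathcal F$, positive on $\mathbf\Delta_T(\mathcal D)$ and negative on $\mathbf\Delta_T(\mathcal D')$. Let $\mathcal R_{\mathcal F}$ be the set of all $(d-1)$-dimensional $F\in\mathcal D$ such that $N_{\mathcal F}$ is a positive multiple of the orthogonal projection of $N_{\mathcal D,F}$ onto $T$. Call $F,F'\in\mathcal R_{\mathcal F}$ equivalent if there are $F=F_1,\dots,F_n=F'$ in $\mathcal R_{\mathcal F}$ and $d$-dimensional $P_0,\dots,P_n\in\mathcal D$ with $F_i=P_{i-1}\cap P_i$ for $i=1,\dots,n$. The repartitioning polyhedra of $\mathcal F$ are the sets $\operatorname{conv}V_{\mathcal C}$, where $\mathcal C$ is an equivalence class and $V_{\mathcal C}$ is the set of all vertices of $d$-dimensional polyhedra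 of $\mathcal D$ that have a facet in $\mathcal C$. For $Q\in\mathbf\Delta_T(\mathcal D)$ and a repartitioning polyhedron $P$ let $\bar P(Q)=\operatorname{conv}\{(v,Q[v]):v\in\operatorname{vert}P\}\subset\mathbb R^{d+1}$. A facet of $\bar P(Q)$ is called lower (upper) if the last coordinate of its outer normal vector is negative (positive). Let $\pi:\mathbb R^{d+1}\to\mathbb R^d$ be the projection onto the first $d$ coordinates. **Theorem 3.6.** Let $T\subseteq\mathcal S^d$ be a linear subspace and let $\mathcal F$ be a common facet of (the closures of) the $T$-secondary cones of two distinct $T$-generic Delone subdivisions $\mathcal D$ and $\mathcal D'$. Then for every $Q\in\mathbf\Delta_T(\mathcal D)$ the $d$-dimensional polyhedra of $\mathcal D'$ are obtained from those of $\mathcal D$ by doing the following for each repartitioning polyhedron $P$ of $\mathcal F$: remove all polyhedra $\pi(\bar F)$ with $\bar F$ a lower facet of $\bar P(Q)$, and add all polyhedra $\pi(\bar F)$ with $\bar F$ an upper facet of $\bar P(Q)$. Here all removed polyhedra belong to $\mathcal D$, and none of the added ones does. -/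

import Mathlib

open scoped Matrix

noncomputable section

namespace Delone

/-- Real `d × d` matrices; the space of quadratic forms consists of the symmetric ones. -/
abbrev Mat (d : ℕ) : Type := Matrix (Fin d) (Fin d) ℝ

/-- The value `Q[x] = xᵗ Q x`. -/
def qval {d : ℕ} (Q : Mat d) (x : Fin d → ℝ) : ℝ := x ⬝ᵥ (Q *ᵥ x)

/-- The inner product `⟨A, B⟩ = trace (A B)` on symmetric matrices. -/
def ip {d : ℕ} (A B : Mat d) : ℝ := (A * B).trace

/-- `B` is the orthogonal projection of the symmetric matrix `A` onto the space `U` of symmetric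
matrices. -/
def IsOrthProj {d : ℕ} (U : Submodule ℝ (Mat d)) (A B : Mat d) : Prop :=
  B ∈ U ∧ ∀ C ∈ U, ip (A - B) C = 0

/-- Dimension of (the affine hull of) a nonempty set. -/
def dim {E : Type*} [AddCommGroup E] [Module ℝ E] (A : Set E) : ℕ :=
  Module.finrank ℝ (vectorSpan ℝ A)

/-- `F` is a facet of the convex set `C`: a nonempty exposed face of codimension one. -/
def IsFacet {E : Type*} [AddCommGroup E] [Module ℝ E] [TopologicalSpace E] (C F : Set E) : Prop :=
  F.Nonempty ∧ IsExposed ℝ C F ∧ dim F + 1 = dim C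

/-- A standard periodic set: a finite nonempty union of translates `t + ℤᵈ`. -/
def IsStandardPeriodic {d : ℕ} (L : Set (Fin d → ℝ)) : Prop :=
  ∃ S : Finset (Fin d → ℝ), S.Nonempty ∧
    L = {x | ∃ t ∈ S, ∃ z : Fin d → ℤ, x = t + fun i => (z i : ℝ)}

/-- The rational closure of the cone of positive definite forms: all symmetric `Q` for which some
`U ∈ GL_d(ℤ)` turns `Uᵗ Q U` into a block form `diag (0, R)` with `R` positive definite. (The
identification `e` of the block indices with `Fin d` is free; permutation matrices are in
`GL_d(ℤ)`. Both blocks may be empty.) -/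
def rationalClosure (d : ℕ) : Set (Mat d) :=
  {Q | ∃ (m k : ℕ) (e : Fin m ⊕ Fin k ≃ Fin d) (U : Matrix (Fin d) (Fin d) ℤ)
      (R : Matrix (Fin k) (Fin k) ℝ),
      IsUnit U.det ∧ R.PosDef ∧
      (U.map (Int.cast : ℤ → ℝ))ᵀ * Q * U.map (Int.cast : ℤ → ℝ) =
        Matrix.reindex e e (Matrix.fromBlocks 0 0 0 R)}

/-- Delone polyhedra of `Q` and the vertex-set `L`. -/
def IsDelonePolyhedron {d : ℕ} (L : Set (Fin d → ℝ)) (Q : Mat d) (P : Set (Fin d → ℝ)) : Prop :=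
  ∃ V : Set (Fin d → ℝ), V.Nonempty ∧ V ⊆ L ∧ P = convexHull ℝ V ∧
    ∃ (c : Fin d → ℝ) (r : ℝ),
      (∀ v ∈ V, qval Q (c - v) = r ^ 2) ∧ ∀ v ∈ L \ V, r ^ 2 < qval Q (c - v)

/-- The Delone subdivision of `Q`: the set of all its Delone polyhedra (of all dimensions). -/
def Del {d : ℕ} (L : Set (Fin d → ℝ)) (Q : Mat d) : Set (Set (Fin d → ℝ)) :=
  {P | IsDelonePolyhedron L Q P}

/-- The `T`-secondary cone of `D`: all `Q ∈ T` in the rational closure with `Del(Q) = D`. -/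
def secondaryCone {d : ℕ} (L : Set (Fin d → ℝ)) (T : Submodule ℝ (Mat d))
    (D : Set (Set (Fin d → ℝ))) : Set (Mat d) :=
  {Q | Q ∈ rationalClosure d ∧ Del L Q = D} ∩ (T : Set (Mat d))

/-- `D` is a `T`-generic Delone subdivision: its `T`-secondary cone has the dimension of `T`. -/
def IsGeneric {d : ℕ} (L : Set (Fin d → ℝ)) (T : Submodule ℝ (Mat d))
    (D : Set (Set (Fin d → ℝ))) : Prop :=
  (secondaryCone L T D).Nonempty ∧ dim (secondaryCone L T D) = Module.finrank ℝ T

/-- `F` is a common facet of (the closures of) the `T`-secondary cones of `D₁` and `D₂`. -/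
def IsCommonFacet {d : ℕ} (L : Set (Fin d → ℝ)) (T : Submodule ℝ (Mat d))
    (D₁ D₂ : Set (Set (Fin d → ℝ))) (F : Set (Mat d)) : Prop :=
  IsFacet (closure (secondaryCone L T D₁)) F ∧ IsFacet (closure (secondaryCone L T D₂)) F

/-- The `d`-dimensional polyhedra of a subdivision. -/
def cells {d : ℕ} (D : Set (Set (Fin d → ℝ))) : Set (Set (Fin d → ℝ)) :=
  {P ∈ D | dim P = d}

/-- `N` is the form `N_{V,w} = w wᵗ - ∑ α_v v vᵗ`, where `w = ∑ α_v v` and `∑ α_v = 1`. The set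
`V` of `d + 1` points is given by the family `v`; the coefficients, hence `N`, are uniquely
determined if `v` is affinely independent. -/
def IsNForm {d : ℕ} (v : Fin (d + 1) → Fin d → ℝ) (w : Fin d → ℝ) (N : Mat d) : Prop :=
  ∃ a : Fin (d + 1) → ℝ, ∑ i, a i = 1 ∧ ∑ i, a i • v i = w ∧
    N = Matrix.vecMulVec w w - ∑ i, a i • Matrix.vecMulVec (v i) (v i)

/-- The linear space of all symmetric `Q` with `⟨N_{V,w}, Q⟩ = 0` for every `d`-dimensional
`P ∈ D`, every affinely independent set `V` of `d + 1` vertices of `P` and every vertex `w` of `P`;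
here the vertices of `P` are the points of `L ∩ P`. -/
def equalitySpace {d : ℕ} (L : Set (Fin d → ℝ)) (D : Set (Set (Fin d → ℝ))) :
    Submodule ℝ (Mat d) where
  carrier := {Q | Q.IsSymm ∧ ∀ P ∈ cells D, ∀ v : Fin (d + 1) → Fin d → ℝ,
    AffineIndependent ℝ v → (∀ i, v i ∈ L ∩ P) → ∀ w ∈ L ∩ P, ∀ N, IsNForm v w N → ip N Q = 0}
  zero_mem' := ⟨by simp [Matrix.IsSymm], by intros; simp [ip]⟩
  add_mem' := by
    rintro A B ⟨hA, hA'⟩ ⟨hB, hB'⟩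
    refine ⟨hA.add hB, fun P hP v hv hvP w hw N hN => ?_⟩
    have h1 := hA' P hP v hv hvP w hw N hN
    have h2 := hB' P hP v hv hvP w hw N hN
    simp only [ip] at h1 h2 ⊢
    rw [Matrix.mul_add, Matrix.trace_add, h1, h2, add_zero]
  smul_mem' := by
    rintro c A ⟨hA, hA'⟩
    refine ⟨hA.smul c, fun P hP v hv hvP w hw N hN => ?_⟩
    have h1 := hA' P hP v hv hvP w hw N hN
    simp only [ip] at h1 ⊢
    rw [Matrix.mul_smul, Matrix.trace_smul, h1, smul_zero]

/-- `N` is the form `N_{D,F}` of the `(d-1)`-dimensional polyhedron `F` of `D`: the unit form in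
`equalitySpace L D` of which the projection of `N_{V ∪ {w}, w'}` is a positive multiple. Here
`F = P ∩ P'` for `d`-dimensional polyhedra `P, P' ∈ D`, `V` consists of `d` affinely independent
vertices of `F`, and `w`, `w'` are vertices of `P`, `P'` outside `F`; for a Delone subdivision `D`
the result does not depend on these choices. -/
def IsFacetForm {d : ℕ} (L : Set (Fin d → ℝ)) (D : Set (Set (Fin d → ℝ)))
    (F : Set (Fin d → ℝ)) (N : Mat d) : Prop :=
  N ∈ equalitySpace L D ∧ ip N N = 1 ∧
    ∃ P ∈ cells D, ∃ P' ∈ cells D, F = P ∩ P' ∧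
      ∃ v : Fin d → Fin d → ℝ, AffineIndependent ℝ v ∧ (∀ i, v i ∈ L ∩ F) ∧
      ∃ w ∈ (L ∩ P) \ F, ∃ w' ∈ (L ∩ P') \ F, ∃ M : Mat d, IsNForm (Fin.cons w v) w' M ∧
        ∃ c : ℝ, 0 < c ∧ IsOrthProj (equalitySpace L D) M (c • N)

/-- `N` is the unit normal form `N_𝓕` in `T` of the common facet `𝓕` of the `T`-secondary cones
of `D` and `D'`, positive on the first cone and negative on the second. -/
def IsWallNormal {d : ℕ} (L : Set (Fin d → ℝ)) (T : Submodule ℝ (Mat d))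
    (D D' : Set (Set (Fin d → ℝ))) (𝓕 : Set (Mat d)) (N : Mat d) : Prop :=
  N ∈ T ∧ ip N N = 1 ∧ (∀ Q ∈ 𝓕, ip N Q = 0) ∧
    (∀ Q ∈ secondaryCone L T D, 0 < ip N Q) ∧ ∀ Q ∈ secondaryCone L T D', ip N Q < 0

/-- The set `R_𝓕` of `(d-1)`-dimensional `F ∈ D` such that `N_𝓕` is a positive multiple of the
projection of `N_{D,F}` onto `T`. -/
def wallFacets {d : ℕ} (L : Set (Fin d → ℝ)) (T : Submodule ℝ (Mat d))
    (D D' : Set (Set (Fin d → ℝ))) (𝓕 : Set (Mat d)) : Set (Set (Fin d → ℝ)) :=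
  {F ∈ D | dim F + 1 = d ∧ ∃ N, IsWallNormal L T D D' 𝓕 N ∧
    ∃ M B : Mat d, IsFacetForm L D F M ∧ IsOrthProj T M B ∧ ∃ a : ℝ, 0 < a ∧ N = a • B}

/-- The relation `F ~ F'` on a set `R` of facets: there are `F = F₀, …, Fₙ = F'` in `R` and
`d`-dimensional polyhedra `P₀, …, Pₙ₊₁` in `D` with `Fᵢ = Pᵢ ∩ Pᵢ₊₁`. -/
def Chained {d : ℕ} (D R : Set (Set (Fin d → ℝ))) (F F' : Set (Fin d → ℝ)) : Prop :=
  ∃ (n : ℕ) (f : Fin (n + 1) → Set (Fin d → ℝ)) (p : Fin (n + 2) → Set (Fin d → ℝ)),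
    f 0 = F ∧ f (Fin.last n) = F' ∧ (∀ i, f i ∈ R) ∧ (∀ i, p i ∈ cells D) ∧
      ∀ i, f i = p i.castSucc ∩ p i.succ

/-- The set `V_C` of all vertices of `d`-dimensional polyhedra of `D` with a facet in `C`. -/
def classVertices {d : ℕ} (L : Set (Fin d → ℝ)) (D C : Set (Set (Fin d → ℝ))) :
    Set (Fin d → ℝ) :=
  {v ∈ L | ∃ P ∈ cells D, v ∈ P ∧ ∃ F ∈ C, IsFacet P F}

/-- The repartitioning polyhedra of `𝓕`: the sets `conv V_C`, where `C` runs through the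
equivalence classes of `Chained` on `R_𝓕`. -/
def repartitioningPolyhedra {d : ℕ} (L : Set (Fin d → ℝ)) (T : Submodule ℝ (Mat d))
    (D D' : Set (Set (Fin d → ℝ))) (𝓕 : Set (Mat d)) : Set (Set (Fin d → ℝ)) :=
  {P | ∃ F ∈ wallFacets L T D D' 𝓕,
    P = convexHull ℝ (classVertices L D
      {F' ∈ wallFacets L T D D' 𝓕 | Chained D (wallFacets L T D D' 𝓕) F F'})}

/-- The lifted polyhedron `conv {(v, Q[v]) : v ∈ L ∩ P}` in `ℝᵈ × ℝ`. -/
def lifted {d : ℕ} (L : Set (Fin d → ℝ)) (P : Set (Fin d → ℝ)) (Q : Mat d) :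
    Set ((Fin d → ℝ) × ℝ) :=
  convexHull ℝ ((fun v => (v, qval Q v)) '' (L ∩ P))

/-- `n` is an outer normal vector of the face `F` of the convex set `C` in `ℝᵈ × ℝ`. -/
def IsOuterNormal {d : ℕ} (C F : Set ((Fin d → ℝ) × ℝ)) (n : (Fin d → ℝ) × ℝ) : Prop :=
  n ≠ 0 ∧ F = {x ∈ C | ∀ y ∈ C, n.1 ⬝ᵥ y.1 + n.2 * y.2 ≤ n.1 ⬝ᵥ x.1 + n.2 * x.2}

/-- Lower facets: the last coordinate of the outer normal vector is negative. -/
def IsLowerFacet {d : ℕ} (C F : Set ((Fin d → ℝ) × ℝ)) : Prop :=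
  IsFacet C F ∧ ∃ n, IsOuterNormal C F n ∧ n.2 < 0

/-- Upper facets: the last coordinate of the outer normal vector is positive. -/
def IsUpperFacet {d : ℕ} (C F : Set ((Fin d → ℝ) × ℝ)) : Prop :=
  IsFacet C F ∧ ∃ n, IsOuterNormal C F n ∧ 0 < n.2

/-- The projections to `ℝᵈ` of the lower facets of the lifted polyhedron of `P`. -/
def lowerCells {d : ℕ} (L : Set (Fin d → ℝ)) (Q : Mat d) (P : Set (Fin d → ℝ)) :
    Set (Set (Fin d → ℝ)) :=
  {X | ∃ F, IsLowerFacet (lifted L P Q) F ∧ X = Prod.fst '' F}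

/-- The projections to `ℝᵈ` of the upper facets of the lifted polyhedron of `P`. -/
def upperCells {d : ℕ} (L : Set (Fin d → ℝ)) (Q : Mat d) (P : Set (Fin d → ℝ)) :
    Set (Set (Fin d → ℝ)) :=
  {X | ∃ F, IsUpperFacet (lifted L P Q) F ∧ X = Prod.fst '' F}

end Delone

end

/-! Lift every vertex v to (v, Q[v]). For a suitable affine map ℓ, Q[c - v] - r² = Q[v] - ℓ(v). An
empty ellipsoid is therefore an affine minorant of Q on the vertex-set, and its Delone polyhedron is
the hull of the contact points (`mem_Del_iff`). The full-dimensional cells come from the minorants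
whose contact points span (`mem_cells_iff`), so the subdivision is the lower hull of the lifted
vertices. Degenerate forms are handled by `exists_good`: Q is a squared norm after a linear map with
rational kernel and locally finite image. Minorants factor through this map, which makes tilting,
closedness and covering (`exists_cellMap_mem_hull`) finite questions.

Let Q₀ be the sum of finitely many forms that span the facet 𝓕. It has the same kernel as the forms
in the two cones, and for each C in T orthogonal to the normal N some t > 0 puts both t Q₀ + C and t
Q₀ - C into both closures (`exists_wall`). Supporting maps of cells survive in the closure of a
secondary cone (`exists_minorant_of_mem_closure`), so D and D' both refine Del(Q₀). Squeezing
between the two forms t Q₀ ± C shows that C is affine on the vertices of each cell P₀ of Q₀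
(`IsWall.exists_affine`).

For Q and Q' in the two cones, some Q' + c Q with c > 0 is orthogonal to N. On the vertices of P₀
this says that Q' is -c Q plus an affine map (`IsWall.exists_reversal`): the upper hull for Q is the
lower hull for Q'. If P₀ is not a cell of D, its lower facets project to the cells of D inside P₀
and its upper facets to those of D'. If P₀ is a cell of D, it is one of D' as well, and nothing
changes.

It remains to see that the repartitioning polyhedra are the cells of Q₀ outside D
(`repartitioningPolyhedra_eq`). A facet belongs to the wall exactly when its form vanishes at Q₀,
that is, when its two neighbours lie in one cell P₀ of Q₀. All such facets in P₀ are chained,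
because a generic segment in the convex set P₀ avoids intersections of codimension two or more
(`reflTransGen_adjacent`). A chain cannot leave P₀, because at most two cells contain a given facet.
-/

noncomputable section

namespace Delone

open Module

set_option linter.unusedSectionVars false

/-! ### Affine minorants and their contact sets -/

section Minorants

variable {E : Type*} [NormedAddCommGroup E] [NormedSpace ℝ E]

/-- The affine map `ℓ` lies below `f` on `L`. -/
def Minorant (L : Set E) (f : E → ℝ) (ℓ : E →ᵃ[ℝ] ℝ) : Prop := ∀ v ∈ L, ℓ v ≤ f v

/-- The points of `L` at which `f` agrees with `ℓ`. -/
def contact (L : Set E) (f : E → ℝ) (ℓ : E →ᵃ[ℝ] ℝ) : Set E := {v ∈ L | f v = ℓ v}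

/-- A minorant whose contact set affinely spans the space. -/
def CellMap (L : Set E) (f : E → ℝ) (ℓ : E →ᵃ[ℝ] ℝ) : Prop :=
  Minorant L f ℓ ∧ affineSpan ℝ (contact L f ℓ) = ⊤

/-- The polyhedron spanned by the contact set. -/
def hull (L : Set E) (f : E → ℝ) (ℓ : E →ᵃ[ℝ] ℝ) : Set E := convexHull ℝ (contact L f ℓ)

/-- The open side ψ < m together with the hull of the top level is already convex, so it contains
the whole hull. -/
lemma convexHull_inter_level (S : Set E) (ψ : E →ᵃ[ℝ] ℝ) (m : ℝ) (h : ∀ s ∈ S, ψ s ≤ m) :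
    {x ∈ convexHull ℝ S | ψ x = m} = convexHull ℝ {s ∈ S | ψ s = m} := by
  have key : convexHull ℝ S ⊆ {x | ψ x < m} ∪ convexHull ℝ {s ∈ S | ψ s = m} := by
    apply convexHull_min
    · intro s hs
      rcases (h s hs).lt_or_eq with h1 | h1
      · exact Or.inl h1
      · exact Or.inr (subset_convexHull ℝ _ ⟨hs, h1⟩)
    · have hle : ∀ x ∈ convexHull ℝ {s ∈ S | ψ s = m}, ψ x = m := by
        have : convexHull ℝ {s ∈ S | ψ s = m} ⊆ ψ ⁻¹' {m} :=
          convexHull_min (fun s hs => hs.2) ((convex_singleton m).affine_preimage ψ)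
        exact fun x hx => this hx
      intro x hx y hy a b ha hb hab
      have e : ψ (a • x + b • y) = a * ψ x + b * ψ y := by
        rw [Convex.combo_affine_apply hab]; rfl
      have hxm : ψ x ≤ m := hx.elim (fun h => le_of_lt h) (fun h => (hle x h).le)
      have hym : ψ y ≤ m := hy.elim (fun h => le_of_lt h) (fun h => (hle y h).le)
      rcases ha.eq_or_lt with rfl | ha'
      · have : b = 1 := by linarith
        subst this; simpa using hy
      rcases hb.eq_or_lt with rfl | hb'
      · have : a = 1 := by linarith
        subst this; simpa using hx
      rcases hx with hx | hx
      · left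
        show ψ _ < m
        rw [e]
        have hx' : ψ x < m := hx
        have : m = a * m + b * m := by rw [← add_mul, hab, one_mul]
        nlinarith
      rcases hy with hy | hy
      · left
        show ψ _ < m
        rw [e]
        have hy' : ψ y < m := hy
        have : m = a * m + b * m := by rw [← add_mul, hab, one_mul]
        nlinarith
      · exact Or.inr (convex_convexHull ℝ _ hx hy ha hb hab)
  apply Set.Subset.antisymm
  · rintro x ⟨hx, hxm⟩
    rcases key hx with h1 | h1
    · exact absurd hxm (ne_of_lt h1)
    · exact h1
  · apply convexHull_min
    · exact fun s hs => ⟨subset_convexHull ℝ _ hs.1, hs.2⟩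
    · exact (convex_convexHull ℝ S).inter ((convex_singleton m).affine_preimage ψ)

variable {L : Set E} {f : E → ℝ} {ℓ ℓ₁ ℓ₂ : E →ᵃ[ℝ] ℝ}

lemma contact_subset : contact L f ℓ ⊆ L := fun _ h => h.1

/-- At contact points of ℓ₁ the value of f is that of ℓ₁, which dominates ℓ₂; affine inequalities
pass to the convex hull. -/
lemma Minorant.le_on_hull (h₂ : Minorant L f ℓ₂) {x : E} (hx : x ∈ hull L f ℓ₁) :
    ℓ₂ x ≤ ℓ₁ x := by
  have : hull L f ℓ₁ ⊆ (ℓ₁ - ℓ₂) ⁻¹' Set.Ici 0 := by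
    apply convexHull_min
    · intro v hv
      have := h₂ v hv.1
      have := hv.2
      simp only [Set.mem_preimage, AffineMap.coe_sub, Pi.sub_apply, Set.mem_Ici]
      linarith
    · exact (convex_Ici (0 : ℝ)).affine_preimage _
  have := this hx
  simpa using this

lemma eqOn_hull (h₁ : Minorant L f ℓ₁) (h₂ : Minorant L f ℓ₂) {x : E} (hx₁ : x ∈ hull L f ℓ₁)
    (hx₂ : x ∈ hull L f ℓ₂) : ℓ₁ x = ℓ₂ x :=
  le_antisymm (h₁.le_on_hull hx₂) (h₂.le_on_hull hx₁)

lemma hull_inter_eq_level (h₂ : Minorant L f ℓ₂) :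
    {x ∈ hull L f ℓ₁ | ℓ₁ x = ℓ₂ x} = convexHull ℝ (contact L f ℓ₁ ∩ contact L f ℓ₂) := by
  have := convexHull_inter_level (contact L f ℓ₁) (ℓ₂ - ℓ₁) 0 (by
    intro v hv
    have := h₂ v hv.1
    have := hv.2
    simp only [AffineMap.coe_sub, Pi.sub_apply]
    linarith)
  have e : {x ∈ hull L f ℓ₁ | ℓ₁ x = ℓ₂ x} =
      {x ∈ convexHull ℝ (contact L f ℓ₁) | (ℓ₂ - ℓ₁) x = 0} := by
    ext x
    simp only [hull, Set.mem_ofPred_eq, AffineMap.coe_sub, Pi.sub_apply, sub_eq_zero]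
    rw [eq_comm (a := ℓ₁ x)]
  rw [e, this]
  congr 1
  ext v
  simp only [contact, Set.mem_ofPred_eq, AffineMap.coe_sub, Pi.sub_apply, sub_eq_zero,
    Set.mem_inter_iff]
  constructor
  · rintro ⟨⟨a, b⟩, c⟩
    exact ⟨⟨a, b⟩, a, b.trans c.symm⟩
  · rintro ⟨⟨a, b⟩, _, c⟩
    exact ⟨⟨a, b⟩, c.symm.trans b⟩

/-- On the intersection the two affine maps agree, which cuts out a face of either hull. This is why
cells meet face to face. -/
lemma hull_inter_hull (h₁ : Minorant L f ℓ₁) (h₂ : Minorant L f ℓ₂) :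
    hull L f ℓ₁ ∩ hull L f ℓ₂ = convexHull ℝ (contact L f ℓ₁ ∩ contact L f ℓ₂) := by
  apply Set.Subset.antisymm
  · rintro x ⟨h1, h2⟩
    rw [← hull_inter_eq_level h₂]
    exact ⟨h1, eqOn_hull h₁ h₂ h1 h2⟩
  · exact Set.subset_inter (convexHull_mono Set.inter_subset_left)
      (convexHull_mono Set.inter_subset_right)

lemma hull_inter_eq_level' (h₁ : Minorant L f ℓ₁) (h₂ : Minorant L f ℓ₂) :
    hull L f ℓ₁ ∩ hull L f ℓ₂ = {x ∈ hull L f ℓ₁ | ℓ₁ x = ℓ₂ x} := by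
  rw [hull_inter_hull h₁ h₂, hull_inter_eq_level h₂]

lemma convex_hull : Convex ℝ (hull L f ℓ) := convex_convexHull ℝ _

lemma contact_subset_hull : contact L f ℓ ⊆ hull L f ℓ := subset_convexHull ℝ _

variable [FiniteDimensional ℝ E]

lemma CellMap.interior_nonempty (h : CellMap L f ℓ) : (interior (hull L f ℓ)).Nonempty :=
  interior_convexHull_nonempty_iff_affineSpan_eq_top.2 h.2

lemma CellMap.hull_subset_closure_interior (h : CellMap L f ℓ) :
    hull L f ℓ ⊆ closure (interior (hull L f ℓ)) := by
  rw [convex_hull.closure_interior_eq_closure_of_nonempty_interior h.interior_nonempty]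
  exact subset_closure

/-- From an interior zero one can move a little both ways along any line, so a nonzero slope would
produce negative values. -/
lemma affineMap_eq_zero_of_nonneg {s : Set E} {x : E} (g : E →ᵃ[ℝ] ℝ) (hg : ∀ y ∈ s, 0 ≤ g y)
    (hx : x ∈ interior s) (h0 : g x = 0) : g = 0 := by
  have hlin : ∀ u, g.linear u = 0 := by
    intro u
    have hc : ContinuousAt (fun t : ℝ => x + t • u) 0 := by fun_prop
    have hnh : s ∈ nhds (x + (0 : ℝ) • u) := by
      simpa using mem_interior_iff_mem_nhds.1 hx
    have h1 : ∀ᶠ t in nhds (0 : ℝ), x + t • u ∈ s := hc hnh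
    obtain ⟨ε, hε, hb⟩ := Metric.eventually_nhds_iff.1 h1
    have hv : ∀ t : ℝ, g (x + t • u) = t * g.linear u := by
      intro t
      have := g.map_vadd x (t • u)
      rw [vadd_eq_add, vadd_eq_add, add_comm, h0, map_smul] at this
      simpa using this
    have p := hg _ (hb (y := ε / 2) (by rw [Real.dist_eq, sub_zero, abs_of_pos] <;> linarith))
    have q := hg _ (hb (y := -(ε / 2)) (by
      rw [Real.dist_eq, sub_zero, abs_neg, abs_of_pos] <;> linarith))
    rw [hv] at p q
    nlinarith
  ext y
  have := g.map_vadd x (y - x)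
  rw [hlin, vadd_eq_add, vadd_eq_add, sub_add_cancel, h0] at this
  simpa using this

/-- Cells whose interior meets another cell coincide with it. -/
lemma eq_of_interior_meets (h₁ : Minorant L f ℓ₁) (h₂ : Minorant L f ℓ₂) {x : E}
    (hx₁ : x ∈ interior (hull L f ℓ₁)) (hx₂ : x ∈ hull L f ℓ₂) : ℓ₁ = ℓ₂ := by
  have := affineMap_eq_zero_of_nonneg (ℓ₁ - ℓ₂)
    (fun y hy => by simpa using h₂.le_on_hull (ℓ₁ := ℓ₁) hy) hx₁
    (by simpa [sub_eq_zero] using eqOn_hull h₁ h₂ (interior_subset hx₁) hx₂)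
  exact sub_eq_zero.1 this

lemma eq_of_eqOn_spanning {s : Set E} (hs : affineSpan ℝ s = ⊤) (h : ∀ v ∈ s, ℓ₁ v = ℓ₂ v) :
    ℓ₁ = ℓ₂ :=
  AffineMap.ext_on hs h

lemma affineSpan_eq_top_iff_dim {s : Set E} (hs : s.Nonempty) :
    affineSpan ℝ s = ⊤ ↔ dim s = finrank ℝ E := by
  rw [AffineSubspace.affineSpan_eq_top_iff_vectorSpan_eq_top_of_nonempty ℝ E E hs, dim]
  constructor
  · intro h; rw [h, finrank_top]
  · intro h; exact Submodule.eq_top_of_finrank_eq h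

lemma dim_convexHull (s : Set E) : dim (convexHull ℝ s) = dim s := by
  unfold dim
  rw [← direction_affineSpan, affineSpan_convexHull, direction_affineSpan]

lemma linear_eq_zero_of_mem_vectorSpan {s : Set E} (g : E →ᵃ[ℝ] ℝ) (h : ∀ v ∈ s, g v = 0)
    {u : E} (hu : u ∈ vectorSpan ℝ s) : g.linear u = 0 := by
  have : vectorSpan ℝ s ≤ LinearMap.ker g.linear := by
    rw [vectorSpan_def, Submodule.span_le]
    rintro _ ⟨a, ha, b, hb, rfl⟩
    simp only [SetLike.mem_coe, LinearMap.mem_ker]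
    rw [vsub_eq_sub, ← vsub_eq_sub, g.linearMap_vsub, h a ha, h b hb, vsub_eq_sub, sub_self]
  exact this hu

/-- Two affine maps vanishing on a set of codimension one are proportional. -/
lemma exists_smul_eq_of_codim_one {s : Set E} (hs : s.Nonempty) (hd : dim s + 1 = finrank ℝ E)
    {g h : E →ᵃ[ℝ] ℝ} (hg : ∀ v ∈ s, g v = 0) (hh : ∀ v ∈ s, h v = 0) (hne : g ≠ 0) :
    ∃ c : ℝ, h = c • g := by
  obtain ⟨v, hv⟩ := hs
  have hgv : ∀ (k : E →ᵃ[ℝ] ℝ), k v = 0 → ∀ x, k x = k.linear (x - v) := by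
    intro k hk x
    have := k.map_vadd v (x - v)
    rw [vadd_eq_add, vadd_eq_add, sub_add_cancel, hk] at this
    simpa using this
  have hlin : g.linear ≠ 0 := by
    intro h0
    apply hne
    ext x
    rw [hgv g (hg v hv), h0]; simp
  have hker : vectorSpan ℝ s = LinearMap.ker g.linear := by
    apply Submodule.eq_of_le_of_finrank_eq
    · intro u hu; exact linear_eq_zero_of_mem_vectorSpan g hg hu
    · have h1 := Module.Dual.finrank_ker_add_one_of_ne_zero (f := g.linear) hlin
      unfold dim at hd
      omega
  obtain ⟨p, hp⟩ : ∃ p, g.linear p ≠ 0 := by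
    by_contra hcon
    push Not at hcon
    exact hlin (LinearMap.ext hcon)
  refine ⟨h.linear p / g.linear p, ?_⟩
  ext x
  have hmem : (x - v) - (g.linear (x - v) / g.linear p) • p ∈ vectorSpan ℝ s := by
    rw [hker, LinearMap.mem_ker, map_sub, map_smul, smul_eq_mul, div_mul_cancel₀ _ hp, sub_self]
  have := linear_eq_zero_of_mem_vectorSpan h hh hmem
  rw [map_sub, map_smul, smul_eq_mul, sub_eq_zero] at this
  rw [hgv h (hh v hv), this, AffineMap.coe_smul, Pi.smul_apply, hgv g (hg v hv), smul_eq_mul]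
  field_simp

lemma exists_affineBasis_subset {s : Set E} (hs : affineSpan ℝ s = ⊤) :
    ∃ b : AffineBasis (Fin (finrank ℝ E + 1)) ℝ E, ∀ i, b i ∈ s := by
  obtain ⟨t, hts, hsp, hind⟩ := exists_affineIndependent ℝ E s
  let b0 : AffineBasis t ℝ E := ⟨_, hind, by rw [Subtype.range_coe, hsp, hs]⟩
  have : Finite t := finite_set_of_fin_dim_affineIndependent ℝ hind
  have : Fintype t := Fintype.ofFinite t
  have hcard : Fintype.card t = finrank ℝ E + 1 := b0.card_eq_finrank_add_one
  refine ⟨b0.reindex (Fintype.equivFinOfCardEq hcard), fun i => ?_⟩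
  simp only [AffineBasis.coe_reindex, Function.comp_apply]
  exact hts (Subtype.mem _)

/-- The affine map with prescribed values at the points of an affine basis. -/
def interp {ι : Type*} [Fintype ι] (b : AffineBasis ι ℝ E) (f : E → ℝ) : E →ᵃ[ℝ] ℝ :=
  ∑ i, f (b i) • b.coord i

lemma interp_apply {ι : Type*} [Fintype ι] (b : AffineBasis ι ℝ E) (f : E → ℝ) (x : E) :
    interp b f x = ∑ i, f (b i) * b.coord i x := by
  unfold interp
  induction (Finset.univ : Finset ι) using Finset.cons_induction with
  | empty => simp
  | cons a s ha ih => rw [Finset.sum_cons, Finset.sum_cons, AffineMap.coe_add, Pi.add_apply, ih]; simp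

lemma interp_eq {ι : Type*} [Fintype ι] (b : AffineBasis ι ℝ E) (f : E → ℝ) (ℓ : E →ᵃ[ℝ] ℝ)
    (h : ∀ i, f (b i) = ℓ (b i)) : interp b f = ℓ := by
  classical
  apply AffineMap.ext_on b.tot
  rintro _ ⟨i, rfl⟩
  rw [interp_apply]
  simp [AffineBasis.coord_apply, h]

end Minorants

/-! ### Quadratic forms in the rational closure -/

section Forms

variable {d : ℕ}

/-- Integral vectors as real vectors. -/
def intVec (z : Fin d → ℤ) : Fin d → ℝ := fun i => (z i : ℝ)

lemma qval_add_form (A B : Mat d) (x : Fin d → ℝ) : qval (A + B) x = qval A x + qval B x := by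
  simp [qval, Matrix.add_mulVec, dotProduct_add]

lemma qval_sub_form (A B : Mat d) (x : Fin d → ℝ) : qval (A - B) x = qval A x - qval B x := by
  simp [qval, Matrix.sub_mulVec, dotProduct_sub]

lemma qval_smul_form (c : ℝ) (A : Mat d) (x : Fin d → ℝ) : qval (c • A) x = c * qval A x := by
  simp [qval, Matrix.smul_mulVec, dotProduct_smul]

lemma qval_zero_form (x : Fin d → ℝ) : qval (0 : Mat d) x = 0 := by simp [qval]

lemma qval_sub {Q : Mat d} (hQ : Q.IsSymm) (x y : Fin d → ℝ) :
    qval Q (x - y) = qval Q x - 2 * ((Q *ᵥ x) ⬝ᵥ y) + qval Q y := by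
  have h1 : x ⬝ᵥ Q *ᵥ y = (Q *ᵥ x) ⬝ᵥ y := by
    rw [Matrix.dotProduct_mulVec, ← Matrix.mulVec_transpose, hQ.eq]
  have h2 : y ⬝ᵥ Q *ᵥ x = (Q *ᵥ x) ⬝ᵥ y := dotProduct_comm _ _
  simp only [qval, Matrix.mulVec_sub, dotProduct_sub, sub_dotProduct]
  rw [h1, h2]; ring

lemma continuous_qval_form (x : Fin d → ℝ) : Continuous fun Q : Mat d => qval Q x := by
  unfold qval; fun_prop

/-- The form `Q` is the square of the norm after a linear map `π` which maps `L` to a locally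
finite set and whose kernel is rational. -/
structure Good {d : ℕ} {W : Type*} [NormedAddCommGroup W] [NormedSpace ℝ W]
    (L : Set (Fin d → ℝ)) (Q : Mat d) (π : (Fin d → ℝ) →ₗ[ℝ] W) : Prop where
  qval_eq : ∀ x, qval Q x = ‖π x‖ ^ 2
  finite : ∀ ρ : ℝ, (π '' L ∩ Metric.closedBall 0 ρ).Finite
  ker_le : ∀ x, π x = 0 → x ∈ Submodule.span ℝ {u | π u = 0 ∧ ∃ z : Fin d → ℤ, u = intVec z}

/-- A nonempty set invariant under integral translations. -/
structure Periodic {d : ℕ} (L : Set (Fin d → ℝ)) : Prop where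
  nonempty : L.Nonempty
  add_mem : ∀ v ∈ L, ∀ z : Fin d → ℤ, v + intVec z ∈ L

lemma IsStandardPeriodic.periodic {L : Set (Fin d → ℝ)} (hL : IsStandardPeriodic L) :
    Periodic L := by
  obtain ⟨S, ⟨t, ht⟩, rfl⟩ := hL
  refine ⟨⟨t, t, ht, 0, by ext; simp⟩, ?_⟩
  rintro _ ⟨s, hs, z, rfl⟩ z'
  refine ⟨s, hs, z + z', ?_⟩
  ext i
  simp [intVec, add_assoc]

/-- An injective linear map in finite dimension is bounded below, so a bounded image forces the
integers into a box. -/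
lemma finite_image_mulVec {k : ℕ} (B : Matrix (Fin k) (Fin k) ℝ) (hB : IsUnit B)
    (s : Fin k → ℝ) (ρ : ℝ) :
    {n : Fin k → ℤ | ‖WithLp.toLp 2 (B *ᵥ (s + intVec n))‖ ≤ ρ}.Finite := by
  let f : (Fin k → ℝ) →ₗ[ℝ] EuclideanSpace ℝ (Fin k) :=
    (WithLp.linearEquiv 2 ℝ (Fin k → ℝ)).symm.toLinearMap ∘ₗ Matrix.mulVecLin B
  have hf : ∀ x, f x = WithLp.toLp 2 (B *ᵥ x) := fun x => rfl
  have hker : LinearMap.ker f = ⊥ := by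
    rw [LinearMap.ker_eq_bot]
    intro x y hxy
    rw [hf, hf] at hxy
    have := (WithLp.toLp_injective 2) hxy
    exact Matrix.mulVec_injective_of_isUnit hB this
  obtain ⟨K, hK, hanti⟩ := f.exists_antilipschitzWith hker
  have hb : ∀ x, ‖x‖ ≤ K * ‖f x‖ := fun x => by
    have := hanti.le_mul_dist x 0
    simpa [dist_zero_right] using this
  have hfin : (Set.univ.pi fun i : Fin k =>
      Set.Icc ⌈-(K * ρ) - s i⌉ ⌊K * ρ - s i⌋).Finite :=
    Set.Finite.pi fun i => Set.finite_Icc _ _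
  refine hfin.subset ?_
  intro n hn i _
  have hn' : ‖f (s + intVec n)‖ ≤ ρ := hn
  have h1 : |s i + n i| ≤ K * ρ := by
    calc |s i + n i| = ‖(s + intVec n) i‖ := rfl
      _ ≤ ‖s + intVec n‖ := norm_le_pi_norm _ i
      _ ≤ K * ‖f (s + intVec n)‖ := hb _
      _ ≤ K * ρ := by gcongr
  rw [abs_le] at h1
  constructor
  · rw [Int.ceil_le]; linarith
  · rw [Int.le_floor]; linarith

lemma dotProduct_reindex_mulVec {m k : ℕ} (e : Fin m ⊕ Fin k ≃ Fin d)
    (R : Matrix (Fin k) (Fin k) ℝ) (y y' : Fin d → ℝ) :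
    y' ⬝ᵥ (Matrix.reindex e e (Matrix.fromBlocks 0 0 0 R) *ᵥ y) =
      (fun j => y' (e (Sum.inr j))) ⬝ᵥ (R *ᵥ fun j => y (e (Sum.inr j))) := by
  rw [Matrix.reindex_apply]
  simp only [dotProduct, Matrix.mulVec]
  rw [← e.sum_comp, Fintype.sum_sum_type]
  simp only [← e.sum_comp (fun x => _ * y x), Fintype.sum_sum_type]
  simp

-- With R = Bᵗ B, the map π applies U⁻¹, drops the coordinates of the zero block and applies B. As
-- U⁻¹ is integral, the vertices go to finitely many translates of a lattice.
open scoped MatrixOrder in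
lemma exists_good {L : Set (Fin d → ℝ)} (hL : IsStandardPeriodic L) {Q : Mat d}
    (hQ : Q ∈ rationalClosure d) :
    ∃ (k : ℕ) (π : (Fin d → ℝ) →ₗ[ℝ] EuclideanSpace ℝ (Fin k)), Good L Q π := by
  obtain ⟨m, k, e, U, R, hU, hR, hblock⟩ := hQ
  obtain ⟨B, hB⟩ : ∃ B : Matrix (Fin k) (Fin k) ℝ, R = star B * B :=
    CStarAlgebra.nonneg_iff_eq_star_mul_self.1 hR.posSemidef.nonneg
  have hBu : IsUnit B := by
    have := hR.isUnit
    rw [hB] at this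
    exact isUnit_of_mul_isUnit_right this
  set Ur : Mat d := U.map (Int.cast : ℤ → ℝ) with hUr
  set V : Matrix (Fin d) (Fin d) ℤ := U⁻¹ with hV
  set Vr : Mat d := V.map (Int.cast : ℤ → ℝ) with hVr
  have hUV : Ur * Vr = 1 := by
    have h1 : U * V = 1 := Matrix.mul_nonsing_inv U hU
    have h2 := congrArg (fun M : Matrix (Fin d) (Fin d) ℤ => M.map (Int.castRingHom ℝ)) h1
    simp only [Matrix.map_mul] at h2
    rw [Matrix.map_one _ (map_zero _) (map_one _)] at h2
    exact h2
  have hVU : Vr * Ur = 1 := mul_eq_one_comm.1 hUV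
  have hVint : ∀ z : Fin d → ℤ, Vr *ᵥ intVec z = intVec (V *ᵥ z) := by
    intro z; ext i
    simp [intVec, Matrix.mulVec, dotProduct, hVr]
  have hq : ∀ x, qval Q x =
      (fun j => (Vr *ᵥ x) (e (Sum.inr j))) ⬝ᵥ (R *ᵥ fun j => (Vr *ᵥ x) (e (Sum.inr j))) := by
    intro x
    have hx : x = Ur *ᵥ (Vr *ᵥ x) := by rw [Matrix.mulVec_mulVec, hUV, Matrix.one_mulVec]
    rw [← dotProduct_reindex_mulVec e R, ← hblock]
    unfold qval
    conv_lhs => rw [hx]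
    rw [← Matrix.mulVec_mulVec, ← Matrix.mulVec_mulVec, Matrix.dotProduct_mulVec _ Urᵀ,
      Matrix.vecMul_transpose]
  let p : (Fin d → ℝ) →ₗ[ℝ] (Fin k → ℝ) :=
    LinearMap.funLeft ℝ ℝ (fun j => e (Sum.inr j)) ∘ₗ Matrix.mulVecLin Vr
  have hp : ∀ x, p x = fun j => (Vr *ᵥ x) (e (Sum.inr j)) := fun x => rfl
  let π : (Fin d → ℝ) →ₗ[ℝ] EuclideanSpace ℝ (Fin k) :=
    (WithLp.linearEquiv 2 ℝ (Fin k → ℝ)).symm.toLinearMap ∘ₗ Matrix.mulVecLin B ∘ₗ p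
  have hπ : ∀ x, π x = WithLp.toLp 2 (B *ᵥ p x) := fun x => rfl
  have hπ0 : ∀ x, π x = 0 ↔ p x = 0 := by
    intro x
    rw [hπ, WithLp.toLp_eq_zero]
    constructor
    · intro h
      exact Matrix.mulVec_injective_of_isUnit hBu (by rw [h, Matrix.mulVec_zero])
    · intro h; rw [h, Matrix.mulVec_zero]
  refine ⟨k, π, ⟨?_, ?_, ?_⟩⟩
  · intro x
    rw [hq, hπ, EuclideanSpace.norm_sq_eq, ← hp, hB, ← Matrix.mulVec_mulVec,
      Matrix.dotProduct_mulVec, Matrix.star_eq_conjTranspose, Matrix.conjTranspose_eq_transpose_of_trivial,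
      Matrix.vecMul_transpose]
    simp [dotProduct, sq]
  · intro ρ
    obtain ⟨S, _, rfl⟩ := hL
    have hfin : (⋃ t ∈ S, (fun n : Fin k → ℤ => (WithLp.toLp 2 (B *ᵥ (p t + intVec n)) :
        EuclideanSpace ℝ (Fin k))) ''
        {n | ‖WithLp.toLp 2 (B *ᵥ (p t + intVec n))‖ ≤ ρ}).Finite :=
      S.finite_toSet.biUnion fun t _ => (finite_image_mulVec B hBu (p t) ρ).image _
    refine hfin.subset ?_
    rintro _ ⟨⟨x, ⟨t, ht, z, rfl⟩, rfl⟩, hx⟩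
    rw [mem_closedBall_zero_iff] at hx
    have e1 : π (t + fun i => (z i : ℝ)) =
        WithLp.toLp 2 (B *ᵥ (p t + intVec fun j => (V *ᵥ z) (e (Sum.inr j)))) := by
      rw [hπ, map_add]
      congr 3
      have : p (fun i => (z i : ℝ)) = fun j => (Vr *ᵥ intVec z) (e (Sum.inr j)) := rfl
      rw [this, hVint]
      rfl
    rw [e1] at hx ⊢
    exact Set.mem_biUnion ht ⟨_, hx, rfl⟩
  -- Expand x in the columns of U: those of the zero block are integral and killed by π, and the
  -- coefficients of the others vanish.
  · intro x hx
    rw [hπ0] at hx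
    have hx' : x = Ur *ᵥ (Vr *ᵥ x) := by rw [Matrix.mulVec_mulVec, hUV, Matrix.one_mulVec]
    rw [hx', Matrix.mulVec_eq_sum]
    refine Submodule.sum_mem _ fun j _ => ?_
    obtain ⟨j', rfl⟩ := e.surjective j
    rcases j' with i | i
    · rw [op_smul_eq_smul]
      refine Submodule.smul_mem _ _ (Submodule.subset_span ⟨?_, fun l => U l (e (Sum.inl i)), ?_⟩)
      · rw [hπ0, hp]
        ext j
        have : (Vr *ᵥ Urᵀ (e (Sum.inl i))) (e (Sum.inr j)) =
            (Vr * Ur) (e (Sum.inr j)) (e (Sum.inl i)) := rfl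
        rw [this, hVU, Matrix.one_apply_ne]
        · rfl
        · simp
      · ext l; simp [intVec, hUr]
    · have : (Vr *ᵥ x) (e (Sum.inr i)) = 0 := congrFun hx i
      rw [this]
      simp

lemma qval_nonneg_of_mem_rationalClosure {Q : Mat d} (hQ : Q ∈ rationalClosure d) : ∀ x, 0 ≤ qval Q x := by
  intro x
  -- Any standard periodic set serves here; ℤᵈ is chosen.
  obtain ⟨k, π, h⟩ := exists_good (L := {x | ∃ t ∈ ({0} : Finset (Fin d → ℝ)),
    ∃ z : Fin d → ℤ, x = t + fun i => (z i : ℝ)}) ⟨{0}, by simp, rfl⟩ hQ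
  rw [h.qval_eq]; positivity

end Forms

/-! ### Minorants of good forms -/

section GoodForms

variable {d : ℕ} {W : Type*} [NormedAddCommGroup W] [NormedSpace ℝ W] [FiniteDimensional ℝ W]
  {L : Set (Fin d → ℝ)} {Q : Mat d} {π : (Fin d → ℝ) →ₗ[ℝ] W} {ℓ : (Fin d → ℝ) →ᵃ[ℝ] ℝ}

lemma affineMap_apply_add {E : Type*} [AddCommGroup E] [Module ℝ E] (g : E →ᵃ[ℝ] ℝ) (x u : E) :
    g (x + u) = g x + g.linear u := by
  have := g.map_vadd x u
  rw [vadd_eq_add, vadd_eq_add] at this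
  rw [add_comm, this, add_comm]

lemma affineMap_apply_eq {E : Type*} [AddCommGroup E] [Module ℝ E] (g : E →ᵃ[ℝ] ℝ) (x : E) :
    g x = g 0 + g.linear x := by
  rw [← affineMap_apply_add, zero_add]

lemma affineMap_eq_of_sub_mem_ker {π : (Fin d → ℝ) →ₗ[ℝ] W} (g : (Fin d → ℝ) →ᵃ[ℝ] ℝ)
    (hg : ∀ x, π x = 0 → g.linear x = 0) {x y : Fin d → ℝ} (h : π x = π y) : g x = g y := by
  have := hg (x - y) (by rw [map_sub, h, sub_self])
  rw [affineMap_apply_eq g x, affineMap_apply_eq g y]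
  rw [map_sub, sub_eq_zero] at this
  rw [this]

/-- A functional that kills the kernel of π factors through π, and the factor is bounded. -/
lemma exists_bound_of_ker_le (π : (Fin d → ℝ) →ₗ[ℝ] W) (φ : (Fin d → ℝ) →ₗ[ℝ] ℝ)
    (h : ∀ x, π x = 0 → φ x = 0) : ∃ C : ℝ, 0 ≤ C ∧ ∀ x, |φ x| ≤ C * ‖π x‖ := by
  have hmem : φ ∈ LinearMap.range π.dualMap := by
    rw [LinearMap.range_dualMap_eq_dualAnnihilator_ker, Submodule.mem_dualAnnihilator]
    exact fun x hx => h x hx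
  obtain ⟨ψ, rfl⟩ := hmem
  refine ⟨‖LinearMap.toContinuousLinearMap ψ‖, norm_nonneg _, fun x => ?_⟩
  have := (LinearMap.toContinuousLinearMap ψ).le_opNorm (π x)
  simpa using this

lemma Good.qval_congr (hG : Good L Q π) {x y : Fin d → ℝ} (h : π x = π y) :
    qval Q x = qval Q y := by
  rw [hG.qval_eq, hG.qval_eq, h]

lemma Good.qval_eq_zero (hG : Good L Q π) {x : Fin d → ℝ} : qval Q x = 0 ↔ π x = 0 := by
  rw [hG.qval_eq]; simp

/-- Along an integral kernel direction Q is constant on vertices, while ℓ would be unbounded above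
unless its slope is zero. Such directions span the kernel. -/
lemma Minorant.linear_eq_zero (hL : Periodic L) (hG : Good L Q π) (hℓ : Minorant L (qval Q) ℓ)
    (x : Fin d → ℝ) (hx : π x = 0) : ℓ.linear x = 0 := by
  have key : Submodule.span ℝ {u | π u = 0 ∧ ∃ z : Fin d → ℤ, u = intVec z} ≤
      LinearMap.ker ℓ.linear := by
    rw [Submodule.span_le]
    rintro u ⟨hu, z, rfl⟩
    obtain ⟨v, hv⟩ := hL.nonempty
    have hb : ∀ n : ℤ, ℓ v + n * ℓ.linear (intVec z) ≤ qval Q v := by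
      intro n
      have e : intVec (n • z) = (n : ℝ) • intVec z := by ext i; simp [intVec]
      have h1 := hℓ _ (hL.add_mem v hv (n • z))
      rw [e, affineMap_apply_add, map_smul, smul_eq_mul] at h1
      rwa [hG.qval_congr (y := v)] at h1
      rw [map_add, map_smul, hu, smul_zero, add_zero]
    have hℓv := hb 0
    by_contra hne
    have hne' : ℓ.linear (intVec z) ≠ 0 := hne
    obtain ⟨n, hn⟩ := exists_int_gt ((qval Q v - ℓ v) / |ℓ.linear (intVec z)|)
    rw [div_lt_iff₀ (abs_pos.2 hne')] at hn
    rcases le_total 0 (ℓ.linear (intVec z)) with h0 | h0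
    · have := hb n
      rw [abs_of_nonneg h0] at hn
      linarith
    · have := hb (-n)
      rw [abs_of_nonpos h0] at hn
      push_cast at this
      linarith
  exact key (hG.ker_le x hx)

lemma Minorant.apply_congr (hL : Periodic L) (hG : Good L Q π) (hℓ : Minorant L (qval Q) ℓ)
    {x y : Fin d → ℝ} (h : π x = π y) : ℓ x = ℓ y :=
  affineMap_eq_of_sub_mem_ker ℓ (hℓ.linear_eq_zero hL hG) h

lemma Minorant.mem_contact_congr (hL : Periodic L) (hG : Good L Q π)
    (hℓ : Minorant L (qval Q) ℓ) {x y : Fin d → ℝ} (h : π x = π y)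
    (hx : x ∈ contact L (qval Q) ℓ) (hy : y ∈ L) : y ∈ contact L (qval Q) ℓ := by
  refine ⟨hy, ?_⟩
  rw [← hG.qval_congr h, ← hℓ.apply_congr hL hG h]
  exact hx.2

/-- A minorant may be tilted in every direction which is nonpositive on the contact set. -/
lemma Minorant.exists_tilt (hL : Periodic L) (hG : Good L Q π) (hℓ : Minorant L (qval Q) ℓ)
    (h : (Fin d → ℝ) →ᵃ[ℝ] ℝ) (hk : ∀ x, π x = 0 → h.linear x = 0)
    (hc : ∀ v ∈ contact L (qval Q) ℓ, h v ≤ 0) :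
    ∃ ε : ℝ, 0 < ε ∧ Minorant L (qval Q) (ℓ + ε • h) := by
  obtain ⟨A, hA0, hA⟩ := exists_bound_of_ker_le π ℓ.linear (hℓ.linear_eq_zero hL hG)
  obtain ⟨B, hB0, hB⟩ := exists_bound_of_ker_le π h.linear hk
  -- Beyond radius ρ the square of ‖π v‖ beats the linear growth of ℓ and h, so any ε < 1 is
  -- harmless there.
  set ρ : ℝ := A + |ℓ 0| + |h 0| + B + 1 with hρ
  have hfar : ∀ v ∈ L, ρ < ‖π v‖ → h v ≤ qval Q v - ℓ v := by
    intro v hv hr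
    have h1 := (abs_le.1 (hA v)).2
    have h2 := (abs_le.1 (hB v)).2
    rw [hG.qval_eq, affineMap_apply_eq h v, affineMap_apply_eq ℓ v]
    have h3 := le_abs_self (ℓ 0)
    have h4 := le_abs_self (h 0)
    have h5 := abs_nonneg (ℓ 0)
    have h6 := abs_nonneg (h 0)
    have h7 : 1 ≤ ‖π v‖ := by linarith
    nlinarith
  -- All quantities depend on v only through π v, which takes finitely many values in the ball. Each
  -- value imposes a condition that holds for small ε.
  have hnear : ∀ᶠ ε : ℝ in nhdsWithin 0 (Set.Ioi 0), ∀ w ∈ π '' L ∩ Metric.closedBall 0 ρ,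
      ∀ v ∈ L, π v = w → ε * h v ≤ qval Q v - ℓ v := by
    rw [Filter.eventually_all_finite (hG.finite ρ)]
    rintro w ⟨⟨v₀, hv₀, rfl⟩, -⟩
    have hred : ∀ᶠ ε : ℝ in nhdsWithin 0 (Set.Ioi 0), ε * h v₀ ≤ qval Q v₀ - ℓ v₀ := by
      by_cases hpos : h v₀ ≤ 0
      · filter_upwards [self_mem_nhdsWithin] with ε hε
        have h1 := hℓ v₀ hv₀
        have h2 : ε * h v₀ ≤ 0 := mul_nonpos_of_nonneg_of_nonpos (le_of_lt hε) hpos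
        linarith
      · have hlt : 0 < qval Q v₀ - ℓ v₀ := by
          have h1 := hℓ v₀ hv₀
          rcases h1.lt_or_eq with h2 | h2
          · linarith
          · exact absurd (hc v₀ ⟨hv₀, h2.symm⟩) hpos
        have hcont : Filter.Tendsto (fun ε : ℝ => ε * h v₀) (nhdsWithin 0 (Set.Ioi 0))
            (nhds (0 * h v₀)) :=
          (Continuous.tendsto (by fun_prop) 0).mono_left nhdsWithin_le_nhds
        rw [zero_mul] at hcont
        exact (hcont.eventually_lt_const hlt).mono fun ε hε => hε.le
    filter_upwards [hred] with ε hε v hv hvw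
    rw [hG.qval_congr hvw, hℓ.apply_congr hL hG hvw, affineMap_eq_of_sub_mem_ker h hk hvw]
    exact hε
  have hsmall : ∀ᶠ ε : ℝ in nhdsWithin 0 (Set.Ioi 0), ε < 1 :=
    (eventually_lt_nhds one_pos).filter_mono nhdsWithin_le_nhds
  obtain ⟨ε, h1, h2, h3⟩ := (hnear.and (hsmall.and self_mem_nhdsWithin)).exists
  have h3' : 0 < ε := h3
  refine ⟨ε, h3', fun v hv => ?_⟩
  simp only [AffineMap.coe_add, AffineMap.coe_smul, Pi.add_apply, Pi.smul_apply, smul_eq_mul]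
  by_cases hr : ‖π v‖ ≤ ρ
  · have := h1 (π v) ⟨⟨v, hv, rfl⟩, by simpa using hr⟩ v hv rfl
    linarith
  · have h4 := hfar v hv (not_le.1 hr)
    have h5 := hℓ v hv
    by_cases h6 : 0 ≤ h v
    · nlinarith
    · nlinarith

/-- A quadratic function of ‖π v‖ can equal one of linear growth only in a bounded region. -/
lemma Minorant.finite_image_contact (hL : Periodic L) (hG : Good L Q π)
    (hℓ : Minorant L (qval Q) ℓ) : (π '' contact L (qval Q) ℓ).Finite := by
  obtain ⟨A, hA0, hA⟩ := exists_bound_of_ker_le π ℓ.linear (hℓ.linear_eq_zero hL hG)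
  refine (hG.finite (A + |ℓ 0| + 1)).subset ?_
  rintro _ ⟨v, hv, rfl⟩
  refine ⟨⟨v, hv.1, rfl⟩, ?_⟩
  rw [mem_closedBall_zero_iff]
  by_contra hcon
  push Not at hcon
  have h1 := (abs_le.1 (hA v)).2
  have h2 := hv.2
  rw [hG.qval_eq, affineMap_apply_eq ℓ v] at h2
  have h3 := le_abs_self (ℓ 0)
  have h5 := abs_nonneg (ℓ 0)
  nlinarith

/-- Integral kernel translations permute the contact points. Convexity fills in real multiples
between consecutive integer ones, and the kernel is spanned by such vectors. -/
lemma Minorant.hull_add_mem (hL : Periodic L) (hG : Good L Q π) (hℓ : Minorant L (qval Q) ℓ)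
    {x u : Fin d → ℝ} (hx : x ∈ hull L (qval Q) ℓ) (hu : π u = 0) :
    x + u ∈ hull L (qval Q) ℓ := by
  have hint : ∀ z : Fin d → ℤ, π (intVec z) = 0 → ∀ y ∈ hull L (qval Q) ℓ,
      y + intVec z ∈ hull L (qval Q) ℓ := by
    intro z hz y hy
    have : hull L (qval Q) ℓ ⊆ (fun y => y + intVec z) ⁻¹' hull L (qval Q) ℓ := by
      apply convexHull_min
      · intro v hv
        apply subset_convexHull
        exact hℓ.mem_contact_congr hL hG (by rw [map_add, hz, add_zero]) hv (hL.add_mem v hv.1 z)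
      · exact convex_hull.translate_preimage_left _
    exact this hy
  have hspan := hG.ker_le u hu
  clear hu
  suffices ∀ c : ℝ, ∀ y ∈ hull L (qval Q) ℓ, y + c • u ∈ hull L (qval Q) ℓ by
    simpa using this 1 x hx
  induction hspan using Submodule.span_induction with
  | mem u hu' =>
    obtain ⟨h0, z, rfl⟩ := hu'
    intro c y hy
    have hn : ∀ n : ℤ, y + (n : ℝ) • intVec z ∈ hull L (qval Q) ℓ := by
      intro n
      have e : intVec (n • z) = (n : ℝ) • intVec z := by ext i; simp [intVec]
      rw [← e]
      exact hint _ (by rw [e, map_smul, h0, smul_zero]) y hy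
    have h1 := hn ⌊c⌋
    have h2 := hn (⌊c⌋ + 1)
    have := convex_hull h1 h2 (a := 1 - Int.fract c) (b := Int.fract c)
      (by linarith [Int.fract_lt_one c]) (Int.fract_nonneg c) (by ring)
    convert this using 1
    rw [Int.fract]
    push_cast
    module
  | zero => intro c y hy; simpa using hy
  | add u u' _ _ ih ih' =>
    intro c y hy
    rw [smul_add, ← add_assoc]
    exact ih' c _ (ih c y hy)
  | smul a u _ ih =>
    intro c y hy
    rw [smul_smul]
    exact ih (c * a) y hy

/-- A cell may be unbounded, but only along the kernel: modulo it, the cell is a polytope.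
Closedness follows. -/
lemma Minorant.hull_eq_preimage (hL : Periodic L) (hG : Good L Q π)
    (hℓ : Minorant L (qval Q) ℓ) :
    hull L (qval Q) ℓ = π ⁻¹' convexHull ℝ (π '' contact L (qval Q) ℓ) := by
  rw [← LinearMap.image_convexHull]
  apply Set.Subset.antisymm
  · exact Set.subset_preimage_image _ _
  · rintro x ⟨y, hy, hxy⟩
    have := hℓ.hull_add_mem hL hG (x := y) (u := x - y) hy (by rw [map_sub, hxy, sub_self])
    simpa using this

lemma Minorant.isClosed_hull (hL : Periodic L) (hG : Good L Q π) (hℓ : Minorant L (qval Q) ℓ) :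
    IsClosed (hull L (qval Q) ℓ) := by
  rw [hℓ.hull_eq_preimage hL hG]
  exact (Set.Finite.isCompact_convexHull ℝ (hℓ.finite_image_contact hL hG)).isClosed.preimage
    (LinearMap.continuous_of_finiteDimensional π)

/-- The affine map `x ↦ a ⬝ᵥ x + b`. -/
def affMap (a : Fin d → ℝ) (b : ℝ) : (Fin d → ℝ) →ᵃ[ℝ] ℝ :=
  (dotProductBilin ℝ ℝ a).toAffineMap + AffineMap.const ℝ _ b

lemma affMap_apply (a : Fin d → ℝ) (b : ℝ) (x : Fin d → ℝ) : affMap a b x = a ⬝ᵥ x + b := by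
  simp [affMap]

lemma exists_eq_affMap (ℓ : (Fin d → ℝ) →ᵃ[ℝ] ℝ) : ∃ a b, ℓ = affMap a b := by
  refine ⟨fun i => ℓ.linear (Pi.single i 1), ℓ 0, ?_⟩
  ext x
  rw [affMap_apply, affineMap_apply_eq, add_comm]
  congr 1
  conv_lhs => rw [pi_eq_sum_univ' x, map_sum]
  simp only [dotProduct, map_smul, smul_eq_mul]
  refine Finset.sum_congr rfl fun i _ => ?_
  rw [mul_comm]

/-- Vertices surrounding x bound the slope of every minorant that is nonnegative at x, so the value
at x is maximised over a compact set. -/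
lemma exists_max_minorant (hL : Periodic L) (hQ : ∀ x, 0 ≤ qval Q x) (x : Fin d → ℝ) :
    ∃ ℓ, Minorant L (qval Q) ℓ ∧ ∀ ℓ', Minorant L (qval Q) ℓ' → ℓ' x ≤ ℓ x := by
  obtain ⟨t, ht⟩ := hL.nonempty
  -- For each sign pattern, t + n σ overshoots x by at least one in every coordinate. The pattern
  -- matching the signs of a slope a then bounds the sum of the |a j|.
  let n : (Fin d → Bool) → Fin d → ℤ := fun σ i =>
    if σ i then ⌈x i - t i⌉ + 1 else ⌊x i - t i⌋ - 1
  set C : ℝ := ∑ σ, qval Q (t + intVec (n σ)) with hC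
  -- Demanding a nonnegative value at x costs nothing, because zero is a minorant.
  set S : Set ((Fin d → ℝ) × ℝ) :=
    {p | (∀ v ∈ L, p.1 ⬝ᵥ v + p.2 ≤ qval Q v) ∧ 0 ≤ p.1 ⬝ᵥ x + p.2} with hS
  have habs : ∀ p ∈ S, ∀ i, |p.1 i| ≤ C := by
    rintro ⟨a, b⟩ ⟨hp, hp0⟩ i
    simp only at hp hp0
    let σ : Fin d → Bool := fun j => decide (0 ≤ a j)
    have h1 := hp _ (hL.add_mem t ht (n σ))
    have h2 : qval Q (t + intVec (n σ)) ≤ C :=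
      Finset.single_le_sum (f := fun σ => qval Q (t + intVec (n σ))) (fun σ _ => hQ _)
        (Finset.mem_univ σ)
    have h3 : ∑ j, |a j| ≤ a ⬝ᵥ (t + intVec (n σ)) - a ⬝ᵥ x := by
      rw [← dotProduct_sub]
      refine Finset.sum_le_sum fun j _ => ?_
      simp only [Pi.sub_apply, Pi.add_apply, intVec, n, σ, decide_eq_true_eq]
      split_ifs with h
      · rw [abs_of_nonneg h]
        push_cast
        have := Int.le_ceil (x j - t j)
        nlinarith
      · push Not at h
        rw [abs_of_neg h]
        push_cast
        have := Int.floor_le (x j - t j)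
        nlinarith
    have h4 : |a i| ≤ ∑ j, |a j| :=
      Finset.single_le_sum (f := fun j => |a j|) (fun j _ => abs_nonneg _) (Finset.mem_univ i)
    show |a i| ≤ C
    linarith
  have hdot : ∀ p ∈ S, ∀ y : Fin d → ℝ, |p.1 ⬝ᵥ y| ≤ ∑ i, C * |y i| := by
    intro p hp y
    refine (Finset.abs_sum_le_sum_abs _ _).trans (Finset.sum_le_sum fun i _ => ?_)
    rw [abs_mul]
    exact mul_le_mul_of_nonneg_right (habs p hp i) (abs_nonneg _)
  have hSc : IsCompact S := by
    have hbox : IsCompact (Set.Icc (fun _ : Fin d => -C) (fun _ => C) ×ˢ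
        Set.Icc (-∑ i, C * |x i|) (qval Q t + ∑ i, C * |t i|)) :=
      isCompact_Icc.prod isCompact_Icc
    refine hbox.of_isClosed_subset ?_ ?_
    · have h1 : IsClosed {p : (Fin d → ℝ) × ℝ | ∀ v ∈ L, p.1 ⬝ᵥ v + p.2 ≤ qval Q v} := by
        simp only [Set.ofPred_forall]
        refine isClosed_iInter fun v => isClosed_iInter fun _ => isClosed_le ?_ continuous_const
        fun_prop
      have h2 : IsClosed {p : (Fin d → ℝ) × ℝ | 0 ≤ p.1 ⬝ᵥ x + p.2} :=
        isClosed_le continuous_const (by fun_prop)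
      exact h1.inter h2
    · intro p hp
      have h0 := habs p hp
      refine ⟨⟨fun i => (abs_le.1 (h0 i)).1, fun i => (abs_le.1 (h0 i)).2⟩, ?_, ?_⟩
      · have := (abs_le.1 (hdot p hp x)).2
        have := hp.2
        linarith
      · have := (abs_le.1 (hdot p hp t)).1
        have := hp.1 t ht
        linarith
  have hne : S.Nonempty := ⟨(0, 0), by
    refine ⟨fun v _ => ?_, ?_⟩
    · simpa using hQ v
    · simp⟩
  obtain ⟨p, hp, hmax⟩ := hSc.exists_isMaxOn hne
    (f := fun p => p.1 ⬝ᵥ x + p.2) (Continuous.continuousOn (by fun_prop))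
  refine ⟨affMap p.1 p.2, fun v hv => by rw [affMap_apply]; exact hp.1 v hv, fun ℓ' hℓ' => ?_⟩
  obtain ⟨a, b, rfl⟩ := exists_eq_affMap ℓ'
  rw [affMap_apply, affMap_apply]
  by_cases h0 : 0 ≤ a ⬝ᵥ x + b
  · exact hmax (a := (a, b)) ⟨fun v hv => by simpa [affMap_apply] using hℓ' v hv, h0⟩
  · have := hp.2
    linarith

/-- Rotate ℓ about the affine span of its contact set, in the direction that does not lower the
value at x, until it hits a new vertex. -/
lemma Minorant.exists_larger_contact (hL : Periodic L) (hG : Good L Q π)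
    (hℓ : Minorant L (qval Q) ℓ) (hne : (contact L (qval Q) ℓ).Nonempty)
    (hsp : vectorSpan ℝ (contact L (qval Q) ℓ) ≠ ⊤) (x : Fin d → ℝ) :
    ∃ ℓ', Minorant L (qval Q) ℓ' ∧ contact L (qval Q) ℓ ⊆ contact L (qval Q) ℓ' ∧
      dim (contact L (qval Q) ℓ) < dim (contact L (qval Q) ℓ') ∧ ℓ x ≤ ℓ' x := by
  obtain ⟨v₀, hv₀⟩ := hne
  obtain ⟨f, hf0, hfx, hfs⟩ : ∃ f : (Fin d → ℝ) →ₗ[ℝ] ℝ, f ≠ 0 ∧ 0 ≤ f (x - v₀) ∧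
      vectorSpan ℝ (contact L (qval Q) ℓ) ≤ LinearMap.ker f := by
    obtain ⟨f, hf0, hf⟩ := Submodule.exists_le_ker_of_lt_top _ (lt_top_iff_ne_top.2 hsp)
    rcases le_total 0 (f (x - v₀)) with h | h
    · exact ⟨f, hf0, h, hf⟩
    · refine ⟨-f, neg_ne_zero.2 hf0, by simpa using h, fun u hu => ?_⟩
      have := hf hu
      simpa using this
  set h : (Fin d → ℝ) →ᵃ[ℝ] ℝ := f.toAffineMap - AffineMap.const ℝ _ (f v₀) with hh
  have hval : ∀ y, h y = f (y - v₀) := by intro y; simp [hh]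
  have hhlin : h.linear = f := by simp [hh]
  have hcont : ∀ v ∈ contact L (qval Q) ℓ, h v = 0 := by
    intro v hv
    rw [hval]
    exact hfs (vsub_mem_vectorSpan ℝ hv hv₀)
  -- Integral kernel translates of v₀ are contact points too, and f is constant on contact points.
  have hk : ∀ y, π y = 0 → h.linear y = 0 := by
    intro y hy
    rw [hhlin]
    have : Submodule.span ℝ {u | π u = 0 ∧ ∃ z : Fin d → ℤ, u = intVec z} ≤
        LinearMap.ker f := by
      rw [Submodule.span_le]
      rintro _ ⟨hu, z, rfl⟩
      have hmem : v₀ + intVec z ∈ contact L (qval Q) ℓ :=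
        hℓ.mem_contact_congr hL hG (by rw [map_add, hu, add_zero]) hv₀ (hL.add_mem _ hv₀.1 z)
      have := hcont _ hmem
      rw [hval, add_sub_cancel_left] at this
      exact this
    exact this (hG.ker_le y hy)
  obtain ⟨v₁, hv₁, hv₁pos⟩ : ∃ v₁ ∈ L, 0 < h v₁ := by
    obtain ⟨i, hi⟩ : ∃ i, f (Pi.single i 1) ≠ 0 := by
      by_contra hcon
      push Not at hcon
      apply hf0
      ext i
      simpa using hcon i
    have e1 : intVec (Pi.single i 1) = (Pi.single i 1 : Fin d → ℝ) := by
      ext j; by_cases hj : j = i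
      · subst hj; simp [intVec]
      · simp [intVec, hj]
    have e2 : intVec (-(Pi.single i 1 : Fin d → ℤ)) = -(Pi.single i 1 : Fin d → ℝ) := by
      rw [← e1]; ext j; simp [intVec]
    rcases hi.lt_or_gt with h0 | h0
    · refine ⟨_, hL.add_mem v₀ hv₀.1 (-(Pi.single i 1)), ?_⟩
      rw [hval, add_sub_cancel_left, e2, map_neg]; linarith
    · refine ⟨_, hL.add_mem v₀ hv₀.1 (Pi.single i 1), ?_⟩
      rwa [hval, add_sub_cancel_left, e1]
  set A : Set ℝ := {ε | 0 ≤ ε ∧ Minorant L (qval Q) (ℓ + ε • h)} with hA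
  have hev : ∀ (ε : ℝ) y, (ℓ + ε • h) y = ℓ y + ε * h y := by intro ε y; simp
  have h0A : (0 : ℝ) ∈ A := ⟨le_rfl, by simpa using hℓ⟩
  have hbdd : ∀ v ∈ L, 0 < h v → ∀ ε ∈ A, ε ≤ (qval Q v - ℓ v) / h v := by
    intro v hv hpos ε hε
    have := hε.2 v hv
    rw [hev] at this
    rw [le_div_iff₀ hpos]; linarith
  have hBA : BddAbove A := ⟨_, fun ε hε => hbdd v₁ hv₁ hv₁pos ε hε⟩
  set s := sSup A with hs
  have hs0 : 0 ≤ s := le_csSup hBA h0A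
  have hmin : Minorant L (qval Q) (ℓ + s • h) := by
    intro v hv
    rw [hev]
    by_cases hpos : 0 < h v
    · have := csSup_le ⟨0, h0A⟩ (hbdd v hv hpos)
      rw [le_div_iff₀ hpos] at this
      linarith
    · have h1 := hℓ v hv
      have : s * h v ≤ 0 := mul_nonpos_of_nonneg_of_nonpos hs0 (not_lt.1 hpos)
      linarith
  -- Otherwise h is nonpositive on the new contact set, and a further tilt would exceed the supremum
  -- s.
  obtain ⟨w, hw, hwpos⟩ : ∃ w ∈ contact L (qval Q) (ℓ + s • h), 0 < h w := by
    by_contra hcon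
    push Not at hcon
    obtain ⟨ε, hε, hmin'⟩ := hmin.exists_tilt hL hG h hk hcon
    rw [add_assoc, ← add_smul] at hmin'
    have := le_csSup hBA (show s + ε ∈ A from ⟨by linarith, hmin'⟩)
    linarith
  have hsub : contact L (qval Q) ℓ ⊆ contact L (qval Q) (ℓ + s • h) := by
    intro v hv
    refine ⟨hv.1, ?_⟩
    rw [hev, hcont v hv, mul_zero, add_zero]
    exact hv.2
  refine ⟨ℓ + s • h, hmin, hsub, ?_, ?_⟩
  · apply Submodule.finrank_lt_finrank_of_lt
    refine lt_of_le_of_ne (vectorSpan_mono ℝ hsub) fun heq => ?_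
    have hmem := vsub_mem_vectorSpan ℝ hw (hsub hv₀)
    rw [← heq] at hmem
    have h1 : f (w - v₀) = 0 := hfs hmem
    rw [hval] at hwpos
    linarith
  · rw [hev]
    have : 0 ≤ h x := by rw [hval]; exact hfx
    have := mul_nonneg hs0 this
    linarith

/-- Every minorant with nonempty contact set can be tilted to a cell map, without losing contact
points and without decreasing the value at a given point. -/
lemma Minorant.exists_cellMap (hL : Periodic L) (hG : Good L Q π)
    (hℓ : Minorant L (qval Q) ℓ) (hne : (contact L (qval Q) ℓ).Nonempty) (x : Fin d → ℝ) :
    ∃ ℓ', CellMap L (qval Q) ℓ' ∧ contact L (qval Q) ℓ ⊆ contact L (qval Q) ℓ' ∧ ℓ x ≤ ℓ' x := by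
  induction hn : d - dim (contact L (qval Q) ℓ) using Nat.strong_induction_on generalizing ℓ with
  | _ n ih =>
    by_cases hsp : vectorSpan ℝ (contact L (qval Q) ℓ) = ⊤
    · exact ⟨ℓ, ⟨hℓ, (AffineSubspace.affineSpan_eq_top_iff_vectorSpan_eq_top_of_nonempty
        ℝ _ _ hne).2 hsp⟩, subset_rfl, le_rfl⟩
    · obtain ⟨ℓ₁, h1, h2, h3, h4⟩ := hℓ.exists_larger_contact hL hG hne hsp x
      have hle : dim (contact L (qval Q) ℓ₁) ≤ d := by
        have := Submodule.finrank_le (vectorSpan ℝ (contact L (qval Q) ℓ₁))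
        rwa [finrank_fin_fun] at this
      obtain ⟨ℓ₂, h5, h6, h7⟩ := ih _ (by omega) h1 (hne.mono h2) rfl
      exact ⟨ℓ₂, h5, h2.trans h6, h4.trans h7⟩

lemma Good.qval_nonneg (hG : Good L Q π) (x : Fin d → ℝ) : 0 ≤ qval Q x := by
  rw [hG.qval_eq]; positivity

/-- The cells cover the space. -/
lemma exists_cellMap_mem_hull (hL : Periodic L) (hG : Good L Q π) (x : Fin d → ℝ) :
    ∃ ℓ, CellMap L (qval Q) ℓ ∧ x ∈ hull L (qval Q) ℓ := by
  obtain ⟨ℓ₀, h0, hmax⟩ := exists_max_minorant hL hG.qval_nonneg x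
  have hne : (contact L (qval Q) ℓ₀).Nonempty := by
    by_contra hcon
    rw [Set.not_nonempty_iff_eq_empty] at hcon
    -- With no contact point at all, ℓ₀ could be raised by a constant.
    obtain ⟨ε, hε, hmin⟩ := h0.exists_tilt hL hG (AffineMap.const ℝ _ 1) (by simp)
      (by rw [hcon]; simp)
    have := hmax _ hmin
    simp at this
    linarith
  obtain ⟨ℓ, hℓ, hsub, hle⟩ := h0.exists_cellMap hL hG hne x
  refine ⟨ℓ, hℓ, ?_⟩
  -- A hyperplane separating x from the closed hull gives a tilt that is negative on the contact
  -- points and positive at x, against the maximality at x.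
  by_contra hx
  obtain ⟨f, u, hfx, hfu⟩ := geometric_hahn_banach_point_closed convex_hull
    (hℓ.1.isClosed_hull hL hG) hx
  obtain ⟨v₀, hv₀⟩ := hne.mono hsub
  set h : (Fin d → ℝ) →ᵃ[ℝ] ℝ :=
    AffineMap.const ℝ _ u - (f : (Fin d → ℝ) →ₗ[ℝ] ℝ).toAffineMap with hh
  have hval : ∀ y, h y = u - f y := by intro y; simp [hh]
  have hk : ∀ y, π y = 0 → h.linear y = 0 := by
    intro y hy
    have e : h.linear y = -f y := by simp [hh]
    rw [e, neg_eq_zero]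
    by_contra hne
    -- If f did not vanish on y, this translate of v₀ would stay in the hull but take the value u,
    -- which f exceeds there.
    have hmem := hℓ.1.hull_add_mem hL hG (x := v₀) (u := ((u - f v₀) / f y) • y)
      (contact_subset_hull hv₀) (by rw [map_smul, hy, smul_zero])
    have := hfu _ hmem
    rw [map_add, map_smul, smul_eq_mul, div_mul_cancel₀ _ hne] at this
    linarith
  obtain ⟨ε, hε, hmin⟩ := hℓ.1.exists_tilt hL hG h hk (fun v hv => by
    rw [hval]
    have := hfu v (contact_subset_hull hv)
    linarith)
  have h1 := hmax _ hmin
  simp only [AffineMap.coe_add, AffineMap.coe_smul, Pi.add_apply, Pi.smul_apply, smul_eq_mul,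
    hval] at h1
  have : 0 < ε * (u - f x) := mul_pos hε (by linarith)
  linarith

/-- Q - ℓ is convex and vanishes at the contact points. So a vertex in the hull of a minorant's
contact set is itself a contact point. -/
lemma inter_hull (hG : Good L Q π) : L ∩ hull L (qval Q) ℓ ⊆ {v ∈ L | qval Q v ≤ ℓ v} := by
  have hconv : ∀ x ∈ hull L (qval Q) ℓ, qval Q x ≤ ℓ x := by
    have hc : Convex ℝ {x | qval Q x ≤ ℓ x} := by
      have h1 : ConvexOn ℝ Set.univ (fun x => ‖π x‖ ^ 2 - ℓ x) := by
        have h2 : ConvexOn ℝ Set.univ (fun x => ‖π x‖ ^ 2) :=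
          ((convexOn_norm convex_univ).comp_linearMap π).pow (fun x _ => norm_nonneg _) 2
        refine h2.sub ⟨convex_univ, ?_⟩
        intro x _ y _ a b ha hb hab
        rw [Convex.combo_affine_apply hab]
      have := h1.convex_le 0
      convert this using 2 with x
      simp [hG.qval_eq]
    intro x hx
    have : hull L (qval Q) ℓ ⊆ {x | qval Q x ≤ ℓ x} :=
      convexHull_min (fun v hv => le_of_eq hv.2) hc
    exact this hx
  exact fun v hv => ⟨hv.1, hconv v hv.2⟩

lemma Minorant.inter_hull_eq (hG : Good L Q π) (hℓ : Minorant L (qval Q) ℓ) :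
    L ∩ hull L (qval Q) ℓ = contact L (qval Q) ℓ := by
  apply Set.Subset.antisymm
  · intro v hv
    have := inter_hull hG hv
    exact ⟨hv.1, le_antisymm this.2 (hℓ v hv.1)⟩
  · exact fun v hv => ⟨hv.1, contact_subset_hull hv⟩

/-- Expanding Q[c - v] gives Q[v] minus an affine map, up to the constant r². Conversely, the slope
of a minorant kills the kernel of Q, hence has the form 2 Q a, and a is a centre. -/
lemma mem_Del_iff (hL : Periodic L) (hG : Good L Q π) (hQ : Q.IsSymm) {P : Set (Fin d → ℝ)} :
    P ∈ Del L Q ↔ ∃ ℓ, Minorant L (qval Q) ℓ ∧ (contact L (qval Q) ℓ).Nonempty ∧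
      P = hull L (qval Q) ℓ := by
  constructor
  · rintro ⟨V, hVne, hVL, rfl, c, r, h1, h2⟩
    set ℓ := affMap ((2 : ℝ) • (Q *ᵥ c)) (r ^ 2 - qval Q c) with hℓ
    have hval : ∀ v, ℓ v = qval Q v - qval Q (c - v) + r ^ 2 := by
      intro v
      rw [hℓ, affMap_apply, qval_sub hQ, smul_dotProduct, smul_eq_mul]; ring
    have hle : Minorant L (qval Q) ℓ := by
      intro v hv
      rw [hval]
      by_cases hvV : v ∈ V
      · rw [h1 v hvV]; linarith
      · have := h2 v ⟨hv, hvV⟩; linarith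
    have hc : contact L (qval Q) ℓ = V := by
      ext v
      constructor
      · rintro ⟨hv, he⟩
        by_contra hvV
        have := h2 v ⟨hv, hvV⟩
        rw [hval] at he; linarith
      · intro hv
        refine ⟨hVL hv, ?_⟩
        rw [hval, h1 v hv]; ring
    exact ⟨ℓ, hle, by rwa [hc], by rw [hull, hc]⟩
  · rintro ⟨ℓ, hℓ, hne, rfl⟩
    have hker : ∀ x, Q *ᵥ x = 0 → ℓ.linear x = 0 := by
      intro x hx
      apply hℓ.linear_eq_zero hL hG
      rw [← hG.qval_eq_zero, qval, hx, dotProduct_zero]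
    have hmem : ((1 / 2 : ℝ) • ℓ.linear) ∈ LinearMap.range (Matrix.mulVecLin Q).dualMap := by
      rw [LinearMap.range_dualMap_eq_dualAnnihilator_ker, Submodule.mem_dualAnnihilator]
      intro x hx
      rw [LinearMap.smul_apply, hker x hx, smul_zero]
    obtain ⟨ψ, hψ⟩ := hmem
    obtain ⟨a, b, hab⟩ := exists_eq_affMap ψ.toAffineMap
    have hb : b = 0 := by
      have := congrArg (fun g => g 0) hab
      simpa [affMap_apply] using this.symm
    have hψa : ∀ y, ψ y = a ⬝ᵥ y := by
      intro y
      have := congrArg (fun g => g y) hab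
      simpa [affMap_apply, hb] using this
    have hlin : ∀ x, ℓ.linear x = 2 * ((Q *ᵥ a) ⬝ᵥ x) := by
      intro x
      have h1 : ψ (Q *ᵥ x) = (1 / 2 : ℝ) * ℓ.linear x := by
        have := LinearMap.congr_fun hψ x
        simpa using this
      rw [hψa, Matrix.dotProduct_mulVec, ← Matrix.mulVec_transpose, hQ.eq] at h1
      linarith
    have hval : ∀ v, qval Q (a - v) = qval Q v - ℓ v + (ℓ 0 + qval Q a) := by
      intro v
      rw [qval_sub hQ, affineMap_apply_eq ℓ v, hlin]; ring
    obtain ⟨v₀, hv₀⟩ := hne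
    -- This will be the squared radius; at a contact point it equals Q[a - v₀].
    have hr : 0 ≤ ℓ 0 + qval Q a := by
      have h1 := hval v₀
      have h2 := hG.qval_nonneg (a - v₀)
      have h3 := hv₀.2
      linarith
    refine ⟨contact L (qval Q) ℓ, ⟨v₀, hv₀⟩, contact_subset, rfl, a, √(ℓ 0 + qval Q a), ?_, ?_⟩
    · intro v hv
      rw [Real.sq_sqrt hr, hval, hv.2]; ring
    · rintro v ⟨hv, hvc⟩
      rw [Real.sq_sqrt hr, hval]
      have h1 := hℓ v hv
      rcases h1.lt_or_eq with h2 | h2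
      · linarith
      · exact absurd ⟨hv, h2.symm⟩ hvc

lemma mem_cells_iff (hL : Periodic L) (hG : Good L Q π) (hQ : Q.IsSymm) {P : Set (Fin d → ℝ)} :
    P ∈ cells (Del L Q) ↔ ∃ ℓ, CellMap L (qval Q) ℓ ∧ P = hull L (qval Q) ℓ := by
  have hiff : ∀ {ℓ}, (contact L (qval Q) ℓ).Nonempty →
      (affineSpan ℝ (contact L (qval Q) ℓ) = ⊤ ↔ dim (hull L (qval Q) ℓ) = d) := by
    intro ℓ hne
    rw [affineSpan_eq_top_iff_dim hne, hull, dim_convexHull, finrank_fin_fun]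
  constructor
  · rintro ⟨hP, hd⟩
    obtain ⟨ℓ, hℓ, hne, rfl⟩ := (mem_Del_iff hL hG hQ).1 hP
    exact ⟨ℓ, ⟨hℓ, (hiff hne).2 hd⟩, rfl⟩
  · rintro ⟨ℓ, hℓ, rfl⟩
    have hne : (contact L (qval Q) ℓ).Nonempty := by
      obtain ⟨x, hx⟩ := hℓ.interior_nonempty
      exact convexHull_nonempty_iff.1 ⟨x, interior_subset hx⟩
    exact ⟨(mem_Del_iff hL hG hQ).2 ⟨ℓ, hℓ.1, hne, rfl⟩, (hiff hne).1 hℓ.2⟩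

end GoodForms

/-! ### Delone subdivisions of admissible forms -/

section Admissible

variable {d : ℕ} {L : Set (Fin d → ℝ)} {Q Q₁ Q₂ : Mat d} {ℓ : (Fin d → ℝ) →ᵃ[ℝ] ℝ}
  {P : Set (Fin d → ℝ)}

/-- Symmetric forms in the rational closure. -/
structure Admissible {d : ℕ} (Q : Mat d) : Prop where
  isSymm : Q.IsSymm
  mem : Q ∈ rationalClosure d

lemma Admissible.exists_cellMap_mem_hull (hL : IsStandardPeriodic L) (hQ : Admissible Q)
    (x : Fin d → ℝ) : ∃ ℓ, CellMap L (qval Q) ℓ ∧ x ∈ hull L (qval Q) ℓ := by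
  obtain ⟨k, π, hG⟩ := exists_good hL hQ.mem
  exact Delone.exists_cellMap_mem_hull hL.periodic hG x

lemma Admissible.mem_cells_iff (hL : IsStandardPeriodic L) (hQ : Admissible Q) :
    P ∈ cells (Del L Q) ↔ ∃ ℓ, CellMap L (qval Q) ℓ ∧ P = hull L (qval Q) ℓ := by
  obtain ⟨k, π, hG⟩ := exists_good hL hQ.mem
  exact Delone.mem_cells_iff hL.periodic hG hQ.isSymm

lemma Admissible.mem_Del_iff (hL : IsStandardPeriodic L) (hQ : Admissible Q) :
    P ∈ Del L Q ↔ ∃ ℓ, Minorant L (qval Q) ℓ ∧ (contact L (qval Q) ℓ).Nonempty ∧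
      P = hull L (qval Q) ℓ := by
  obtain ⟨k, π, hG⟩ := exists_good hL hQ.mem
  exact Delone.mem_Del_iff hL.periodic hG hQ.isSymm

lemma Admissible.inter_hull_eq (hL : IsStandardPeriodic L) (hQ : Admissible Q)
    (hℓ : Minorant L (qval Q) ℓ) : L ∩ hull L (qval Q) ℓ = contact L (qval Q) ℓ := by
  obtain ⟨k, π, hG⟩ := exists_good hL hQ.mem
  exact hℓ.inter_hull_eq hG

lemma Admissible.isClosed_hull (hL : IsStandardPeriodic L) (hQ : Admissible Q)
    (hℓ : Minorant L (qval Q) ℓ) : IsClosed (hull L (qval Q) ℓ) := by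
  obtain ⟨k, π, hG⟩ := exists_good hL hQ.mem
  exact hℓ.isClosed_hull hL.periodic hG

lemma Admissible.qval_nonneg (hQ : Admissible Q) (x : Fin d → ℝ) : 0 ≤ qval Q x :=
  qval_nonneg_of_mem_rationalClosure hQ.mem x

lemma Admissible.exists_of_mem_cells (hL : IsStandardPeriodic L) (hQ : Admissible Q)
    (hP : P ∈ cells (Del L Q)) : ∃ ℓ, CellMap L (qval Q) ℓ ∧ P = hull L (qval Q) ℓ ∧
      L ∩ P = contact L (qval Q) ℓ := by
  obtain ⟨ℓ, hℓ, rfl⟩ := (hQ.mem_cells_iff hL).1 hP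
  exact ⟨ℓ, hℓ, rfl, hQ.inter_hull_eq hL hℓ.1⟩

lemma eq_convexHull_inter_of_mem_cells (hL : IsStandardPeriodic L) (hQ : Admissible Q)
    (hP : P ∈ cells (Del L Q)) : P = convexHull ℝ (L ∩ P) := by
  obtain ⟨ℓ, hℓ, rfl, h⟩ := hQ.exists_of_mem_cells hL hP
  rw [h]; rfl

lemma affineSpan_inter_of_mem_cells (hL : IsStandardPeriodic L) (hQ : Admissible Q)
    (hP : P ∈ cells (Del L Q)) : affineSpan ℝ (L ∩ P) = ⊤ := by
  obtain ⟨ℓ, hℓ, rfl, h⟩ := hQ.exists_of_mem_cells hL hP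
  rw [h]; exact hℓ.2

lemma interior_nonempty_of_mem_cells (hL : IsStandardPeriodic L) (hQ : Admissible Q)
    (hP : P ∈ cells (Del L Q)) : (interior P).Nonempty := by
  obtain ⟨ℓ, hℓ, rfl, h⟩ := hQ.exists_of_mem_cells hL hP
  exact hℓ.interior_nonempty

/-- Faces of Delone cells are Delone polyhedra. -/
lemma Admissible.face_mem_Del (hL : IsStandardPeriodic L) (hQ : Admissible Q)
    (hℓ : Minorant L (qval Q) ℓ) (h : (Fin d → ℝ) →ᵃ[ℝ] ℝ)
    (hc : ∀ v ∈ contact L (qval Q) ℓ, h v ≤ 0)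
    (hne : {v ∈ contact L (qval Q) ℓ | h v = 0}.Nonempty) :
    convexHull ℝ {v ∈ contact L (qval Q) ℓ | h v = 0} ∈ Del L Q := by
  obtain ⟨k, π, hG⟩ := exists_good hL hQ.mem
  have hP := hL.periodic
  obtain ⟨v₀, hv₀, hv₀h⟩ := hne
  have hk : ∀ x, π x = 0 → h.linear x = 0 := by
    intro x hx
    have : Submodule.span ℝ {u | π u = 0 ∧ ∃ z : Fin d → ℤ, u = intVec z} ≤
        LinearMap.ker h.linear := by
      rw [Submodule.span_le]
      rintro _ ⟨hu, z, rfl⟩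
      -- Translates of v₀ by z and by -z are both contact points, where h is nonpositive, while h
      -- vanishes at v₀; so its slope along z is zero.
      have hle : ∀ z : Fin d → ℤ, π (intVec z) = 0 → h.linear (intVec z) ≤ 0 := by
        intro z hz
        have := hc _ (hℓ.mem_contact_congr hP hG (x := v₀) (y := v₀ + intVec z)
          (by rw [map_add, hz, add_zero]) hv₀ (hP.add_mem _ hv₀.1 z))
        rwa [affineMap_apply_add, hv₀h, zero_add] at this
      have h1 := hle z hu
      have e : intVec (-z) = -intVec z := by ext i; simp [intVec]
      have h2 := hle (-z) (by rw [e, map_neg, hu, neg_zero])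
      rw [e, map_neg] at h2
      exact le_antisymm h1 (by linarith)
    exact this (hG.ker_le x hx)
  obtain ⟨ε, hε, hmin⟩ := hℓ.exists_tilt hP hG h hk hc
  have hev : ∀ (ε : ℝ) y, (ℓ + ε • h) y = ℓ y + ε * h y := by intro ε y; simp
  -- Half the admissible tilt: the full one might create new contacts, but half of it keeps strict
  -- inequalities strict.
  have hmin' : Minorant L (qval Q) (ℓ + (ε / 2) • h) := by
    intro v hv
    have h1 := hmin v hv
    have h2 := hℓ v hv
    rw [hev] at h1 ⊢
    linarith
  have hcont : contact L (qval Q) (ℓ + (ε / 2) • h) = {v ∈ contact L (qval Q) ℓ | h v = 0} := by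
    ext v
    constructor
    · rintro ⟨hv, he⟩
      have h1 := hmin v hv
      have h2 := hℓ v hv
      rw [hev] at h1 he
      have h3 : qval Q v = ℓ v := by linarith
      refine ⟨⟨hv, h3⟩, ?_⟩
      have : ε / 2 * h v = 0 := by linarith
      rcases mul_eq_zero.1 this with h4 | h4
      · linarith
      · exact h4
    · rintro ⟨⟨hv, he⟩, h0⟩
      exact ⟨hv, by rw [hev, h0, mul_zero, add_zero, he]⟩
  rw [hQ.mem_Del_iff hL]
  exact ⟨_, hmin', by rw [hcont]; exact ⟨v₀, hv₀, hv₀h⟩, by rw [hull, hcont]⟩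

lemma eq_of_interior_meets_cell (hL : IsStandardPeriodic L) (hQ : Admissible Q)
    {P₁ P₂ : Set (Fin d → ℝ)} (h₁ : P₁ ∈ cells (Del L Q)) (h₂ : P₂ ∈ cells (Del L Q))
    {x : Fin d → ℝ} (hx₁ : x ∈ interior P₁) (hx₂ : x ∈ P₂) : P₁ = P₂ := by
  obtain ⟨ℓ₁, hℓ₁, rfl, -⟩ := hQ.exists_of_mem_cells hL h₁
  obtain ⟨ℓ₂, hℓ₂, rfl, -⟩ := hQ.exists_of_mem_cells hL h₂
  rw [eq_of_interior_meets hℓ₁.1 hℓ₂.1 hx₁ hx₂]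

lemma exists_cell_mem (hL : IsStandardPeriodic L) (hQ : Admissible Q) (x : Fin d → ℝ) :
    ∃ P ∈ cells (Del L Q), x ∈ P := by
  obtain ⟨ℓ, hℓ, hx⟩ := hQ.exists_cellMap_mem_hull hL x
  exact ⟨_, (hQ.mem_cells_iff hL).2 ⟨ℓ, hℓ, rfl⟩, hx⟩

/-- The smaller family already covers space, so an interior point of any further cell would lie in
one of its members. -/
lemma cells_eq_of_subset (hL : IsStandardPeriodic L) (h₁ : Admissible Q₁) (h₂ : Admissible Q₂)
    (h : cells (Del L Q₁) ⊆ cells (Del L Q₂)) : cells (Del L Q₁) = cells (Del L Q₂) := by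
  refine h.antisymm fun P hP => ?_
  obtain ⟨x, hx⟩ := interior_nonempty_of_mem_cells hL h₂ hP
  obtain ⟨P', hP', hx'⟩ := exists_cell_mem hL h₁ x
  rw [eq_of_interior_meets_cell hL h₂ hP (h hP') hx hx']
  exact hP'

/-- Every Delone polyhedron is a face of some cell, cut out by the difference of the two minorants.
A face of a cell is Delone for any form having that cell. -/
lemma Del_subset_of_cells_eq (hL : IsStandardPeriodic L) (h₁ : Admissible Q₁)
    (h₂ : Admissible Q₂) (h : cells (Del L Q₁) = cells (Del L Q₂)) :
    Del L Q₁ ⊆ Del L Q₂ := by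
  intro P hP
  obtain ⟨ℓ, hℓ, hne, rfl⟩ := (h₁.mem_Del_iff hL).1 hP
  obtain ⟨k, π, hG⟩ := exists_good hL h₁.mem
  obtain ⟨ℓ', hℓ', hsub, -⟩ := hℓ.exists_cellMap hL.periodic hG hne 0
  have hP' : hull L (qval Q₁) ℓ' ∈ cells (Del L Q₂) := by
    rw [← h]; exact (h₁.mem_cells_iff hL).2 ⟨ℓ', hℓ', rfl⟩
  obtain ⟨ℓ₂, hℓ₂, -, hint⟩ := h₂.exists_of_mem_cells hL hP'
  rw [h₁.inter_hull_eq hL hℓ'.1] at hint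
  have hset : {v ∈ contact L (qval Q₂) ℓ₂ | (ℓ - ℓ') v = 0} = contact L (qval Q₁) ℓ := by
    rw [← hint]
    ext v
    simp only [AffineMap.coe_sub, Pi.sub_apply, sub_eq_zero]
    constructor
    · rintro ⟨hv, he⟩
      exact ⟨hv.1, by rw [he, hv.2]⟩
    · intro hv
      have := hsub hv
      exact ⟨this, by rw [← hv.2, ← this.2]⟩
  have := h₂.face_mem_Del hL hℓ₂.1 (ℓ - ℓ') (by
    rw [← hint]
    intro v hv
    have h1 := hℓ v hv.1
    have h2 := hv.2
    simp only [AffineMap.coe_sub, Pi.sub_apply]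
    linarith) (by rw [hset]; exact hne)
  rw [hset] at this
  exact this

/-- A Delone subdivision is determined by its full-dimensional cells. -/
lemma Del_eq_of_cells_subset (hL : IsStandardPeriodic L) (h₁ : Admissible Q₁)
    (h₂ : Admissible Q₂) (h : cells (Del L Q₁) ⊆ cells (Del L Q₂)) : Del L Q₁ = Del L Q₂ := by
  have := cells_eq_of_subset hL h₁ h₂ h
  exact (Del_subset_of_cells_eq hL h₁ h₂ this).antisymm
    (Del_subset_of_cells_eq hL h₂ h₁ this.symm)

/-- For an integral z in the kernel of Q₁, the points v, v + z and v - z are vertices of one common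
cell. There Q₂ is affine, and its second difference 2 Q₂[z] vanishes. -/
lemma qval_eq_zero_of_Del_eq (hL : IsStandardPeriodic L) (h₁ : Admissible Q₁)
    (h₂ : Admissible Q₂) (h : Del L Q₁ = Del L Q₂) {x : Fin d → ℝ} (hx : qval Q₁ x = 0) :
    qval Q₂ x = 0 := by
  obtain ⟨k₁, π₁, hG₁⟩ := exists_good hL h₁.mem
  obtain ⟨k₂, π₂, hG₂⟩ := exists_good hL h₂.mem
  obtain ⟨P, hP, -⟩ := exists_cell_mem hL h₁ 0
  obtain ⟨ℓ₁, hℓ₁, -, hint₁⟩ := h₁.exists_of_mem_cells hL hP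
  rw [h] at hP
  obtain ⟨ℓ₂, hℓ₂, -, hint₂⟩ := h₂.exists_of_mem_cells hL hP
  rw [hint₁] at hint₂
  obtain ⟨v, hv⟩ : (contact L (qval Q₁) ℓ₁).Nonempty := by
    obtain ⟨y, hy⟩ := hℓ₁.interior_nonempty
    exact convexHull_nonempty_iff.1 ⟨y, interior_subset hy⟩
  rw [hG₁.qval_eq_zero] at hx
  rw [hG₂.qval_eq_zero]
  have key : Submodule.span ℝ {u | π₁ u = 0 ∧ ∃ z : Fin d → ℤ, u = intVec z} ≤
      LinearMap.ker π₂ := by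
    rw [Submodule.span_le]
    rintro _ ⟨hu, z, rfl⟩
    show π₂ (intVec z) = 0
    rw [← hG₂.qval_eq_zero]
    have e : intVec (-z) = -intVec z := by ext i; simp [intVec]
    have hval : ∀ z, π₁ (intVec z) = 0 →
        qval Q₂ (v + intVec z) = ℓ₂ (v + intVec z) := by
      intro z hz
      have := hℓ₁.1.mem_contact_congr hL.periodic hG₁ (x := v) (y := v + intVec z)
        (by rw [map_add, hz, add_zero]) hv (hL.periodic.add_mem _ hv.1 z)
      rw [hint₂] at this
      exact this.2
    have h1 := hval z hu
    have h2 := hval (-z) (by rw [e, map_neg, hu, neg_zero])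
    have h3 : qval Q₂ v = ℓ₂ v := (hint₂ ▸ hv : v ∈ contact L (qval Q₂) ℓ₂).2
    rw [e] at h2
    rw [affineMap_apply_add] at h1 h2
    rw [← sub_neg_eq_add, ← e, qval_sub h₂.isSymm, e] at h1
    rw [← sub_eq_add_neg, qval_sub h₂.isSymm, map_neg] at h2
    have h4 : qval Q₂ (-intVec z) = qval Q₂ (intVec z) := by
      simp [qval, Matrix.mulVec_neg]
    rw [h4, dotProduct_neg] at h1
    linarith
  exact key (hG₁.ker_le x hx)

lemma posSemidef_of_qval_nonneg (hs : Q.IsSymm) (h0 : ∀ x, 0 ≤ qval Q x) : Q.PosSemidef :=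
  Matrix.posSemidef_iff_dotProduct_mulVec.2
    ⟨by rw [Matrix.IsHermitian, Matrix.conjTranspose_eq_transpose_of_trivial]; exact hs,
     fun x => by simpa [qval] using h0 x⟩

/-- Membership in the rational closure depends only on the kernel. -/
lemma Admissible.of_ker_eq (hQ : Admissible Q) (hs : Q₂.IsSymm) (h0 : ∀ x, 0 ≤ qval Q₂ x)
    (hker : ∀ x, qval Q₂ x = 0 ↔ qval Q x = 0) : Admissible Q₂ := by
  refine ⟨hs, ?_⟩
  obtain ⟨m, k, e, U, R, hU, hR, hblock⟩ := hQ.mem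
  set Ur : Mat d := U.map (Int.cast : ℤ → ℝ) with hUr
  set A : Mat d := Urᵀ * Q₂ * Ur with hA
  have hqA : ∀ (M : Mat d) (y : Fin d → ℝ), qval M (Ur *ᵥ y) = y ⬝ᵥ ((Urᵀ * M * Ur) *ᵥ y) := by
    intro M y
    unfold qval
    rw [← Matrix.mulVec_mulVec, ← Matrix.mulVec_mulVec, Matrix.dotProduct_mulVec _ Urᵀ,
      Matrix.vecMul_transpose]
  have hAs : Aᵀ = A := by
    rw [hA, Matrix.transpose_mul, Matrix.transpose_mul, Matrix.transpose_transpose, hs.eq,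
      Matrix.mul_assoc]
  have hpsd := posSemidef_of_qval_nonneg hs h0
  -- The columns of U in the zero block are null vectors of Q, hence of Q₂, and a null vector of a
  -- positive semidefinite form lies in its matrix kernel.
  have hcol : ∀ i j, A j (e (Sum.inl i)) = 0 := by
    intro i j
    have h1 : qval Q (Ur *ᵥ Pi.single (e (Sum.inl i)) 1) = 0 := by
      rw [hqA, hblock, dotProduct_reindex_mulVec]
      have : (fun j => (Pi.single (e (Sum.inl i)) 1 : Fin d → ℝ) (e (Sum.inr j))) = 0 := by
        ext j; simp
      rw [this]; simp
    rw [← hker] at h1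
    have h2 : Q₂ *ᵥ (Ur *ᵥ Pi.single (e (Sum.inl i)) 1) = 0 := by
      rw [← hpsd.dotProduct_mulVec_zero_iff]
      simpa [qval] using h1
    have h3 : A *ᵥ Pi.single (e (Sum.inl i)) 1 = 0 := by
      rw [hA, ← Matrix.mulVec_mulVec, ← Matrix.mulVec_mulVec, h2, Matrix.mulVec_zero]
    have := congrFun h3 j
    simpa using this
  have hrow : ∀ i j, A (e (Sum.inl i)) j = 0 := by
    intro i j
    have := hcol i j
    rw [← hAs] at this
    exact this
  set R' : Matrix (Fin k) (Fin k) ℝ := A.submatrix (fun j => e (Sum.inr j)) fun j => e (Sum.inr j)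
    with hR'
  have hAblock : A = Matrix.reindex e e (Matrix.fromBlocks 0 0 0 R') := by
    rw [← Equiv.symm_apply_eq]
    ext i j
    rcases i with i | i <;> rcases j with j | j <;> simp [hcol, hrow, hR']
  refine ⟨m, k, e, U, R', hU, ?_, hAblock⟩
  rw [Matrix.posDef_iff_dotProduct_mulVec]
  refine ⟨?_, fun x hx => ?_⟩
  · rw [Matrix.IsHermitian, Matrix.conjTranspose_eq_transpose_of_trivial, hR',
      Matrix.transpose_submatrix, hAs]
  · let y : Fin d → ℝ := fun i => Sum.elim (fun _ => 0) x (e.symm i)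
    have hy : (fun j => y (e (Sum.inr j))) = x := by ext j; simp [y]
    have h1 : qval Q₂ (Ur *ᵥ y) = x ⬝ᵥ (R' *ᵥ x) := by
      rw [hqA, ← hA, hAblock, dotProduct_reindex_mulVec, hy]
    have h2 : qval Q (Ur *ᵥ y) = x ⬝ᵥ (R *ᵥ x) := by
      rw [hqA, hblock, dotProduct_reindex_mulVec, hy]
    have h3 := (Matrix.posDef_iff_dotProduct_mulVec.1 hR).2 hx
    simp only [star_trivial] at h3 ⊢
    rw [← h1]
    refine lt_of_le_of_ne (h0 _) fun h4 => ?_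
    have := (hker _).1 h4.symm
    rw [h2] at this
    linarith

end Admissible

/-! ### The inner product on symmetric forms -/

section InnerProduct

variable {d : ℕ} {U : Submodule ℝ (Mat d)}

/-- The functional `⟨N, ·⟩`. -/
def ipLin (N : Mat d) : Mat d →ₗ[ℝ] ℝ :=
  Matrix.traceLinearMap (Fin d) ℝ ℝ ∘ₗ LinearMap.mulLeft ℝ N

lemma ipLin_apply (N C : Mat d) : ipLin N C = ip N C := rfl

lemma ip_comm (A B : Mat d) : ip A B = ip B A := Matrix.trace_mul_comm A B

lemma ip_add_left (A B C : Mat d) : ip (A + B) C = ip A C + ip B C := by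
  simp [ip, Matrix.add_mul]

lemma ip_sub_left (A B C : Mat d) : ip (A - B) C = ip A C - ip B C := by
  simp [ip, Matrix.sub_mul]

lemma ip_smul_left (c : ℝ) (A B : Mat d) : ip (c • A) B = c * ip A B := by
  simp [ip]

lemma ip_add_right (A B C : Mat d) : ip A (B + C) = ip A B + ip A C := by
  simp [ip, Matrix.mul_add]

lemma ip_sub_right (A B C : Mat d) : ip A (B - C) = ip A B - ip A C := by
  simp [ip, Matrix.mul_sub]

lemma ip_smul_right (c : ℝ) (A B : Mat d) : ip A (c • B) = c * ip A B := by
  simp [ip]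

lemma ip_self_nonneg {A : Mat d} (hA : A.IsSymm) : 0 ≤ ip A A := by
  have : ip A A = ∑ i, ∑ j, A i j ^ 2 := by
    simp only [ip, Matrix.trace, Matrix.diag, Matrix.mul_apply]
    refine Finset.sum_congr rfl fun i _ => Finset.sum_congr rfl fun j _ => ?_
    rw [hA.apply i j]; ring
  rw [this]
  positivity

lemma ip_self_eq_zero {A : Mat d} (hA : A.IsSymm) (h : ip A A = 0) : A = 0 := by
  rw [← Matrix.trace_conjTranspose_mul_self_eq_zero_iff,
    Matrix.conjTranspose_eq_transpose_of_trivial, hA.eq]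
  exact h

lemma eq_of_forall_ip (hU : ∀ A ∈ U, A.IsSymm) {A B : Mat d} (hA : A ∈ U) (hB : B ∈ U)
    (h : ∀ C ∈ U, ip A C = ip B C) : A = B := by
  have hm := U.sub_mem hA hB
  rw [← sub_eq_zero]
  apply ip_self_eq_zero (hU _ hm)
  rw [ip_sub_left, h _ hm, sub_self]

/-- Every linear functional is represented on a space of symmetric forms. -/
lemma exists_ip_eq (hU : ∀ A ∈ U, A.IsSymm) (φ : Mat d →ₗ[ℝ] ℝ) :
    ∃ B ∈ U, ∀ C ∈ U, ip B C = φ C := by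
  let Φ : U →ₗ[ℝ] Module.Dual ℝ U :=
    { toFun := fun A => (ipLin A.1).comp U.subtype
      map_add' := by intro A B; ext C; simp [ipLin_apply, ip_add_left]
      map_smul' := by intro c A; ext C; simp [ipLin_apply, ip_smul_left] }
  have hinj : Function.Injective Φ := by
    rw [← LinearMap.ker_eq_bot, LinearMap.ker_eq_bot']
    intro A hA
    have : ip A.1 A.1 = 0 := LinearMap.congr_fun hA A
    exact Subtype.ext (ip_self_eq_zero (hU _ A.2) this)
  have hsurj : Function.Surjective Φ :=
    (LinearMap.injective_iff_surjective_of_finrank_eq_finrank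
      (Subspace.dual_finrank_eq (K := ℝ) (V := U)).symm).1 hinj
  obtain ⟨B, hB⟩ := hsurj (φ.comp U.subtype)
  exact ⟨B.1, B.2, fun C hC => LinearMap.congr_fun hB ⟨C, hC⟩⟩

lemma exists_isOrthProj (hU : ∀ A ∈ U, A.IsSymm) (M : Mat d) : ∃ B, IsOrthProj U M B := by
  obtain ⟨B, hB, h⟩ := exists_ip_eq hU (ipLin M)
  exact ⟨B, hB, fun C hC => by rw [ip_sub_left, h C hC, ipLin_apply, sub_self]⟩

lemma IsOrthProj.ip_eq {M B C : Mat d} (h : IsOrthProj U M B) (hC : C ∈ U) : ip B C = ip M C := by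
  have := h.2 C hC
  rw [ip_sub_left] at this
  linarith

end InnerProduct

/-! ### Secondary cones -/

section Cones

variable {d : ℕ} {L : Set (Fin d → ℝ)} {T : Submodule ℝ (Mat d)}
  {D D' : Set (Set (Fin d → ℝ))} {Q R : Mat d} {P : Set (Fin d → ℝ)}

lemma admissible_of_mem (hT : ∀ Q ∈ T, Q.IsSymm) (hQ : Q ∈ secondaryCone L T D) : Admissible Q :=
  ⟨hT _ hQ.2, hQ.1.1⟩

lemma Del_eq_of_mem (hQ : Q ∈ secondaryCone L T D) : Del L Q = D := hQ.1.2

lemma vectorSpan_secondaryCone (hgen : IsGeneric L T D) :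
    vectorSpan ℝ (secondaryCone L T D) = T := by
  apply Submodule.eq_of_le_of_finrank_eq
  · rw [vectorSpan_def, Submodule.span_le]
    rintro _ ⟨A, hA, B, hB, rfl⟩
    exact T.sub_mem hA.2 hB.2
  · exact hgen.2

lemma le_span_secondaryCone (hgen : IsGeneric L T D) :
    T ≤ Submodule.span ℝ (secondaryCone L T D) := by
  conv_lhs => rw [← vectorSpan_secondaryCone hgen, vectorSpan_def]
  rw [Submodule.span_le]
  rintro _ ⟨A, hA, B, hB, rfl⟩
  exact Submodule.sub_mem _ (Submodule.subset_span hA) (Submodule.subset_span hB)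

/-- All forms of `T` are affine on the vertices of each cell of a generic subdivision. -/
lemma exists_affine_on_cell (hL : IsStandardPeriodic L) (hT : ∀ Q ∈ T, Q.IsSymm)
    (hgen : IsGeneric L T D) (hP : P ∈ cells D) (hR : R ∈ T) :
    ∃ ℓ : (Fin d → ℝ) →ᵃ[ℝ] ℝ, ∀ v ∈ L ∩ P, qval R v = ℓ v := by
  have := le_span_secondaryCone hgen hR
  clear hR
  induction this using Submodule.span_induction with
  | mem A hA =>
    rw [← Del_eq_of_mem hA] at hP
    obtain ⟨ℓ, -, -, hint⟩ := (admissible_of_mem hT hA).exists_of_mem_cells hL hP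
    refine ⟨ℓ, fun v hv => ?_⟩
    rw [hint] at hv
    exact hv.2
  | zero => exact ⟨0, fun v _ => by simp [qval_zero_form]⟩
  | add A B _ _ ihA ihB =>
    obtain ⟨ℓ₁, h₁⟩ := ihA
    obtain ⟨ℓ₂, h₂⟩ := ihB
    exact ⟨ℓ₁ + ℓ₂, fun v hv => by simp [qval_add_form, h₁ v hv, h₂ v hv]⟩
  | smul c A _ ih =>
    obtain ⟨ℓ, h⟩ := ih
    exact ⟨c • ℓ, fun v hv => by simp [qval_smul_form, h v hv]⟩

/-- T is spanned by forms with the same subdivision as Q, and these share its kernel. -/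
lemma qval_eq_zero_of_mem (hL : IsStandardPeriodic L) (hT : ∀ Q ∈ T, Q.IsSymm)
    (hgen : IsGeneric L T D) (hQ : Q ∈ secondaryCone L T D) (hR : R ∈ T) {x : Fin d → ℝ}
    (hx : qval Q x = 0) : qval R x = 0 := by
  have := le_span_secondaryCone hgen hR
  clear hR
  induction this using Submodule.span_induction with
  | mem A hA =>
    exact qval_eq_zero_of_Del_eq hL (admissible_of_mem hT hQ) (admissible_of_mem hT hA)
      ((Del_eq_of_mem hQ).trans (Del_eq_of_mem hA).symm) hx
  | zero => exact qval_zero_form x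
  | add A B _ _ ihA ihB => rw [qval_add_form, ihA, ihB, add_zero]
  | smul c A _ ih => rw [qval_smul_form, ih, mul_zero]

lemma closure_secondaryCone_subset : closure (secondaryCone L T D) ⊆ T :=
  closure_minimal (fun _ h => h.2) (Submodule.closed_of_finiteDimensional T)

lemma qval_nonneg_of_mem_closure (hR : R ∈ closure (secondaryCone L T D)) (x : Fin d → ℝ) :
    0 ≤ qval R x := by
  have : closure (secondaryCone L T D) ⊆ {R | 0 ≤ qval R x} :=
    closure_minimal (fun R h => qval_nonneg_of_mem_rationalClosure h.1.1 x)
      (isClosed_le continuous_const (continuous_qval_form x))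
  exact this hR

/-- Forms in the closure of a secondary cone are supported by an affine map on each cell. -/
lemma exists_minorant_of_mem_closure (hL : IsStandardPeriodic L) (hT : ∀ Q ∈ T, Q.IsSymm)
    (hP : P ∈ cells D) (hR : R ∈ closure (secondaryCone L T D)) :
    ∃ ℓ, Minorant L (qval R) ℓ ∧ L ∩ P ⊆ contact L (qval R) ℓ := by
  obtain ⟨Q, hQ⟩ : (secondaryCone L T D).Nonempty := closure_nonempty_iff.1 ⟨R, hR⟩
  have hP' := hP
  rw [← Del_eq_of_mem hQ] at hP'
  obtain ⟨b, hb⟩ := exists_affineBasis_subset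
    (affineSpan_inter_of_mem_cells hL (admissible_of_mem hT hQ) hP')
  -- Interpolating at a fixed affine basis of vertices makes the supporting map depend continuously
  -- on the form, so the conditions on it are closed.
  have hcont : ∀ v, Continuous fun R : Mat d => interp b (qval R) v := by
    intro v
    simp only [interp_apply]
    exact continuous_finsetSum _ fun i _ => (continuous_qval_form _).mul continuous_const
  have hsub : closure (secondaryCone L T D) ⊆ {R | (∀ v ∈ L, interp b (qval R) v ≤ qval R v) ∧
      ∀ v ∈ L ∩ P, qval R v = interp b (qval R) v} := by
    apply closure_minimal
    · intro A hA
      rw [← Del_eq_of_mem hA] at hP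
      obtain ⟨ℓ, hℓ, -, hint⟩ := (admissible_of_mem hT hA).exists_of_mem_cells hL hP
      have e : interp b (qval A) = ℓ := interp_eq b _ _ fun i => by
        have := hb i
        rw [hint] at this
        exact this.2
      refine ⟨fun v hv => by rw [e]; exact hℓ.1 v hv, fun v hv => ?_⟩
      rw [hint] at hv
      rw [e]; exact hv.2
    · apply IsClosed.and
      · simp only [Set.ofPred_forall]
        exact isClosed_iInter fun v => isClosed_iInter fun _ =>
          isClosed_le (hcont v) (continuous_qval_form v)
      · simp only [Set.ofPred_forall]
        exact isClosed_iInter fun v => isClosed_iInter fun _ =>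
          isClosed_eq (continuous_qval_form v) (hcont v)
  have := hsub hR
  exact ⟨_, this.1, fun v hv => ⟨hv.1, this.2 v hv⟩⟩

/-- Supporting maps add up. Where Q lies strictly above its map so does the sum, and at contact
points of Q the map for R touches as well. The kernel is unchanged, so the sum stays in the rational
closure. -/
lemma add_mem_secondaryCone (hL : IsStandardPeriodic L) (hT : ∀ Q ∈ T, Q.IsSymm)
    (hgen : IsGeneric L T D) (hQ : Q ∈ secondaryCone L T D)
    (hR : R ∈ closure (secondaryCone L T D)) : Q + R ∈ secondaryCone L T D := by
  have hRT : R ∈ T := closure_secondaryCone_subset hR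
  have hmem : Q + R ∈ T := T.add_mem hQ.2 hRT
  have hQa := admissible_of_mem hT hQ
  have hadm : Admissible (Q + R) := by
    refine hQa.of_ker_eq (hT _ hmem) (fun x => ?_) (fun x => ?_)
    · rw [qval_add_form]
      exact add_nonneg (hQa.qval_nonneg x) (qval_nonneg_of_mem_closure hR x)
    · rw [qval_add_form]
      constructor
      · intro h
        have h1 := hQa.qval_nonneg x
        have h2 := qval_nonneg_of_mem_closure hR x
        linarith
      · intro h
        rw [h, qval_eq_zero_of_mem hL hT hgen hQ hRT h, add_zero]
  refine ⟨⟨hadm.mem, ?_⟩, hmem⟩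
  rw [← Del_eq_of_mem hQ]
  symm
  apply Del_eq_of_cells_subset hL hQa hadm
  intro P hP
  obtain ⟨ℓ, hℓ, rfl, hint⟩ := hQa.exists_of_mem_cells hL hP
  rw [Del_eq_of_mem hQ] at hP
  obtain ⟨ℓ', hℓ', hsub⟩ := exists_minorant_of_mem_closure hL hT hP hR
  rw [hint] at hsub
  have hc : contact L (qval (Q + R)) (ℓ + ℓ') = contact L (qval Q) ℓ := by
    ext v
    constructor
    · rintro ⟨hv, he⟩
      have h1 := hℓ.1 v hv
      have h2 := hℓ' v hv
      simp only [qval_add_form, AffineMap.coe_add, Pi.add_apply] at he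
      exact ⟨hv, by linarith⟩
    · intro hv
      refine ⟨hv.1, ?_⟩
      simp only [qval_add_form, AffineMap.coe_add, Pi.add_apply]
      rw [hv.2, (hsub hv).2]
  rw [hadm.mem_cells_iff hL]
  refine ⟨ℓ + ℓ', ⟨fun v hv => ?_, by rw [hc]; exact hℓ.2⟩, by rw [hull, hull, hc]⟩
  simp only [qval_add_form, AffineMap.coe_add, Pi.add_apply]
  exact add_le_add (hℓ.1 v hv) (hℓ' v hv)

lemma smul_mem_secondaryCone (hL : IsStandardPeriodic L) (hT : ∀ Q ∈ T, Q.IsSymm)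
    (hQ : Q ∈ secondaryCone L T D) {c : ℝ} (hc : 0 < c) : c • Q ∈ secondaryCone L T D := by
  have hmem : c • Q ∈ T := T.smul_mem c hQ.2
  have hQa := admissible_of_mem hT hQ
  have hadm : Admissible (c • Q) := by
    refine hQa.of_ker_eq (hT _ hmem) (fun x => ?_) (fun x => ?_)
    · rw [qval_smul_form]
      exact mul_nonneg hc.le (hQa.qval_nonneg x)
    · rw [qval_smul_form]
      simp [hc.ne']
  refine ⟨⟨hadm.mem, ?_⟩, hmem⟩
  rw [← Del_eq_of_mem hQ]
  symm
  apply Del_eq_of_cells_subset hL hQa hadm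
  intro P hP
  obtain ⟨ℓ, hℓ, rfl, hint⟩ := hQa.exists_of_mem_cells hL hP
  have hcon : contact L (qval (c • Q)) (c • ℓ) = contact L (qval Q) ℓ := by
    ext v
    simp [contact, qval_smul_form, hc.ne']
  rw [hadm.mem_cells_iff hL]
  refine ⟨c • ℓ, ⟨fun v hv => ?_, by rw [hcon]; exact hℓ.2⟩, by rw [hull, hull, hcon]⟩
  simp only [qval_smul_form, AffineMap.coe_smul, Pi.smul_apply, smul_eq_mul]
  exact mul_le_mul_of_nonneg_left (hℓ.1 v hv) hc.le

lemma smul_mem_closure (hL : IsStandardPeriodic L) (hT : ∀ Q ∈ T, Q.IsSymm)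
    (hR : R ∈ closure (secondaryCone L T D)) {c : ℝ} (hc : 0 < c) :
    c • R ∈ closure (secondaryCone L T D) :=
  map_mem_closure (continuous_const_smul c) hR fun _ hQ => smul_mem_secondaryCone hL hT hQ hc

lemma zero_mem_closure (hL : IsStandardPeriodic L) (hT : ∀ Q ∈ T, Q.IsSymm)
    (hQ : Q ∈ secondaryCone L T D) : (0 : Mat d) ∈ closure (secondaryCone L T D) := by
  have hcont : Filter.Tendsto (fun c : ℝ => c • Q) (nhdsWithin 0 (Set.Ioi 0)) (nhds 0) := by
    have : Continuous fun c : ℝ => c • Q := continuous_id.smul continuous_const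
    have := (this.tendsto 0).mono_left (nhdsWithin_le_nhds (s := Set.Ioi 0))
    rwa [zero_smul] at this
  refine mem_closure_of_tendsto hcont ?_
  filter_upwards [self_mem_nhdsWithin] with c hc
  exact smul_mem_secondaryCone hL hT hQ hc

lemma add_mem_closure (hL : IsStandardPeriodic L) (hT : ∀ Q ∈ T, Q.IsSymm)
    (hgen : IsGeneric L T D) {A B : Mat d} (hA : A ∈ closure (secondaryCone L T D))
    (hB : B ∈ closure (secondaryCone L T D)) : A + B ∈ closure (secondaryCone L T D) :=
  map_mem_closure₂ continuous_add hA hB fun _ hQ _ hR =>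
    add_mem_secondaryCone hL hT hgen hQ (subset_closure hR)

/-- A secondary cone does not meet the closure of another one. -/
lemma eq_of_mem_of_mem_closure (hL : IsStandardPeriodic L) (hT : ∀ Q ∈ T, Q.IsSymm)
    (hgen : IsGeneric L T D) (hQ : Q ∈ secondaryCone L T D)
    (hQ' : Q ∈ closure (secondaryCone L T D')) : D = D' := by
  obtain ⟨Q', hmem⟩ : (secondaryCone L T D').Nonempty := closure_nonempty_iff.1 ⟨Q, hQ'⟩
  have hQa := admissible_of_mem hT hQ
  have hQa' := admissible_of_mem hT hmem
  rw [← Del_eq_of_mem hQ, ← Del_eq_of_mem hmem]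
  symm
  apply Del_eq_of_cells_subset hL hQa' hQa
  intro P hP
  obtain ⟨ℓ', hℓ', rfl, hint⟩ := hQa'.exists_of_mem_cells hL hP
  rw [Del_eq_of_mem hmem] at hP
  obtain ⟨ℓ, hℓ, hsub⟩ := exists_minorant_of_mem_closure hL hT hP hQ'
  rw [hint] at hsub
  have hcell : CellMap L (qval Q) ℓ :=
    ⟨hℓ, top_le_iff.1 (by rw [← hℓ'.2]; exact affineSpan_mono ℝ hsub)⟩
  have hP₀ : hull L (qval Q) ℓ ∈ cells (Del L Q) := (hQa.mem_cells_iff hL).2 ⟨ℓ, hcell, rfl⟩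
  rw [Del_eq_of_mem hQ] at hP₀
  -- Genericity makes Q' affine on the possibly larger cell for Q; matching ℓ' on the spanning
  -- vertices of the smaller cell, it forces the two cells to coincide.
  obtain ⟨ℓ₂, h₂⟩ := exists_affine_on_cell hL hT hgen hP₀ hmem.2
  rw [hQa.inter_hull_eq hL hℓ] at h₂
  have e : ℓ₂ = ℓ' := eq_of_eqOn_spanning hℓ'.2 fun v hv => by rw [← h₂ v (hsub hv), hv.2]
  have hset : contact L (qval Q') ℓ' = contact L (qval Q) ℓ :=
    hsub.antisymm fun v hv => ⟨hv.1, by rw [h₂ v hv, e]⟩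
  rw [hull, hset]
  rw [← Del_eq_of_mem hQ] at hP₀
  exact hP₀

end Cones

/-! ### Walls between secondary cones -/

section Walls

variable {d : ℕ} {L : Set (Fin d → ℝ)} {T : Submodule ℝ (Mat d)}
  {D D' : Set (Set (Fin d → ℝ))} {𝓕 : Set (Mat d)}

/-- The cone on which both closures of secondary cones meet. -/
def closureInter (L : Set (Fin d → ℝ)) (T : Submodule ℝ (Mat d)) (D D' : Set (Set (Fin d → ℝ))) :
    Set (Mat d) :=
  closure (secondaryCone L T D) ∩ closure (secondaryCone L T D')

/-- `N` is the normal and `Q₀` a relative interior point of a wall between the secondary cones of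
`D` and `D'`. -/
structure IsWall (L : Set (Fin d → ℝ)) (T : Submodule ℝ (Mat d))
    (D D' : Set (Set (Fin d → ℝ))) (N Q₀ : Mat d) : Prop where
  normal_mem : N ∈ T
  normal_unit : ip N N = 1
  pos : ∀ Q ∈ secondaryCone L T D, 0 < ip N Q
  neg : ∀ Q ∈ secondaryCone L T D', ip N Q < 0
  admissible : Admissible Q₀
  mem_T : Q₀ ∈ T
  mem : Q₀ ∈ closureInter L T D D'
  ker_le : ∀ C ∈ T, ∀ x, qval Q₀ x = 0 → qval C x = 0
  absorb : ∀ C ∈ T, ip N C = 0 → ∃ t : ℝ, 0 < t ∧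
    t • Q₀ + C ∈ closureInter L T D D' ∧ t • Q₀ - C ∈ closureInter L T D D'

/-- The closure is stable under positive scaling and contains 0, so the maximum of an exposing
functional is 0. -/
lemma exposed_face_eq (hL : IsStandardPeriodic L) (hT : ∀ Q ∈ T, Q.IsSymm)
    (hD : (secondaryCone L T D).Nonempty)
    {F : Set (Mat d)} (hF : F.Nonempty) (hexp : IsExposed ℝ (closure (secondaryCone L T D)) F) :
    ∃ l : Mat d →ₗ[ℝ] ℝ, (∀ R ∈ closure (secondaryCone L T D), l R ≤ 0) ∧
      F = {R ∈ closure (secondaryCone L T D) | l R = 0} := by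
  obtain ⟨l, rfl⟩ := hexp hF
  obtain ⟨Q, hQ⟩ := hD
  obtain ⟨R₀, hR₀, hmax⟩ := hF
  have h0 := zero_mem_closure hL hT hQ
  have hl0 : l R₀ = 0 := by
    have h1 := hmax 0 h0
    have h2 := hmax _ (smul_mem_closure hL hT hR₀ (c := 2) two_pos)
    rw [map_zero] at h1
    rw [map_smul, smul_eq_mul] at h2
    linarith
  refine ⟨l, fun R hR => by have := hmax R hR; rw [hl0] at this; exact this, ?_⟩
  ext R
  constructor
  · rintro ⟨hR, h⟩
    refine ⟨hR, le_antisymm ?_ ?_⟩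
    · have := hmax R hR; rw [hl0] at this; exact this
    · have := h 0 h0; rw [map_zero] at this; exact this
  · rintro ⟨hR, h⟩
    refine ⟨hR, fun y hy => ?_⟩
    have h' : l R = 0 := h
    rw [h']
    have := hmax y hy; rwa [hl0] at this

lemma vectorSpan_closure_secondaryCone (hgen : IsGeneric L T D) :
    vectorSpan ℝ (closure (secondaryCone L T D)) = T := by
  apply le_antisymm
  · rw [vectorSpan_def, Submodule.span_le]
    rintro _ ⟨A, hA, B, hB, rfl⟩
    exact T.sub_mem (closure_secondaryCone_subset hA) (closure_secondaryCone_subset hB)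
  · conv_lhs => rw [← vectorSpan_secondaryCone hgen]
    exact vectorSpan_mono ℝ subset_closure

/-- The unit normal of a facet of a secondary cone. -/
lemma exists_facet_normal (hL : IsStandardPeriodic L) (hT : ∀ Q ∈ T, Q.IsSymm)
    (hgen : IsGeneric L T D) (hF : IsFacet (closure (secondaryCone L T D)) 𝓕) :
    ∃ N ∈ T, ip N N = 1 ∧ (∀ R ∈ 𝓕, ip N R = 0) ∧
      (∀ R ∈ closure (secondaryCone L T D), 0 ≤ ip N R) ∧
      ∀ C ∈ T, ip N C = 0 → C ∈ Submodule.span ℝ 𝓕 := by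
  obtain ⟨hne, hexp, hdim⟩ := hF
  obtain ⟨l, hl, rfl⟩ := exposed_face_eq hL hT hgen.1 hne hexp
  set 𝓕 := {R ∈ closure (secondaryCone L T D) | l R = 0} with h𝓕
  obtain ⟨Q, hQ⟩ := hgen.1
  have h0 : (0 : Mat d) ∈ 𝓕 := ⟨zero_mem_closure hL hT hQ, map_zero l⟩
  have hspan : vectorSpan ℝ 𝓕 = Submodule.span ℝ 𝓕 := by
    rw [vectorSpan_eq_span_vsub_set_right ℝ h0]
    simp
  have hdT : finrank ℝ (Submodule.span ℝ 𝓕) + 1 = finrank ℝ T := by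
    unfold dim at hdim
    rw [hspan, vectorSpan_closure_secondaryCone hgen] at hdim
    exact hdim
  have h𝓕T : Submodule.span ℝ 𝓕 ≤ T :=
    Submodule.span_le.2 fun R hR => closure_secondaryCone_subset hR.1
  obtain ⟨B, hB, hBl⟩ := exists_ip_eq hT (-l)
  -- Otherwise the facet would be the whole closure, against its codimension one.
  have hBne : B ≠ 0 := by
    rintro rfl
    have hall : 𝓕 = closure (secondaryCone L T D) := by
      apply Set.Subset.antisymm (fun R hR => hR.1)
      intro R hR
      refine ⟨hR, ?_⟩
      have := hBl R (closure_secondaryCone_subset hR)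
      simp only [ip, Matrix.zero_mul, Matrix.trace_zero, LinearMap.neg_apply] at this
      linarith
    rw [hall] at hdim
    omega
  have hBpos : 0 < ip B B := lt_of_le_of_ne (ip_self_nonneg (hT _ hB)) fun h =>
    hBne (ip_self_eq_zero (hT _ hB) h.symm)
  set c := (√(ip B B))⁻¹ with hc
  have hcpos : 0 < c := inv_pos.2 (Real.sqrt_pos.2 hBpos)
  have hNT : c • B ∈ T := T.smul_mem c hB
  have hNN : ip (c • B) (c • B) = 1 := by
    have hs := Real.mul_self_sqrt hBpos.le
    have hsne := (Real.sqrt_pos.2 hBpos).ne'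
    rw [ip_smul_left, ip_smul_right, hc]
    field_simp
    nlinarith
  have hN𝓕 : ∀ R ∈ 𝓕, ip (c • B) R = 0 := by
    intro R hR
    rw [ip_smul_left, hBl R (closure_secondaryCone_subset hR.1), LinearMap.neg_apply, hR.2]
    simp
  refine ⟨c • B, hNT, hNN, hN𝓕, ?_, ?_⟩
  · intro R hR
    rw [ip_smul_left, hBl R (closure_secondaryCone_subset hR), LinearMap.neg_apply]
    exact mul_nonneg hcpos.le (by linarith [hl R hR])
  · have hle : Submodule.span ℝ 𝓕 ≤ T ⊓ LinearMap.ker (ipLin (c • B)) :=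
      le_inf h𝓕T (Submodule.span_le.2 fun R hR => hN𝓕 R hR)
    have hlt : finrank ℝ (T ⊓ LinearMap.ker (ipLin (c • B)) : Submodule ℝ (Mat d)) <
        finrank ℝ T := by
      apply Submodule.finrank_lt_finrank_of_lt
      refine lt_of_le_of_ne inf_le_left fun heq => ?_
      have : c • B ∈ T ⊓ LinearMap.ker (ipLin (c • B)) := by rw [heq]; exact hNT
      have h1 : ip (c • B) (c • B) = 0 := this.2
      rw [hNN] at h1
      exact one_ne_zero h1
    -- Both spaces have codimension one in T.
    have heq := Submodule.eq_of_le_of_finrank_le hle (by omega)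
    intro C hC hC0
    rw [heq]
    exact ⟨hC, hC0⟩

/-- In the span of finitely many elements of a cone, their sum is a relative interior point. -/
lemma exists_smul_sum_add_mem {V : Type*} [AddCommGroup V] [Module ℝ V] {K : Set V}
    (h0 : (0 : V) ∈ K) (hadd : ∀ A ∈ K, ∀ B ∈ K, A + B ∈ K)
    (hsmul : ∀ c : ℝ, 0 < c → ∀ A ∈ K, c • A ∈ K) (s : Finset V) (hs : ∀ R ∈ s, R ∈ K) {C : V}
    (hC : C ∈ Submodule.span ℝ (s : Set V)) :
    ∃ t : ℝ, 0 < t ∧ t • ∑ R ∈ s, R + C ∈ K ∧ t • ∑ R ∈ s, R - C ∈ K := by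
  classical
  have hsum : ∀ s' : Finset V, s' ⊆ s → ∑ R ∈ s', R ∈ K := by
    intro s' hs'
    induction s' using Finset.induction_on with
    | empty => simpa using h0
    | insert a s'' ha ih =>
      rw [Finset.sum_insert ha]
      exact hadd _ (hs _ (hs' (Finset.mem_insert_self _ _))) _
        (ih fun x hx => hs' (Finset.mem_insert_of_mem hx))
  induction hC using Submodule.span_induction with
  | mem R hR =>
    refine ⟨1, one_pos, ?_, ?_⟩
    · rw [one_smul]; exact hadd _ (hsum s subset_rfl) _ (hs R hR)
    · rw [one_smul, ← Finset.add_sum_erase s _ hR, add_sub_cancel_left]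
      exact hsum _ (Finset.erase_subset _ _)
  | zero =>
    exact ⟨1, one_pos, by simpa using hsum s subset_rfl, by simpa using hsum s subset_rfl⟩
  | add A B _ _ ihA ihB =>
    obtain ⟨t, ht, h1, h2⟩ := ihA
    obtain ⟨t', ht', h1', h2'⟩ := ihB
    refine ⟨t + t', by positivity, ?_, ?_⟩
    · convert hadd _ h1 _ h1' using 1; module
    · convert hadd _ h2 _ h2' using 1; module
  | smul c A _ ih =>
    obtain ⟨t, ht, h1, h2⟩ := ih
    rcases lt_trichotomy c 0 with hc | rfl | hc
    · refine ⟨-c * t, mul_pos (by linarith) ht, ?_, ?_⟩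
      · convert hsmul (-c) (by linarith) _ h2 using 1; module
      · convert hsmul (-c) (by linarith) _ h1 using 1; module
    · exact ⟨1, one_pos, by simpa using hsum s subset_rfl, by simpa using hsum s subset_rfl⟩
    · refine ⟨c * t, by positivity, ?_, ?_⟩
      · convert hsmul c hc _ h1 using 1; module
      · convert hsmul c hc _ h2 using 1; module

/-- The facet spans the hyperplane orthogonal to N in T, so a finite sum Q₀ of spanning elements
absorbs every form of that hyperplane. All signs below follow from absorption and from the
disjointness of the two cones. -/
lemma exists_wall (hL : IsStandardPeriodic L) (hT : ∀ Q ∈ T, Q.IsSymm)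
    (hD : IsGeneric L T D) (hD' : IsGeneric L T D') (hne : D ≠ D')
    (hF : IsCommonFacet L T D D' 𝓕) :
    ∃ N Q₀, IsWall L T D D' N Q₀ ∧ IsWallNormal L T D D' 𝓕 N ∧
      ∀ N', IsWallNormal L T D D' 𝓕 N' → ip N' Q₀ = 0 := by
  obtain ⟨N, hNT, hNN, hN𝓕, hnonneg, hspan⟩ := exists_facet_normal hL hT hD hF.1
  have hsub : 𝓕 ⊆ closureInter L T D D' := by
    intro R hR
    obtain ⟨l, -, h⟩ := exposed_face_eq hL hT hD.1 hF.1.1 hF.1.2.1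
    obtain ⟨l', -, h'⟩ := exposed_face_eq hL hT hD'.1 hF.2.1 hF.2.2.1
    have h1 := hR
    have h2 := hR
    rw [h] at h1
    rw [h'] at h2
    exact ⟨h1.1, h2.1⟩
  obtain ⟨s, hs𝓕, hs⟩ := (Submodule.fg_span_iff_fg_span_finset_subset 𝓕).1
    (IsNoetherian.noetherian (Submodule.span ℝ 𝓕))
  set Q₀ : Mat d := ∑ R ∈ s, R with hQ₀
  obtain ⟨Q, hQ⟩ := hD.1
  obtain ⟨Q', hQ'⟩ := hD'.1
  have habsorb : ∀ C ∈ T, ip N C = 0 → ∃ t : ℝ, 0 < t ∧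
      t • Q₀ + C ∈ closureInter L T D D' ∧ t • Q₀ - C ∈ closureInter L T D D' := by
    intro C hC h0
    refine exists_smul_sum_add_mem (K := closureInter L T D D')
      ⟨zero_mem_closure hL hT hQ, zero_mem_closure hL hT hQ'⟩
      (fun A hA B hB => ⟨add_mem_closure hL hT hD hA.1 hB.1, add_mem_closure hL hT hD' hA.2 hB.2⟩)
      (fun c hc A hA => ⟨smul_mem_closure hL hT hA.1 hc, smul_mem_closure hL hT hA.2 hc⟩)
      s (fun R hR => hsub (hs𝓕 hR)) ?_
    rw [← hs]
    exact hspan C hC h0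
  have hscale : ∀ {t : ℝ}, 0 < t → t • Q₀ ∈ closureInter L T D D' → Q₀ ∈ closureInter L T D D' := by
    intro t ht h
    have e : t⁻¹ • (t • Q₀) = Q₀ := by rw [smul_smul, inv_mul_cancel₀ ht.ne', one_smul]
    rw [← e]
    exact ⟨smul_mem_closure hL hT h.1 (inv_pos.2 ht), smul_mem_closure hL hT h.2 (inv_pos.2 ht)⟩
  have hQ₀mem : Q₀ ∈ closureInter L T D D' := by
    obtain ⟨t, ht, h1, -⟩ := habsorb 0 T.zero_mem (by simp [ip])
    rw [add_zero] at h1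
    exact hscale ht h1
  have hQ₀T : Q₀ ∈ T := closure_secondaryCone_subset hQ₀mem.1
  have hnormal0 : ∀ N' : Mat d, (∀ R ∈ 𝓕, ip N' R = 0) → ip N' Q₀ = 0 := by
    intro N' h
    have : ipLin N' Q₀ = 0 := by
      rw [hQ₀, map_sum]
      exact Finset.sum_eq_zero fun R hR => h R (hs𝓕 hR)
    exact this
  have hnot : Q₀ ∉ secondaryCone L T D := fun h =>
    hne (eq_of_mem_of_mem_closure hL hT hD h hQ₀mem.2)
  have hnot' : Q₀ ∉ secondaryCone L T D' := fun h =>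
    hne (eq_of_mem_of_mem_closure hL hT hD' h hQ₀mem.1).symm
  -- If A were orthogonal to N, then t Q₀ = A + (t Q₀ - A) would put Q₀ into the cone of D, although
  -- it lies in the closure of the other one.
  have hpos : ∀ A ∈ secondaryCone L T D, 0 < ip N A := by
    intro A hA
    refine lt_of_le_of_ne (hnonneg A (subset_closure hA)) fun h => hnot ?_
    obtain ⟨t, ht, -, h2⟩ := habsorb A hA.2 h.symm
    have h3 := add_mem_secondaryCone hL hT hD hA h2.1
    rw [add_sub_cancel] at h3
    have e : t⁻¹ • (t • Q₀) = Q₀ := by rw [smul_smul, inv_mul_cancel₀ ht.ne', one_smul]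
    rw [← e]
    exact smul_mem_secondaryCone hL hT h3 (inv_pos.2 ht)
  have hneg : ∀ A ∈ secondaryCone L T D', ip N A < 0 := by
    intro A hA
    rcases lt_trichotomy (ip N A) 0 with h | h | h
    · exact h
    · exfalso
      apply hnot'
      obtain ⟨t, ht, -, h2⟩ := habsorb A hA.2 h
      have h3 := add_mem_secondaryCone hL hT hD' hA h2.2
      rw [add_sub_cancel] at h3
      have e : t⁻¹ • (t • Q₀) = Q₀ := by rw [smul_smul, inv_mul_cancel₀ ht.ne', one_smul]
      rw [← e]
      exact smul_mem_secondaryCone hL hT h3 (inv_pos.2 ht)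
    · exfalso
      have hQpos := hpos Q hQ
      set a := ip N A / ip N Q with ha
      have hapos : 0 < a := div_pos h hQpos
      -- If N were positive on A, then a Q - A would be absorbed, and A + t Q₀ would lie in both
      -- cones.
      obtain ⟨t, ht, -, h2⟩ := habsorb (a • Q - A) (T.sub_mem (T.smul_mem a hQ.2) hA.2) (by
        rw [ip_sub_right, ip_smul_right, ha, div_mul_cancel₀ _ hQpos.ne', sub_self])
      have h3 := add_mem_secondaryCone hL hT hD (smul_mem_secondaryCone hL hT hQ hapos) h2.1
      have h4 := add_mem_secondaryCone hL hT hD' hA (smul_mem_closure hL hT hQ₀mem.2 ht)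
      have e : a • Q + (t • Q₀ - (a • Q - A)) = A + t • Q₀ := by abel
      rw [e] at h3
      exact hne ((Del_eq_of_mem h3).symm.trans (Del_eq_of_mem h4))
  have hQa := admissible_of_mem hT hQ
  have hQa' := admissible_of_mem hT hQ'
  -- A positive combination of Q and Q' orthogonal to N is dominated by a multiple of Q₀, so Q
  -- vanishes wherever Q₀ does.
  have hker : ∀ x, qval Q₀ x = 0 → qval Q x = 0 := by
    intro x h
    have hp := hpos Q hQ
    have hn := hneg Q' hQ'
    obtain ⟨t, ht, -, h2⟩ := habsorb ((-ip N Q') • Q + ip N Q • Q')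
      (T.add_mem (T.smul_mem _ hQ.2) (T.smul_mem _ hQ'.2)) (by
        rw [ip_add_right, ip_smul_right, ip_smul_right]; ring)
    have h3 := qval_nonneg_of_mem_closure h2.1 x
    rw [qval_sub_form, qval_add_form, qval_smul_form, qval_smul_form, qval_smul_form, h] at h3
    have h4 := hQa.qval_nonneg x
    have h5 := mul_nonneg hp.le (hQa'.qval_nonneg x)
    nlinarith
  have hadm : Admissible Q₀ := hQa.of_ker_eq (hT _ hQ₀T) (qval_nonneg_of_mem_closure hQ₀mem.1)
    fun x => ⟨hker x, fun h => qval_eq_zero_of_mem hL hT hD hQ hQ₀T h⟩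
  exact ⟨N, Q₀, ⟨hNT, hNN, hpos, hneg, hadm, hQ₀T, hQ₀mem,
      fun C hC x h => qval_eq_zero_of_mem hL hT hD hQ hC (hker x h), habsorb⟩,
    ⟨hNT, hNN, hN𝓕, hpos, hneg⟩, fun N' hN' => hnormal0 N' hN'.2.2.1⟩

end Walls

/-! ### Refinement of the subdivision on the wall -/

section Refinement

variable {d : ℕ} {L : Set (Fin d → ℝ)} {T : Submodule ℝ (Mat d)}
  {D D' : Set (Set (Fin d → ℝ))} {N Q₀ Q Q' : Mat d} {P P₀ P₁ P₂ F : Set (Fin d → ℝ)}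

lemma ip_neg_left (A B : Mat d) : ip (-A) B = -ip A B := by simp [ip]

lemma ip_neg_right (A B : Mat d) : ip A (-B) = -ip A B := by simp [ip]

lemma IsWall.symm (hW : IsWall L T D D' N Q₀) : IsWall L T D' D (-N) Q₀ where
  normal_mem := T.neg_mem hW.normal_mem
  normal_unit := by rw [ip_neg_left, ip_neg_right, neg_neg]; exact hW.normal_unit
  pos Q hQ := by rw [ip_neg_left]; linarith [hW.neg Q hQ]
  neg Q hQ := by rw [ip_neg_left]; linarith [hW.pos Q hQ]
  admissible := hW.admissible
  mem_T := hW.mem_T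
  mem := ⟨hW.mem.2, hW.mem.1⟩
  ker_le := hW.ker_le
  absorb C hC h0 := by
    obtain ⟨t, ht, h1, h2⟩ := hW.absorb C hC (by rw [ip_neg_left] at h0; linarith)
    exact ⟨t, ht, ⟨h1.2, h1.1⟩, ⟨h2.2, h2.1⟩⟩

/-- Q₀ lies in the closure of the cone, so a supporting map for Q₀ touches at all vertices of P.
This is the refinement of Del(Q₀) by D. -/
lemma exists_cell_superset (hL : IsStandardPeriodic L) (hT : ∀ Q ∈ T, Q.IsSymm)
    (hQ : Q ∈ secondaryCone L T D) (hW : IsWall L T D D' N Q₀) (hP : P ∈ cells D) :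
    ∃ P₀ ∈ cells (Del L Q₀), P ⊆ P₀ := by
  obtain ⟨ℓ, hℓ, hsub⟩ := exists_minorant_of_mem_closure hL hT hP hW.mem.1
  have hQa := admissible_of_mem hT hQ
  rw [← Del_eq_of_mem hQ] at hP
  have hsp := affineSpan_inter_of_mem_cells hL hQa hP
  refine ⟨hull L (qval Q₀) ℓ, (hW.admissible.mem_cells_iff hL).2
    ⟨ℓ, ⟨hℓ, top_le_iff.1 (by rw [← hsp]; exact affineSpan_mono ℝ hsub)⟩, rfl⟩, ?_⟩
  rw [eq_convexHull_inter_of_mem_cells hL hQa hP]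
  exact convexHull_mono hsub

lemma eq_of_cell_subset (hL : IsStandardPeriodic L) (hT : ∀ Q ∈ T, Q.IsSymm)
    (hQ : Q ∈ secondaryCone L T D) (hQ₀ : Admissible Q₀) (hP : P ∈ cells D)
    (h₁ : P₁ ∈ cells (Del L Q₀)) (h₂ : P₂ ∈ cells (Del L Q₀)) (hs₁ : P ⊆ P₁) (hs₂ : P ⊆ P₂) :
    P₁ = P₂ := by
  rw [← Del_eq_of_mem hQ] at hP
  obtain ⟨x, hx⟩ := interior_nonempty_of_mem_cells hL (admissible_of_mem hT hQ) hP
  exact eq_of_interior_meets_cell hL hQ₀ h₁ h₂ (interior_mono hs₁ hx) (hs₂ (interior_subset hx))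

lemma exists_subcell_of_mem_interior (hL : IsStandardPeriodic L) (hT : ∀ Q ∈ T, Q.IsSymm)
    (hQ : Q ∈ secondaryCone L T D) (hW : IsWall L T D D' N Q₀) (hP₀ : P₀ ∈ cells (Del L Q₀))
    {x : Fin d → ℝ} (hx : x ∈ interior P₀) : ∃ P ∈ cells D, P ⊆ P₀ ∧ x ∈ P := by
  obtain ⟨P, hP, hxP⟩ := exists_cell_mem hL (admissible_of_mem hT hQ) x
  rw [Del_eq_of_mem hQ] at hP
  obtain ⟨P₁, hP₁, hsub⟩ := exists_cell_superset hL hT hQ hW hP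
  have := eq_of_interior_meets_cell hL hW.admissible hP₀ hP₁ hx (hsub hxP)
  exact ⟨P, hP, this ▸ hsub, hxP⟩

lemma exists_subcell (hL : IsStandardPeriodic L) (hT : ∀ Q ∈ T, Q.IsSymm)
    (hQ : Q ∈ secondaryCone L T D) (hW : IsWall L T D D' N Q₀) (hP₀ : P₀ ∈ cells (Del L Q₀)) :
    ∃ P ∈ cells D, P ⊆ P₀ := by
  obtain ⟨x, hx⟩ := interior_nonempty_of_mem_cells hL hW.admissible hP₀
  obtain ⟨P, hP, hsub, -⟩ := exists_subcell_of_mem_interior hL hT hQ hW hP₀ hx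
  exact ⟨P, hP, hsub⟩

/-- Forms on the wall hyperplane are affine on the vertices of the cells of the wall form. -/
lemma IsWall.exists_affine (hL : IsStandardPeriodic L) (hT : ∀ Q ∈ T, Q.IsSymm)
    (hQ : Q ∈ secondaryCone L T D) (hW : IsWall L T D D' N Q₀) (hP₀ : P₀ ∈ cells (Del L Q₀))
    {C : Mat d} (hC : C ∈ T) (h0 : ip N C = 0) :
    ∃ ℓ : (Fin d → ℝ) →ᵃ[ℝ] ℝ, ∀ v ∈ L ∩ P₀, qval C v = ℓ v := by
  obtain ⟨P, hP, hsub⟩ := exists_subcell hL hT hQ hW hP₀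
  obtain ⟨t, -, h1, h2⟩ := hW.absorb C hC h0
  obtain ⟨ℓ₁, hℓ₁, hc₁⟩ := exists_minorant_of_mem_closure hL hT hP h1.1
  obtain ⟨ℓ₂, hℓ₂, hc₂⟩ := exists_minorant_of_mem_closure hL hT hP h2.1
  obtain ⟨ℓ₀, hℓ₀, -, hint⟩ := hW.admissible.exists_of_mem_cells hL hP₀
  have hsp : affineSpan ℝ (L ∩ P) = ⊤ := affineSpan_inter_of_mem_cells hL
    (admissible_of_mem hT hQ) (by rw [Del_eq_of_mem hQ]; exact hP)
  -- The maps under t Q₀ + C and t Q₀ - C add up to the map of 2 t Q₀. At vertices of P₀ the two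
  -- inequalities thus sum to an equality, and both are tight.
  have e : ℓ₁ + ℓ₂ = (2 * t) • ℓ₀ := eq_of_eqOn_spanning hsp fun v hv => by
    have h3 := (hc₁ hv).2
    have h4 := (hc₂ hv).2
    have h5 : v ∈ contact L (qval Q₀) ℓ₀ := by rw [← hint]; exact ⟨hv.1, hsub hv.2⟩
    have h6 := h5.2
    simp only [qval_add_form, qval_sub_form, qval_smul_form] at h3 h4
    simp only [AffineMap.coe_add, AffineMap.coe_smul, Pi.add_apply, Pi.smul_apply, smul_eq_mul]
    rw [← h6]; linarith
  refine ⟨ℓ₁ - t • ℓ₀, fun v hv => ?_⟩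
  have h3 := hℓ₁ v hv.1
  have h4 := hℓ₂ v hv.1
  rw [hint] at hv
  have h6 := hv.2
  have h7 := congrArg (fun g => g v) e
  simp only [qval_add_form, qval_sub_form, qval_smul_form] at h3 h4
  simp only [AffineMap.coe_add, AffineMap.coe_smul, AffineMap.coe_sub, Pi.add_apply,
    Pi.smul_apply, Pi.sub_apply, smul_eq_mul] at h7 ⊢
  rw [← h6] at h7 ⊢
  linarith

/-- A subcell's supporting map is determined by its spanning vertices. If Q is affine on P₀, that
map touches at every vertex of P₀, and the subcell is all of P₀. -/
lemma mem_cells_of_affine (hL : IsStandardPeriodic L) (hT : ∀ Q ∈ T, Q.IsSymm)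
    (hQ : Q ∈ secondaryCone L T D) (hW : IsWall L T D D' N Q₀) (hP₀ : P₀ ∈ cells (Del L Q₀))
    {ℓ : (Fin d → ℝ) →ᵃ[ℝ] ℝ} (hℓ : ∀ v ∈ L ∩ P₀, qval Q v = ℓ v) : P₀ ∈ cells D := by
  obtain ⟨P, hP, hsub⟩ := exists_subcell hL hT hQ hW hP₀
  have hQa := admissible_of_mem hT hQ
  have hP' := hP
  rw [← Del_eq_of_mem hQ] at hP'
  obtain ⟨ℓ₁, hℓ₁, -, hint⟩ := hQa.exists_of_mem_cells hL hP'
  have e : ℓ = ℓ₁ := eq_of_eqOn_spanning hℓ₁.2 fun v hv => by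
    rw [← hv.2]
    rw [← hint] at hv
    exact (hℓ v ⟨hv.1, hsub hv.2⟩).symm
  have hle : L ∩ P₀ ⊆ L ∩ P := by
    rw [hint]
    intro v hv
    exact ⟨hv.1, by rw [hℓ v hv, e]⟩
  have : P₀ = P := by
    apply Set.Subset.antisymm _ hsub
    rw [eq_convexHull_inter_of_mem_cells hL hW.admissible hP₀,
      eq_convexHull_inter_of_mem_cells hL hQa hP']
    exact convexHull_mono hle
  rw [this]; exact hP

lemma mem_cells_of_mem_cells (hL : IsStandardPeriodic L) (hT : ∀ Q ∈ T, Q.IsSymm)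
    (hD : IsGeneric L T D) (hD' : IsGeneric L T D') (hW : IsWall L T D D' N Q₀)
    (hP₀ : P₀ ∈ cells (Del L Q₀)) (h : P₀ ∈ cells D) : P₀ ∈ cells D' := by
  obtain ⟨Q', hQ'⟩ := hD'.1
  obtain ⟨ℓ, hℓ⟩ := exists_affine_on_cell hL hT hD h hQ'.2
  exact mem_cells_of_affine hL hT hQ' hW.symm hP₀ hℓ

/-- A functional which is nonnegative on the secondary cone and vanishes at a relative interior
point of the wall is a multiple of the wall normal. -/
lemma IsWall.functional_eq (hW : IsWall L T D D' N Q₀) (φ : Mat d →ₗ[ℝ] ℝ)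
    (hφ : ∀ R ∈ closure (secondaryCone L T D), 0 ≤ φ R) (h0 : φ Q₀ = 0) {C : Mat d}
    (hC : C ∈ T) : φ C = φ N * ip N C := by
  -- The component of C orthogonal to N is absorbed with either sign, so φ vanishes on it.
  obtain ⟨t, -, h1, h2⟩ := hW.absorb (C - ip N C • N)
    (T.sub_mem hC (T.smul_mem _ hW.normal_mem)) (by
      rw [ip_sub_right, ip_smul_right, hW.normal_unit, mul_one, sub_self])
  have h3 := hφ _ h1.1
  have h4 := hφ _ h2.1
  simp only [map_add, map_sub, map_smul, h0, smul_eq_mul] at h3 h4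
  linarith

/-! ### Facets inside the cells of the wall form -/

lemma affineMap_sum_smul {ι : Type*} [Fintype ι] (ℓ : (Fin d → ℝ) →ᵃ[ℝ] ℝ) (a : ι → ℝ)
    (v : ι → Fin d → ℝ) (ha : ∑ i, a i = 1) : ℓ (∑ i, a i • v i) = ∑ i, a i * ℓ (v i) := by
  have h : ∀ i, a i * ℓ (v i) = a i * ℓ 0 + a i * ℓ.linear (v i) := fun i => by
    rw [affineMap_apply_eq ℓ (v i), mul_add]
  rw [affineMap_apply_eq, map_sum]
  simp only [map_smul, smul_eq_mul, h]
  rw [Finset.sum_add_distrib, ← Finset.sum_mul, ha, one_mul]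

lemma ip_vecMulVec (w : Fin d → ℝ) (Q : Mat d) : ip (Matrix.vecMulVec w w) Q = qval Q w := by
  rw [ip, Matrix.vecMulVec_mul, Matrix.trace_vecMulVec, qval, Matrix.dotProduct_mulVec,
    dotProduct_comm]

lemma IsNForm.ip_eq {v : Fin (d + 1) → Fin d → ℝ} {w : Fin d → ℝ} {M : Mat d}
    (hM : IsNForm v w M) : ∃ a : Fin (d + 1) → ℝ, ∑ i, a i = 1 ∧ ∑ i, a i • v i = w ∧
      ∀ C, ip M C = qval C w - ∑ i, a i * qval C (v i) := by
  obtain ⟨a, h1, h2, rfl⟩ := hM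
  refine ⟨a, h1, h2, fun C => ?_⟩
  rw [ip_sub_left, ip_vecMulVec]
  congr 1
  rw [ip_comm, ← ipLin_apply, map_sum]
  refine Finset.sum_congr rfl fun i _ => ?_
  rw [map_smul, ipLin_apply, ip_comm, ip_vecMulVec, smul_eq_mul]

lemma IsNForm.ip_eq_of_affine {v : Fin (d + 1) → Fin d → ℝ} {w : Fin d → ℝ} {M C : Mat d}
    (hM : IsNForm v w M) {ℓ : (Fin d → ℝ) →ᵃ[ℝ] ℝ} (h : ∀ i, qval C (v i) = ℓ (v i)) :
    ip M C = qval C w - ℓ w := by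
  obtain ⟨a, h1, h2, h3⟩ := hM.ip_eq
  rw [h3, ← h2, affineMap_sum_smul ℓ a v h1]
  simp only [h]

lemma le_equalitySpace (hL : IsStandardPeriodic L) (hT : ∀ Q ∈ T, Q.IsSymm)
    (hgen : IsGeneric L T D) : T ≤ equalitySpace L D := by
  intro C hC
  refine ⟨hT C hC, fun P hP v _ hvP w hw M hM => ?_⟩
  obtain ⟨ℓ, hℓ⟩ := exists_affine_on_cell hL hT hgen hP hC
  rw [hM.ip_eq_of_affine fun i => hℓ _ (hvP i), hℓ w hw, sub_self]

lemma nonempty_of_mem_Del (hF : F ∈ Del L Q) : F.Nonempty := by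
  obtain ⟨V, hV, -, rfl, -⟩ := hF
  exact convexHull_nonempty_iff.2 hV

/-- `F` is the common facet of two cells of `D` which lie in the cell `P₀`. -/
structure IsInnerFacet {d : ℕ} (D : Set (Set (Fin d → ℝ))) (P₀ P₁ P₂ F : Set (Fin d → ℝ)) :
    Prop where
  left : P₁ ∈ cells D
  right : P₂ ∈ cells D
  ne : P₁ ≠ P₂
  left_subset : P₁ ⊆ P₀
  right_subset : P₂ ⊆ P₀
  eq : F = P₁ ∩ P₂
  nonempty : F.Nonempty
  dim_add_one : dim F + 1 = d

lemma dim_range_add_one {v : Fin d → Fin d → ℝ} (hv : AffineIndependent ℝ v) (hd : 0 < d) :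
    dim (Set.range v) + 1 = d := by
  obtain ⟨n, rfl⟩ : ∃ n, d = n + 1 := ⟨d - 1, by omega⟩
  unfold dim
  rw [hv.finrank_vectorSpan (n := n) (by simp)]

/-- The facet form pairs to zero with Q₀, so the supporting map of Q₀ on P also touches at w' beyond
the facet. Hence Q₀ does not break there, and both neighbours lie in one cell of Q₀. -/
lemma exists_isInnerFacet_of_mem_wallFacets (hL : IsStandardPeriodic L)
    (hT : ∀ Q ∈ T, Q.IsSymm) (hD : IsGeneric L T D) (hQ : Q ∈ secondaryCone L T D)
    (hW : IsWall L T D D' N Q₀) {𝓕 : Set (Mat d)}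
    (hn : ∀ N', IsWallNormal L T D D' 𝓕 N' → ip N' Q₀ = 0)
    (hF : F ∈ wallFacets L T D D' 𝓕) :
    ∃ P₀ ∈ cells (Del L Q₀), ∃ P₁ P₂, IsInnerFacet D P₀ P₁ P₂ F := by
  obtain ⟨hFD, hdim, N', hN', Mf, B, ⟨hMfU, -, P, hP, P', hP', hFeq, v, hvind, hvF, w, hw, w', hw',
    M, hM, c, hc, hproj⟩, hB, a, ha, hNa⟩ := hF
  have hFne : F.Nonempty := by
    rw [← Del_eq_of_mem hQ] at hFD
    exact nonempty_of_mem_Del hFD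
  have hQa := admissible_of_mem hT hQ
  -- Q₀ lies in T and therefore in `equalitySpace`, so neither projection changes the pairing with
  -- it; only nonzero factors intervene.
  have hMQ₀ : ip M Q₀ = 0 := by
    have h1 := hn N' hN'
    rw [hNa, ip_smul_left] at h1
    have h2 : ip B Q₀ = 0 := (mul_eq_zero.1 h1).resolve_left ha.ne'
    rw [hB.ip_eq hW.mem_T] at h2
    rw [← hproj.ip_eq (le_equalitySpace hL hT hD hW.mem_T), ip_smul_left, h2, mul_zero]
  obtain ⟨P₀, hP₀, hsub⟩ := exists_cell_superset hL hT hQ hW hP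
  obtain ⟨P₀', hP₀', hsub'⟩ := exists_cell_superset hL hT hQ hW hP'
  obtain ⟨ℓ₀, hℓ₀, hP₀eq, hint₀⟩ := hW.admissible.exists_of_mem_cells hL hP₀
  obtain ⟨ℓ₀', hℓ₀', hP₀eq', hint₀'⟩ := hW.admissible.exists_of_mem_cells hL hP₀'
  have hPd := hP
  have hPd' := hP'
  rw [← Del_eq_of_mem hQ] at hPd hPd'
  obtain ⟨ℓ₁, hℓ₁, -, hint₁⟩ := hQa.exists_of_mem_cells hL hPd
  obtain ⟨ℓ₂, hℓ₂, -, hint₂⟩ := hQa.exists_of_mem_cells hL hPd'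
  have hw'P : w' ∉ P := fun h => hw'.2 (by rw [hFeq]; exact ⟨h, hw'.1.2⟩)
  have hvP : ∀ i, v i ∈ L ∩ P := fun i => ⟨(hvF i).1, by
    have := (hvF i).2; rw [hFeq] at this; exact this.1⟩
  have hvP' : ∀ i, v i ∈ L ∩ P' := fun i => ⟨(hvF i).1, by
    have := (hvF i).2; rw [hFeq] at this; exact this.2⟩
  have hval : ∀ x ∈ L ∩ P, qval Q₀ x = ℓ₀ x := fun x hx => by
    have : x ∈ L ∩ P₀ := ⟨hx.1, hsub hx.2⟩
    rw [hint₀] at this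
    exact this.2
  have hval' : ∀ x ∈ L ∩ P', qval Q₀ x = ℓ₀' x := fun x hx => by
    have : x ∈ L ∩ P₀' := ⟨hx.1, hsub' hx.2⟩
    rw [hint₀'] at this
    exact this.2
  have hw'ℓ : qval Q₀ w' = ℓ₀ w' := by
    have := hM.ip_eq_of_affine (C := Q₀) (ℓ := ℓ₀) (fun i => by
      refine Fin.cases ?_ (fun j => ?_) i
      · exact hval w hw.1
      · exact hval _ (hvP j))
    rw [hMQ₀] at this
    linarith
  have hne : (ℓ₁ - ℓ₂) w' ≠ 0 := by
    have h1 : w' ∈ L ∩ P' := hw'.1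
    rw [hint₂] at h1
    intro h0
    simp only [AffineMap.coe_sub, Pi.sub_apply, sub_eq_zero] at h0
    have h2 : w' ∈ L ∩ P := by rw [hint₁]; exact ⟨h1.1, by rw [h0]; exact h1.2⟩
    exact hw'P h2.2
  have hd : 0 < d := by omega
  -- The breaks of Q₀ and of Q across the facet are proportional. At w' the former vanishes and the
  -- latter does not, so the ratio is zero.
  obtain ⟨e, he⟩ := exists_smul_eq_of_codim_one (s := Set.range v) (g := ℓ₁ - ℓ₂) (h := ℓ₀ - ℓ₀')
    ⟨_, ⟨⟨0, hd⟩, rfl⟩⟩ (by rw [dim_range_add_one hvind hd, finrank_fin_fun]) (by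
      rintro _ ⟨i, rfl⟩
      have h1 := hvP i
      have h2 := hvP' i
      rw [hint₁] at h1
      rw [hint₂] at h2
      simp only [AffineMap.coe_sub, Pi.sub_apply]
      rw [← h1.2, ← h2.2, sub_self]) (by
      rintro _ ⟨i, rfl⟩
      simp only [AffineMap.coe_sub, Pi.sub_apply]
      rw [← hval _ (hvP i), ← hval' _ (hvP' i), sub_self])
    (by intro h0; rw [h0] at hne; exact hne rfl)
  have he0 : e = 0 := by
    have := congrArg (fun g => g w') he
    simp only [AffineMap.coe_smul, Pi.smul_apply, smul_eq_mul] at this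
    rw [AffineMap.coe_sub, Pi.sub_apply, ← hw'ℓ, ← hval' w' hw'.1, sub_self] at this
    exact (mul_eq_zero.1 this.symm).resolve_right hne
  rw [he0, zero_smul, sub_eq_zero] at he
  refine ⟨P₀, hP₀, P, P', hP, hP', ?_, hsub, ?_, hFeq, hFne, hdim⟩
  · rintro rfl
    exact hw'P hw'.1.2
  · rw [hP₀eq, he, ← hP₀eq']; exact hsub'

end Refinement

/-! ### Inner facets of wall cells belong to the wall -/

section InnerFacets

variable {d : ℕ} {L : Set (Fin d → ℝ)} {T : Submodule ℝ (Mat d)}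
  {D D' : Set (Set (Fin d → ℝ))} {N Q₀ Q Q' : Mat d} {P P₀ P₁ P₂ F : Set (Fin d → ℝ)}

lemma inter_mem_Del (hL : IsStandardPeriodic L) (hQ : Admissible Q) (h₁ : P₁ ∈ cells (Del L Q))
    (h₂ : P₂ ∈ cells (Del L Q)) (hne : (P₁ ∩ P₂).Nonempty) : P₁ ∩ P₂ ∈ Del L Q := by
  obtain ⟨ℓ₁, hℓ₁, rfl, -⟩ := hQ.exists_of_mem_cells hL h₁
  obtain ⟨ℓ₂, hℓ₂, rfl, -⟩ := hQ.exists_of_mem_cells hL h₂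
  have hset : {v ∈ contact L (qval Q) ℓ₁ | (ℓ₂ - ℓ₁) v = 0} =
      contact L (qval Q) ℓ₁ ∩ contact L (qval Q) ℓ₂ := by
    ext v
    simp only [AffineMap.coe_sub, Pi.sub_apply, sub_eq_zero]
    constructor
    · rintro ⟨h, h'⟩
      exact ⟨h, h.1, h.2.trans h'.symm⟩
    · rintro ⟨h, h'⟩
      exact ⟨h, h'.2.symm.trans h.2⟩
  rw [hull_inter_hull hℓ₁.1 hℓ₂.1] at hne ⊢
  rw [← hset] at hne ⊢
  apply hQ.face_mem_Del hL hℓ₁.1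
  · intro v hv
    have := hℓ₂.1 v hv.1
    have := hv.2
    simp only [AffineMap.coe_sub, Pi.sub_apply]
    linarith
  · exact convexHull_nonempty_iff.1 hne

lemma inter_eq_convexHull (hL : IsStandardPeriodic L) (hQ : Admissible Q)
    (h₁ : P₁ ∈ cells (Del L Q)) (h₂ : P₂ ∈ cells (Del L Q)) :
    P₁ ∩ P₂ = convexHull ℝ (L ∩ (P₁ ∩ P₂)) := by
  obtain ⟨ℓ₁, hℓ₁, rfl, hint₁⟩ := hQ.exists_of_mem_cells hL h₁
  obtain ⟨ℓ₂, hℓ₂, rfl, hint₂⟩ := hQ.exists_of_mem_cells hL h₂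
  rw [Set.inter_inter_distrib_left, hint₁, hint₂, hull_inter_hull hℓ₁.1 hℓ₂.1]

/-- A point off the span of `d` affinely independent points completes them to a generating
family. -/
lemma exists_affine_coordinates {v : Fin d → Fin d → ℝ} (hv : AffineIndependent ℝ v) (hd : 0 < d)
    {w : Fin d → ℝ} (k : (Fin d → ℝ) →ᵃ[ℝ] ℝ) (hk : ∀ i, k (v i) = 0) (hkw : k w ≠ 0)
    (w' : Fin d → ℝ) :
    ∃ a : Fin (d + 1) → ℝ, ∑ i, a i = 1 ∧
      ∑ i, a i • (Fin.cons w v : Fin (d + 1) → Fin d → ℝ) i = w' := by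
  set p : Fin (d + 1) → Fin d → ℝ := Fin.cons w v with hp
  have hspan : affineSpan ℝ (Set.range p) = ⊤ := by
    rw [AffineSubspace.affineSpan_eq_top_iff_vectorSpan_eq_top_of_nonempty ℝ _ _
      (Set.range_nonempty p)]
    -- Otherwise an affine map g vanishes on all the points; being proportional to g, k would vanish
    -- at w.
    by_contra hne
    obtain ⟨f, hf0, hf⟩ := Submodule.exists_le_ker_of_lt_top _ (lt_top_iff_ne_top.2 hne)
    set g : (Fin d → ℝ) →ᵃ[ℝ] ℝ := f.toAffineMap - AffineMap.const ℝ _ (f w) with hg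
    have hval : ∀ y, g y = f (y - w) := by intro y; simp [hg]
    have hgne : g ≠ 0 := by
      intro h0
      apply hf0
      ext i
      have := congrArg (fun g => g (w + Pi.single i 1)) h0
      simp only [hval, add_sub_cancel_left] at this
      simpa using this
    obtain ⟨c, hc⟩ := exists_smul_eq_of_codim_one (s := Set.range v) (g := g) (h := k)
      ⟨_, ⟨⟨0, hd⟩, rfl⟩⟩ (by rw [dim_range_add_one hv hd, finrank_fin_fun]) (by
        rintro _ ⟨i, rfl⟩
        rw [hval]
        exact hf (vsub_mem_vectorSpan ℝ (s := Set.range p) ⟨i.succ, by simp [hp]⟩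
          ⟨0, by simp [hp]⟩)) (by
        rintro _ ⟨i, rfl⟩
        exact hk i) hgne
    apply hkw
    rw [hc, AffineMap.coe_smul, Pi.smul_apply, hval, sub_self, map_zero, smul_zero]
  obtain ⟨a, ha, haw⟩ := eq_affineCombination_of_mem_affineSpan_of_fintype (k := ℝ) (p1 := w')
    (p := p) (by rw [hspan]; trivial)
  refine ⟨a, ha, ?_⟩
  rw [haw, Finset.univ.affineCombination_eq_linear_combination p a ha]

/-- The form M of the facet is positive on the cone of D, as w' is no vertex of P₁. It vanishes at
Q₀, as all points involved lie in P₀. On T it is therefore a positive multiple of N. -/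
lemma mem_wallFacets_of_isInnerFacet (hL : IsStandardPeriodic L)
    (hT : ∀ Q ∈ T, Q.IsSymm) (hD : IsGeneric L T D)
    (hW : IsWall L T D D' N Q₀) {𝓕 : Set (Mat d)} (hN : IsWallNormal L T D D' 𝓕 N)
    (hP₀ : P₀ ∈ cells (Del L Q₀)) (hF : IsInnerFacet D P₀ P₁ P₂ F) :
    F ∈ wallFacets L T D D' 𝓕 := by
  obtain ⟨Q, hQ⟩ := hD.1
  have hQa := admissible_of_mem hT hQ
  have h₁ := hF.left
  have h₂ := hF.right
  rw [← Del_eq_of_mem hQ] at h₁ h₂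
  have hd : 0 < d := by have := hF.dim_add_one; omega
  have hFD : F ∈ D := by
    have := inter_mem_Del hL hQa h₁ h₂ (by rw [← hF.eq]; exact hF.nonempty)
    rwa [← hF.eq, Del_eq_of_mem hQ] at this
  have hFhull : F = convexHull ℝ (L ∩ F) := by
    have := inter_eq_convexHull hL hQa h₁ h₂
    rwa [← hF.eq] at this
  have hLF : (L ∩ F).Nonempty := by
    have := hF.nonempty
    rw [hFhull] at this
    exact convexHull_nonempty_iff.1 this
  obtain ⟨ℓ₁, hℓ₁, -, hint₁⟩ := hQa.exists_of_mem_cells hL h₁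
  obtain ⟨ℓ₂, hℓ₂, -, hint₂⟩ := hQa.exists_of_mem_cells hL h₂
  obtain ⟨v, hvind, hvF⟩ : ∃ v : Fin d → Fin d → ℝ, AffineIndependent ℝ v ∧ ∀ i, v i ∈ L ∩ F := by
    obtain ⟨t, hts, hsp, hind⟩ := exists_affineIndependent ℝ (Fin d → ℝ) (L ∩ F)
    have hfin : Finite t := finite_set_of_fin_dim_affineIndependent ℝ hind
    have : Fintype t := Fintype.ofFinite t
    have htne : Nonempty t := by
      rw [Set.nonempty_coe_sort, ← affineSpan_nonempty ℝ, hsp, affineSpan_nonempty]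
      exact hLF
    have hcard := hind.finrank_vectorSpan_add_one
    have hdt : finrank ℝ (vectorSpan ℝ (Set.range ((↑) : t → Fin d → ℝ))) = dim F := by
      rw [Subtype.range_coe, ← direction_affineSpan, hsp]
      conv_rhs => rw [hFhull, dim_convexHull]
      rw [direction_affineSpan, dim]
    rw [hdt, hF.dim_add_one] at hcard
    let e := (Fintype.equivFinOfCardEq hcard.symm).symm
    exact ⟨fun i => e i, hind.comp_embedding e.toEmbedding, fun i => hts (e i).2⟩
  have hex : ∀ P ∈ cells (Del L Q), ∃ w ∈ L ∩ P, w ∉ F := by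
    intro P hP
    by_contra hcon
    push Not at hcon
    have h3 := affineSpan_inter_of_mem_cells hL hQa hP
    have h4 : affineSpan ℝ F = ⊤ := top_le_iff.1 (by rw [← h3]; exact affineSpan_mono ℝ hcon)
    rw [affineSpan_eq_top_iff_dim hF.nonempty, finrank_fin_fun] at h4
    have := hF.dim_add_one
    omega
  obtain ⟨w, hw, hwF⟩ := hex P₁ h₁
  obtain ⟨w', hw', hw'F⟩ := hex P₂ h₂
  have hvP₁ : ∀ i, v i ∈ L ∩ P₁ := fun i => ⟨(hvF i).1, by
    have := (hvF i).2; rw [hF.eq] at this; exact this.1⟩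
  have hvP₂ : ∀ i, v i ∈ L ∩ P₂ := fun i => ⟨(hvF i).1, by
    have := (hvF i).2; rw [hF.eq] at this; exact this.2⟩
  have hw'P₁ : w' ∉ P₁ := fun h => hw'F (by rw [hF.eq]; exact ⟨h, hw'.2⟩)
  have hwP₂ : w ∉ P₂ := fun h => hwF (by rw [hF.eq]; exact ⟨hw.2, h⟩)
  obtain ⟨a, ha, haw⟩ := exists_affine_coordinates hvind hd (w := w) (ℓ₁ - ℓ₂) (fun i => by
      have h1 := hvP₁ i
      have h2 := hvP₂ i
      rw [hint₁] at h1
      rw [hint₂] at h2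
      simp only [AffineMap.coe_sub, Pi.sub_apply]
      rw [← h1.2, ← h2.2, sub_self]) (by
      intro h0
      simp only [AffineMap.coe_sub, Pi.sub_apply, sub_eq_zero] at h0
      have h1 := hw
      rw [hint₁] at h1
      have : w ∈ L ∩ P₂ := by rw [hint₂]; exact ⟨h1.1, by rw [← h0]; exact h1.2⟩
      exact hwP₂ this.2) w'
  set p : Fin (d + 1) → Fin d → ℝ := Fin.cons w v with hp
  set M : Mat d := Matrix.vecMulVec w' w' - ∑ i, a i • Matrix.vecMulVec (p i) (p i) with hMdef
  have hM : IsNForm p w' M := ⟨a, ha, haw, rfl⟩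
  have hpP₁ : ∀ i, p i ∈ L ∩ P₁ := by
    intro i
    refine Fin.cases ?_ (fun j => ?_) i
    · exact hw
    · exact hvP₁ j
  have hpos : ∀ A ∈ secondaryCone L T D, 0 < ip M A := by
    intro A hA
    have hP := hF.left
    rw [← Del_eq_of_mem hA] at hP
    obtain ⟨ℓ, hℓ, -, hint⟩ := (admissible_of_mem hT hA).exists_of_mem_cells hL hP
    rw [hM.ip_eq_of_affine (ℓ := ℓ) fun i => by
      have := hpP₁ i
      rw [hint] at this
      exact this.2]
    have h3 := hℓ.1 w' hw'.1
    rcases h3.lt_or_eq with h4 | h4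
    · linarith
    · exfalso
      have : w' ∈ L ∩ P₁ := by rw [hint]; exact ⟨hw'.1, h4.symm⟩
      exact hw'P₁ this.2
  have hnonneg : ∀ R ∈ closure (secondaryCone L T D), 0 ≤ ipLin M R := by
    intro R hR
    have : closure (secondaryCone L T D) ⊆ {R | 0 ≤ ipLin M R} :=
      closure_minimal (fun A hA => (hpos A hA).le) (isClosed_le continuous_const
        (LinearMap.continuous_of_finiteDimensional (ipLin M)))
    exact this hR
  have hM0 : ipLin M Q₀ = 0 := by
    obtain ⟨ℓ₀, hℓ₀, -, hint₀⟩ := hW.admissible.exists_of_mem_cells hL hP₀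
    have hval : ∀ x ∈ L ∩ P₀, qval Q₀ x = ℓ₀ x := fun x hx => by
      rw [hint₀] at hx
      exact hx.2
    rw [ipLin_apply, hM.ip_eq_of_affine (ℓ := ℓ₀) fun i =>
      hval _ ⟨(hpP₁ i).1, hF.left_subset (hpP₁ i).2⟩,
      hval w' ⟨hw'.1, hF.right_subset hw'.2⟩, sub_self]
  have hfun : ∀ C ∈ T, ip M C = ip M N * ip N C := fun C hC =>
    hW.functional_eq (ipLin M) hnonneg hM0 hC
  have hm : 0 < ip M N := by
    have h3 := hpos Q hQ
    rw [hfun Q hQ.2] at h3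
    exact pos_of_mul_pos_left h3 (hW.pos Q hQ).le
  have hUsymm : ∀ A ∈ equalitySpace L D, A.IsSymm := fun A hA => hA.1
  have hTU := le_equalitySpace hL hT hD
  obtain ⟨B, hB⟩ := exists_isOrthProj hUsymm M
  have hBB : 0 < ip B B := by
    refine lt_of_le_of_ne (ip_self_nonneg (hUsymm _ hB.1)) fun h => ?_
    have hB0 := ip_self_eq_zero (hUsymm _ hB.1) h.symm
    have h3 := hB.ip_eq (hTU hQ.2)
    rw [hB0] at h3
    have h4 := hpos Q hQ
    rw [← h3] at h4
    simp [ip] at h4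
  set s := √(ip B B) with hs
  have hspos : 0 < s := Real.sqrt_pos.2 hBB
  have hss : s * s = ip B B := Real.mul_self_sqrt hBB.le
  obtain ⟨B', hB'⟩ := exists_isOrthProj hT (s⁻¹ • B)
  -- Projecting first to `equalitySpace` and then to T is projecting to T, because T lies in
  -- `equalitySpace`.
  have hB'N : B' = (s⁻¹ * ip M N) • N := by
    apply eq_of_forall_ip hT hB'.1 (T.smul_mem _ hW.normal_mem)
    intro C hC
    rw [hB'.ip_eq hC, ip_smul_left, ip_smul_left, hB.ip_eq (hTU hC), hfun C hC]
    ring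
  have hcpos : 0 < s⁻¹ * ip M N := mul_pos (inv_pos.2 hspos) hm
  refine ⟨hFD, hF.dim_add_one, N, hN, s⁻¹ • B, B', ⟨?_, ?_, P₁, hF.left, P₂, hF.right, hF.eq, v,
    hvind, hvF, w, ⟨hw, hwF⟩, w', ⟨hw', hw'F⟩, M, hM, s, hspos, ?_⟩, hB',
    (s⁻¹ * ip M N)⁻¹, inv_pos.2 hcpos, ?_⟩
  · exact Submodule.smul_mem _ _ hB.1
  · rw [ip_smul_left, ip_smul_right, ← hss]
    field_simp
  · rw [smul_smul, mul_inv_cancel₀ hspos.ne', one_smul]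
    exact hB
  · rw [hB'N, smul_smul, inv_mul_cancel₀ hcpos.ne', one_smul]

end InnerFacets

/-! ### Connectivity of the subdivision inside a cell of the wall form -/

section Connectivity

variable {d : ℕ} {L : Set (Fin d → ℝ)} {T : Submodule ℝ (Mat d)}
  {D D' : Set (Set (Fin d → ℝ))} {N Q₀ Q Q' : Mat d} {P P' P₀ P₁ P₂ F F' : Set (Fin d → ℝ)}

/-- The cells of `D` inside `P₀`. -/
def subcells {d : ℕ} (D : Set (Set (Fin d → ℝ))) (P₀ : Set (Fin d → ℝ)) :
    Set (Set (Fin d → ℝ)) :=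
  {P ∈ cells D | P ⊆ P₀}

/-- P₀ may be unbounded, but modulo the kernel of Q₀ it has finitely many vertices. That kernel lies
in the kernel of Q, so the image of its vertices determines a subcell. -/
lemma finite_subcells (hL : IsStandardPeriodic L) (hT : ∀ Q ∈ T, Q.IsSymm)
    (hQ : Q ∈ secondaryCone L T D) (hW : IsWall L T D D' N Q₀) (hP₀ : P₀ ∈ cells (Del L Q₀)) :
    (subcells D P₀).Finite := by
  obtain ⟨k₀, π₀, hG₀⟩ := exists_good hL hW.admissible.mem
  have hQa := admissible_of_mem hT hQ
  obtain ⟨k, π, hG⟩ := exists_good hL hQa.mem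
  obtain ⟨ℓ₀, hℓ₀, -, hint₀⟩ := hW.admissible.exists_of_mem_cells hL hP₀
  have hfin := hℓ₀.1.finite_image_contact hL.periodic hG₀
  rw [← hint₀] at hfin
  refine Set.Finite.of_finite_image (f := fun P => π₀ '' (L ∩ P)) (hfin.finite_subsets.subset ?_) ?_
  · rintro _ ⟨P, hP, rfl⟩
    exact Set.image_mono (Set.inter_subset_inter_right L hP.2)
  · have key : ∀ P ∈ subcells D P₀, L ∩ P = {v ∈ L | π₀ v ∈ π₀ '' (L ∩ P)} := by
      rintro P ⟨hP, -⟩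
      rw [← Del_eq_of_mem hQ] at hP
      obtain ⟨ℓ, hℓ, -, hint⟩ := hQa.exists_of_mem_cells hL hP
      ext v
      constructor
      · exact fun hv => ⟨hv.1, v, hv, rfl⟩
      · rintro ⟨hv, v', hv', heq⟩
        have h1 : qval Q₀ (v' - v) = 0 := by
          rw [hG₀.qval_eq_zero, map_sub, heq, sub_self]
        have h2 := hW.ker_le Q hQ.2 _ h1
        rw [hG.qval_eq_zero, map_sub, sub_eq_zero] at h2
        rw [hint] at hv' ⊢
        exact hℓ.1.mem_contact_congr hL.periodic hG h2 hv' hv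
    intro P hP P' hP' heq
    have h1 := hP.1
    have h2 := hP'.1
    rw [← Del_eq_of_mem hQ] at h1 h2
    rw [eq_convexHull_inter_of_mem_cells hL hQa h1, eq_convexHull_inter_of_mem_cells hL hQa h2,
      key P hP, key P' hP']
    have heq' : π₀ '' (L ∩ P) = π₀ '' (L ∩ P') := heq
    rw [heq']

lemma isClosed_of_mem_cells (hL : IsStandardPeriodic L) (hQ : Admissible Q)
    (hP : P ∈ cells (Del L Q)) : IsClosed P := by
  obtain ⟨ℓ, hℓ, rfl, -⟩ := hQ.exists_of_mem_cells hL hP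
  exact hQ.isClosed_hull hL hℓ.1

lemma convex_of_mem_cells (hL : IsStandardPeriodic L) (hQ : Admissible Q)
    (hP : P ∈ cells (Del L Q)) : Convex ℝ P := by
  obtain ⟨ℓ, hℓ, rfl, -⟩ := hQ.exists_of_mem_cells hL hP
  exact convex_hull

/-- Subcells cover the interior of P₀, and their finite union is closed, so they cover the boundary
too. -/
lemma exists_subcell_of_mem (hL : IsStandardPeriodic L) (hT : ∀ Q ∈ T, Q.IsSymm)
    (hQ : Q ∈ secondaryCone L T D) (hW : IsWall L T D D' N Q₀) (hP₀ : P₀ ∈ cells (Del L Q₀))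
    {x : Fin d → ℝ} (hx : x ∈ P₀) : ∃ P ∈ subcells D P₀, x ∈ P := by
  have hclosed : IsClosed (⋃ P ∈ subcells D P₀, P) :=
    (finite_subcells hL hT hQ hW hP₀).isClosed_biUnion fun P hP =>
      isClosed_of_mem_cells hL (admissible_of_mem hT hQ) (by rw [Del_eq_of_mem hQ]; exact hP.1)
  have hsub : closure (interior P₀) ⊆ ⋃ P ∈ subcells D P₀, P := by
    apply closure_minimal _ hclosed
    intro y hy
    obtain ⟨P, hP, hs, hyP⟩ := exists_subcell_of_mem_interior hL hT hQ hW hP₀ hy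
    exact Set.mem_biUnion (x := P) ⟨hP, hs⟩ hyP
  obtain ⟨ℓ₀, hℓ₀, hP₀eq, -⟩ := hW.admissible.exists_of_mem_cells hL hP₀
  have : x ∈ closure (interior P₀) := by
    rw [hP₀eq] at hx ⊢
    exact hℓ₀.hull_subset_closure_interior hx
  simpa using hsub this

/-- Two cells share a facet inside `P₀`. -/
def Adjacent (D : Set (Set (Fin d → ℝ))) (P₀ P P' : Set (Fin d → ℝ)) : Prop :=
  IsInnerFacet D P₀ P P' (P ∩ P')

lemma dim_inter_lt (hL : IsStandardPeriodic L) (hQ : Admissible Q) (h₁ : P₁ ∈ cells (Del L Q))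
    (h₂ : P₂ ∈ cells (Del L Q)) (hne : P₁ ≠ P₂) (hint : (P₁ ∩ P₂).Nonempty) :
    dim (P₁ ∩ P₂) < d := by
  have hle : dim (P₁ ∩ P₂) ≤ d := by
    have := Submodule.finrank_le (vectorSpan ℝ (P₁ ∩ P₂))
    rwa [finrank_fin_fun] at this
  refine lt_of_le_of_ne hle fun h => hne ?_
  have h3 : affineSpan ℝ (P₁ ∩ P₂) = ⊤ := by
    rw [affineSpan_eq_top_iff_dim hint, h, finrank_fin_fun]
  rw [← ((convex_of_mem_cells hL hQ h₁).inter
    (convex_of_mem_cells hL hQ h₂)).interior_nonempty_iff_affineSpan_eq_top] at h3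
  obtain ⟨x, hx⟩ := h3
  exact eq_of_interior_meets_cell hL hQ h₁ h₂ (interior_mono Set.inter_subset_left hx)
    (interior_subset hx).2

/-- An open set contains a point off finitely many proper affine subspaces. -/
lemma exists_mem_notMem_affineSubspaces {U : Set (Fin d → ℝ)} (hU : IsOpen U) (hne : U.Nonempty)
    {ι : Type*} {s : Set ι} (hs : s.Finite) (A : ι → AffineSubspace ℝ (Fin d → ℝ))
    (hA : ∀ i ∈ s, A i ≠ ⊤) : ∃ x ∈ U, ∀ i ∈ s, x ∉ A i := by
  by_contra hcon
  push Not at hcon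
  have hsub : U ⊆ ⋃ i ∈ s, (A i : Set (Fin d → ℝ)) := by
    intro x hx
    obtain ⟨i, hi, hxi⟩ := hcon x hx
    exact Set.mem_biUnion hi hxi
  -- Proper affine subspaces are null sets, and nonempty open sets are not.
  have h0 : MeasureTheory.volume (⋃ i ∈ s, (A i : Set (Fin d → ℝ))) = 0 :=
    (MeasureTheory.measure_biUnion_null_iff hs.countable).2 fun i hi =>
      MeasureTheory.Measure.addHaar_affineSubspace _ _ (hA i hi)
  exact (hU.measure_pos MeasureTheory.volume hne).ne' (MeasureTheory.measure_mono_null hsub h0)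

/-- A segment between interior points of P and P' is covered by two closed sets, the reachable and
the unreachable cells. By connectedness it meets both at some y; in general position y lies on a
common facet, which makes the unreachable cell reachable. -/
lemma reflTransGen_adjacent (hL : IsStandardPeriodic L) (hT : ∀ Q ∈ T, Q.IsSymm)
    (hQ : Q ∈ secondaryCone L T D) (hW : IsWall L T D D' N Q₀) (hP₀ : P₀ ∈ cells (Del L Q₀))
    (hP : P ∈ subcells D P₀) (hP' : P' ∈ subcells D P₀) :
    Relation.ReflTransGen (Adjacent D P₀) P P' := by
  by_contra hcon
  have hQa := admissible_of_mem hT hQ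
  have hcell : ∀ P ∈ subcells D P₀, P ∈ cells (Del L Q) := fun P hP => by
    rw [Del_eq_of_mem hQ]; exact hP.1
  have hfin := finite_subcells hL hT hQ hW hP₀
  set A := {X ∈ subcells D P₀ | Relation.ReflTransGen (Adjacent D P₀) P X} with hA
  set B := {X ∈ subcells D P₀ | ¬ Relation.ReflTransGen (Adjacent D P₀) P X} with hB
  have hAc : IsClosed (⋃ X ∈ A, X) := (hfin.subset fun X hX => hX.1).isClosed_biUnion fun X hX =>
    isClosed_of_mem_cells hL hQa (hcell X hX.1)
  have hBc : IsClosed (⋃ X ∈ B, X) := (hfin.subset fun X hX => hX.1).isClosed_biUnion fun X hX =>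
    isClosed_of_mem_cells hL hQa (hcell X hX.1)
  obtain ⟨x, hx⟩ := interior_nonempty_of_mem_cells hL hQa (hcell P hP)
  -- Intersections of codimension at least two: together with x each spans a proper affine subspace,
  -- which x' must avoid.
  set bad := {p : Set (Fin d → ℝ) × Set (Fin d → ℝ) | (p.1 ∈ subcells D P₀ ∧ p.2 ∈ subcells D P₀) ∧
    dim (p.1 ∩ p.2) + 1 < d} with hbad
  have hbadfin : bad.Finite := (hfin.prod hfin).subset fun p hp => hp.1
  obtain ⟨x', hx', hgen⟩ := exists_mem_notMem_affineSubspaces isOpen_interior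
    (interior_nonempty_of_mem_cells hL hQa (hcell P' hP')) hbadfin
    (fun p => affineSpan ℝ (insert x (p.1 ∩ p.2))) (by
      rintro ⟨X, Y⟩ ⟨-, hd⟩ htop
      have h1 := AffineSubspace.vectorSpan_eq_top_of_affineSpan_eq_top ℝ _ _ htop
      have h2 := finrank_vectorSpan_insert_le_set ℝ (X ∩ Y) x
      simp only at h1 h2 hd
      rw [h1, finrank_top, finrank_fin_fun] at h2
      unfold dim at hd
      omega)
  have hconv := convex_of_mem_cells hL hW.admissible hP₀
  have hseg : segment ℝ x x' ⊆ P₀ :=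
    hconv.segment_subset (hP.2 (interior_subset hx)) (hP'.2 (interior_subset hx'))
  obtain ⟨y, hy, hyA, hyB⟩ := isPreconnected_closed_iff.1 (convex_segment x x').isPreconnected
    _ _ hAc hBc (by
      intro z hz
      obtain ⟨X, hX, hzX⟩ := exists_subcell_of_mem hL hT hQ hW hP₀ (hseg hz)
      by_cases h : Relation.ReflTransGen (Adjacent D P₀) P X
      · exact Or.inl (Set.mem_biUnion (x := X) ⟨hX, h⟩ hzX)
      · exact Or.inr (Set.mem_biUnion (x := X) ⟨hX, h⟩ hzX))
    ⟨x, left_mem_segment ℝ x x',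
      Set.mem_biUnion (x := P) ⟨hP, Relation.ReflTransGen.refl⟩ (interior_subset hx)⟩
    ⟨x', right_mem_segment ℝ x x',
      Set.mem_biUnion (x := P') ⟨hP', hcon⟩ (interior_subset hx')⟩
  simp only [Set.mem_iUnion, exists_prop] at hyA hyB
  obtain ⟨X, hX, hyX⟩ := hyA
  obtain ⟨Y, hY, hyY⟩ := hyB
  have hXY : X ≠ Y := by
    rintro rfl
    exact hY.2 hX.2
  have hlt := dim_inter_lt hL hQa (hcell X hX.1) (hcell Y hY.1) hXY ⟨y, hyX, hyY⟩
  by_cases hd : dim (X ∩ Y) + 1 = d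
  · exact hY.2 (hX.2.tail ⟨hX.1.1, hY.1.1, hXY, hX.1.2, hY.1.2, rfl, ⟨y, hyX, hyY⟩, hd⟩)
  · refine hgen (X, Y) ⟨⟨hX.1, hY.1⟩, by simp only; omega⟩ ?_
    have hyx : y ≠ x := by
      rintro rfl
      have h1 := eq_of_interior_meets_cell hL hQa (hcell P hP) (hcell X hX.1) hx hyX
      have h2 := eq_of_interior_meets_cell hL hQa (hcell P hP) (hcell Y hY.1) hx hyY
      exact hXY (h1.symm.trans h2)
    -- If X ∩ Y were too small, the line from x through y would put x' into the excluded subspace.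
    rw [segment_eq_image_lineMap] at hy
    obtain ⟨t, ht, rfl⟩ := hy
    have ht0 : t ≠ 0 := by
      rintro rfl
      exact hyx (AffineMap.lineMap_apply_zero x x')
    have hline : x' = AffineMap.lineMap x (AffineMap.lineMap x x' t) t⁻¹ := by
      simp only [AffineMap.lineMap_apply, vadd_eq_add, vsub_eq_sub, add_sub_cancel_right, smul_smul]
      rw [inv_mul_cancel₀ ht0, one_smul, sub_add_cancel]
    rw [SetLike.mem_coe.symm, hline]
    exact AffineMap.lineMap_mem _ (subset_affineSpan ℝ _ (Set.mem_insert _ _))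
      (subset_affineSpan ℝ _ (Set.mem_insert_of_mem _ ⟨hyX, hyY⟩))

/-- Since P₀ is not a cell of D, P has a companion in P₀, and the first step of a path to it crosses
a facet of P. -/
lemma exists_adjacent (hL : IsStandardPeriodic L) (hT : ∀ Q ∈ T, Q.IsSymm)
    (hQ : Q ∈ secondaryCone L T D) (hW : IsWall L T D D' N Q₀) (hP₀ : P₀ ∈ cells (Del L Q₀))
    (hP₀D : P₀ ∉ cells D) (hP : P ∈ subcells D P₀) : ∃ P', Adjacent D P₀ P P' := by
  obtain ⟨X, hX, hne⟩ : ∃ X ∈ subcells D P₀, X ≠ P := by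
    by_contra hcon
    push Not at hcon
    apply hP₀D
    have : P₀ = P := by
      apply Set.Subset.antisymm _ hP.2
      intro x hx
      obtain ⟨X, hX, hxX⟩ := exists_subcell_of_mem hL hT hQ hW hP₀ hx
      rwa [hcon X hX] at hxX
    rw [this]; exact hP.1
  rcases Relation.ReflTransGen.cases_head (reflTransGen_adjacent hL hT hQ hW hP₀ hP hX) with h | h
  · exact absurd h.symm hne
  · obtain ⟨Y, hY, -⟩ := h
    exact ⟨Y, hY⟩

/-- At most two cells contain a given facet. -/
lemma IsInnerFacet.eq_or_eq (hL : IsStandardPeriodic L) (hT : ∀ Q ∈ T, Q.IsSymm)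
    (hQ : Q ∈ secondaryCone L T D) (hF : IsInnerFacet D P₀ P₁ P₂ F) (hP : P ∈ cells D)
    (hFP : F ⊆ P) : P = P₁ ∨ P = P₂ := by
  have hQa := admissible_of_mem hT hQ
  have h₁ := hF.left
  have h₂ := hF.right
  rw [← Del_eq_of_mem hQ] at h₁ h₂ hP
  obtain ⟨ℓ₁, hℓ₁, e₁, -⟩ := hQa.exists_of_mem_cells hL h₁
  obtain ⟨ℓ₂, hℓ₂, e₂, -⟩ := hQa.exists_of_mem_cells hL h₂
  obtain ⟨ℓ, hℓ, e, -⟩ := hQa.exists_of_mem_cells hL hP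
  have hmem : ∀ x ∈ F, x ∈ P₁ ∧ x ∈ P₂ := fun x hx => by rw [hF.eq] at hx; exact hx
  have hne : ℓ₂ - ℓ₁ ≠ 0 := by
    intro h
    rw [sub_eq_zero] at h
    exact hF.ne (by rw [e₁, e₂, h])
  obtain ⟨t, ht⟩ := exists_smul_eq_of_codim_one (s := F) (g := ℓ₂ - ℓ₁) (h := ℓ - ℓ₁) hF.nonempty
    (by rw [hF.dim_add_one, finrank_fin_fun]) (by
      intro x hx
      have := hmem x hx
      rw [e₁, e₂] at this
      simp only [AffineMap.coe_sub, Pi.sub_apply]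
      rw [eqOn_hull hℓ₁.1 hℓ₂.1 this.1 this.2, sub_self]) (by
      intro x hx
      have h3 := (hmem x hx).1
      have h4 := hFP hx
      rw [e₁] at h3
      rw [e] at h4
      simp only [AffineMap.coe_sub, Pi.sub_apply]
      rw [eqOn_hull hℓ.1 hℓ₁.1 h4 h3, sub_self]) hne
  -- All three maps lie in one pencil. Unless t is 0 or 1, comparing minorants makes ℓ₁ and ℓ₂ agree
  -- on a spanning contact set: that of ℓ₁ for t < 0, of ℓ for 0 < t < 1, of ℓ₂ for t > 1.
  have htv : ∀ v, ℓ v = ℓ₁ v + t * (ℓ₂ v - ℓ₁ v) := by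
    intro v
    have := congrArg (fun g => g v) ht
    simp only [AffineMap.coe_sub, Pi.sub_apply, AffineMap.coe_smul, Pi.smul_apply,
      smul_eq_mul] at this
    linarith
  have hspan : ∀ {s : Set (Fin d → ℝ)}, affineSpan ℝ s = ⊤ → ¬ ∀ v ∈ s, ℓ₂ v - ℓ₁ v = 0 := by
    intro s hs h
    exact hne (sub_eq_zero.2 (eq_of_eqOn_spanning hs fun v hv => by linarith [h v hv]))
  rcases lt_trichotomy t 0 with h0 | rfl | h0
  · exfalso
    refine hspan hℓ₁.2 fun v hv => ?_
    have h3 := hℓ.1 v hv.1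
    have h4 := hℓ₂.1 v hv.1
    have h5 := hv.2
    rw [htv] at h3
    nlinarith
  · left
    rw [e, e₁]
    congr 1
    ext v; rw [htv]; ring
  rcases lt_trichotomy t 1 with h1 | rfl | h1
  · exfalso
    refine hspan hℓ.2 fun v hv => ?_
    have h3 := hℓ₁.1 v hv.1
    have h4 := hℓ₂.1 v hv.1
    have h5 := hv.2
    rw [htv] at h5
    have h6 : (1 - t) * (qval Q v - ℓ₁ v) + t * (qval Q v - ℓ₂ v) = 0 := by linarith
    have h7 : 0 ≤ (1 - t) * (qval Q v - ℓ₁ v) := mul_nonneg (by linarith) (by linarith)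
    have h8 : 0 ≤ t * (qval Q v - ℓ₂ v) := mul_nonneg h0.le (by linarith)
    have h9 : (1 - t) * (qval Q v - ℓ₁ v) = 0 := by linarith
    have h10 : t * (qval Q v - ℓ₂ v) = 0 := by linarith
    have h11 := (mul_eq_zero.1 h9).resolve_left (by linarith)
    have h12 := (mul_eq_zero.1 h10).resolve_left (by linarith)
    linarith
  · right
    rw [e, e₂]
    congr 1
    ext v; rw [htv]; ring
  · exfalso
    refine hspan hℓ₂.2 fun v hv => ?_
    have h3 := hℓ.1 v hv.1
    have h4 := hℓ₁.1 v hv.1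
    have h5 := hv.2
    rw [htv] at h3
    nlinarith

lemma IsInnerFacet.subset_of_subset (hL : IsStandardPeriodic L) (hT : ∀ Q ∈ T, Q.IsSymm)
    (hQ : Q ∈ secondaryCone L T D) (hF : IsInnerFacet D P₀ P₁ P₂ F) (hP : P ∈ cells D)
    (hFP : F ⊆ P) : P ⊆ P₀ := by
  rcases hF.eq_or_eq hL hT hQ hP hFP with rfl | rfl
  · exact hF.left_subset
  · exact hF.right_subset

/-- The difference of the two supporting maps is nonpositive on P₁ and vanishes exactly on F, so it
exposes F. -/
lemma IsInnerFacet.isFacet (hL : IsStandardPeriodic L) (hT : ∀ Q ∈ T, Q.IsSymm)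
    (hQ : Q ∈ secondaryCone L T D) (hF : IsInnerFacet D P₀ P₁ P₂ F) : IsFacet P₁ F := by
  have hQa := admissible_of_mem hT hQ
  have h₁ := hF.left
  have h₂ := hF.right
  rw [← Del_eq_of_mem hQ] at h₁ h₂
  refine ⟨hF.nonempty, fun _ => ?_, by rw [hF.dim_add_one, hF.left.2]⟩
  obtain ⟨ℓ₁, hℓ₁, e₁, -⟩ := hQa.exists_of_mem_cells hL h₁
  obtain ⟨ℓ₂, hℓ₂, e₂, -⟩ := hQa.exists_of_mem_cells hL h₂
  obtain ⟨x₀, hx₀⟩ := hF.nonempty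
  have hval : ∀ x y, (ℓ₂ - ℓ₁).linear x ≤ (ℓ₂ - ℓ₁).linear y ↔
      (ℓ₂ - ℓ₁) x ≤ (ℓ₂ - ℓ₁) y := by
    intro x y
    rw [affineMap_apply_eq (ℓ₂ - ℓ₁) x, affineMap_apply_eq (ℓ₂ - ℓ₁) y, add_le_add_iff_left]
  have hle : ∀ x ∈ P₁, (ℓ₂ - ℓ₁) x ≤ 0 := by
    intro x hx
    rw [e₁] at hx
    have := hℓ₂.1.le_on_hull hx
    simp only [AffineMap.coe_sub, Pi.sub_apply]
    linarith
  have hFeq : F = {x ∈ P₁ | ℓ₁ x = ℓ₂ x} := by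
    rw [hF.eq, e₁, e₂, hull_inter_eq_level' hℓ₁.1 hℓ₂.1]
  refine ⟨LinearMap.toContinuousLinearMap (ℓ₂ - ℓ₁).linear, ?_⟩
  have hFx₀ := hx₀
  rw [hFeq] at hFx₀
  rw [hFeq]
  ext x
  simp only [LinearMap.coe_toContinuousLinearMap']
  constructor
  · rintro ⟨hx, hx'⟩
    refine ⟨hx, fun y hy => ?_⟩
    rw [hval]
    refine (hle y hy).trans (le_of_eq ?_)
    simp only [AffineMap.coe_sub, Pi.sub_apply]
    rw [hx', sub_self]
  · rintro ⟨hx, hx'⟩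
    refine ⟨hx, ?_⟩
    have h3 := (hval _ _).1 (hx' x₀ hFx₀.1)
    have h4 := hle x hx
    have h5 := hFx₀.2
    simp only [AffineMap.coe_sub, Pi.sub_apply] at h3 h4
    linarith

end Connectivity

/-! ### Repartitioning polyhedra -/

section Repartitioning

variable {d : ℕ} {L : Set (Fin d → ℝ)} {T : Submodule ℝ (Mat d)}
  {D D' R : Set (Set (Fin d → ℝ))} {N Q₀ Q Q' : Mat d} {P P' P₀ P₁ P₂ F F' : Set (Fin d → ℝ)}

/-- A chain of facets in `R` from `F` to `F'` whose last cell is `X`. -/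
def ChainedTo (D R : Set (Set (Fin d → ℝ))) (F F' X : Set (Fin d → ℝ)) : Prop :=
  ∃ (n : ℕ) (f : Fin (n + 1) → Set (Fin d → ℝ)) (p : Fin (n + 2) → Set (Fin d → ℝ)),
    f 0 = F ∧ f (Fin.last n) = F' ∧ p (Fin.last (n + 1)) = X ∧ (∀ i, f i ∈ R) ∧
      (∀ i, p i ∈ cells D) ∧ ∀ i, f i = p i.castSucc ∩ p i.succ

lemma ChainedTo.chained {X : Set (Fin d → ℝ)} (h : ChainedTo D R F F' X) : Chained D R F F' := by
  obtain ⟨n, f, p, h0, h1, -, h2, h3, h4⟩ := h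
  exact ⟨n, f, p, h0, h1, h2, h3, h4⟩

lemma ChainedTo.single (hF : F ∈ R) (h₁ : P₁ ∈ cells D) (h₂ : P₂ ∈ cells D) (he : F = P₁ ∩ P₂) :
    ChainedTo D R F F P₂ := by
  refine ⟨0, fun _ => F, ![P₁, P₂], rfl, rfl, rfl, fun _ => hF, ?_, ?_⟩
  · intro i; fin_cases i
    · exact h₁
    · exact h₂
  · intro i; fin_cases i
    exact he

lemma ChainedTo.step {X Y : Set (Fin d → ℝ)} (h : ChainedTo D R F F' X) (hY : Y ∈ cells D)
    (hXY : X ∩ Y ∈ R) : ChainedTo D R F (X ∩ Y) Y := by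
  obtain ⟨n, f, p, h0, h1, hX, h2, h3, h4⟩ := h
  refine ⟨n + 1, Fin.snoc (α := fun _ => Set (Fin d → ℝ)) f (X ∩ Y),
    Fin.snoc (α := fun _ => Set (Fin d → ℝ)) p Y, ?_, by simp, by simp, ?_, ?_, ?_⟩
  · rw [← h0, ← Fin.castSucc_zero, Fin.snoc_castSucc]
  · intro i
    refine Fin.lastCases ?_ (fun j => ?_) i
    · simpa using hXY
    · simpa using h2 j
  · intro i
    refine Fin.lastCases ?_ (fun j => ?_) i
    · simpa using hY
    · simpa using h3 j
  · intro i
    refine Fin.lastCases ?_ (fun j => ?_) i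
    · rw [Fin.snoc_last, Fin.succ_last, Fin.snoc_last, Fin.snoc_castSucc, hX]
    · rw [Fin.snoc_castSucc, Fin.snoc_castSucc, Fin.succ_castSucc, Fin.snoc_castSucc, h4]

/-- All facets inside a cell of the wall form are chained to each other. -/
lemma chained_of_isInnerFacet (hL : IsStandardPeriodic L) (hT : ∀ Q ∈ T, Q.IsSymm)
    (hQ : Q ∈ secondaryCone L T D) (hW : IsWall L T D D' N Q₀) (hP₀ : P₀ ∈ cells (Del L Q₀))
    (hR : ∀ {P₁ P₂ F}, IsInnerFacet D P₀ P₁ P₂ F → F ∈ R)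
    (hF : IsInnerFacet D P₀ P₁ P₂ F) {P₁' P₂' : Set (Fin d → ℝ)}
    (hF' : IsInnerFacet D P₀ P₁' P₂' F') : Chained D R F F' := by
  have hpath := reflTransGen_adjacent hL hT hQ hW hP₀ (P := P₂) (P' := P₁')
    ⟨hF.right, hF.right_subset⟩ ⟨hF'.left, hF'.left_subset⟩
  have hchain : ∀ X, Relation.ReflTransGen (Adjacent D P₀) P₂ X → ∃ G, ChainedTo D R F G X := by
    intro X hX
    induction hX with
    | refl => exact ⟨F, ChainedTo.single (hR hF) hF.left hF.right hF.eq⟩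
    | tail _ hadj ih =>
      obtain ⟨G, hG⟩ := ih
      exact ⟨_, hG.step hadj.right (hR hadj)⟩
  obtain ⟨G, hG⟩ := hchain _ hpath
  have := (hG.step hF'.right (by rw [← hF'.eq]; exact hR hF')).chained
  rwa [← hF'.eq] at this

/-- Each facet of the chain is inner to some cell of Q₀, which contains every cell of D through that
facet. Consecutive facets share a cell of D, so this cell of Q₀ is always the same. -/
lemma isInnerFacet_of_chained (hL : IsStandardPeriodic L) (hT : ∀ Q ∈ T, Q.IsSymm)
    (hQ : Q ∈ secondaryCone L T D) (hQ₀ : Admissible Q₀) (hP₀ : P₀ ∈ cells (Del L Q₀))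
    (hR : ∀ F ∈ R, ∃ P₀ ∈ cells (Del L Q₀), ∃ P₁ P₂, IsInnerFacet D P₀ P₁ P₂ F)
    (hF : IsInnerFacet D P₀ P₁ P₂ F) (hch : Chained D R F F') :
    ∃ P₁ P₂, IsInnerFacet D P₀ P₁ P₂ F' := by
  obtain ⟨n, f, p, h0, h1, h2, h3, h4⟩ := hch
  have hunique : ∀ X ∈ cells D, X ⊆ P₀ → ∀ P₀' ∈ cells (Del L Q₀), X ⊆ P₀' → P₀' = P₀ :=
    fun X hX hs P₀' hP₀' hs' => eq_of_cell_subset hL hT hQ hQ₀ hX hP₀' hP₀ hs' hs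
  have hcast : ∀ i, f i ⊆ p i.castSucc := fun i => by rw [h4]; exact Set.inter_subset_left
  have hsucc : ∀ i, f i ⊆ p i.succ := fun i => by rw [h4]; exact Set.inter_subset_right
  have hsub : ∀ i, p i ⊆ P₀ := by
    intro i
    induction i using Fin.induction with
    | zero =>
      exact hF.subset_of_subset hL hT hQ (h3 0) (by rw [← h0]; exact hcast 0)
    | succ i ih =>
      obtain ⟨P₀', hP₀', X, Y, hXY⟩ := hR _ (h2 i)
      have h5 := hXY.subset_of_subset hL hT hQ (h3 _) (hcast i)
      rw [← hunique _ (h3 _) ih P₀' hP₀' h5]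
      exact hXY.subset_of_subset hL hT hQ (h3 _) (hsucc i)
  obtain ⟨P₀', hP₀', X, Y, hXY⟩ := hR _ (h2 (Fin.last n))
  have h5 := hXY.subset_of_subset hL hT hQ (h3 _) (hcast _)
  rw [hunique _ (h3 _) (hsub _) P₀' hP₀' h5, h1] at hXY
  exact ⟨X, Y, hXY⟩

lemma IsInnerFacet.not_mem_cells (hL : IsStandardPeriodic L) (hT : ∀ Q ∈ T, Q.IsSymm)
    (hQ : Q ∈ secondaryCone L T D) (hF : IsInnerFacet D P₀ P₁ P₂ F) : P₀ ∉ cells D := by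
  intro hP₀
  have hQa := admissible_of_mem hT hQ
  have hsub : ∀ X ∈ cells D, X ⊆ P₀ → X = P₀ := by
    intro X hX hs
    rw [← Del_eq_of_mem hQ] at hX hP₀
    obtain ⟨x, hx⟩ := interior_nonempty_of_mem_cells hL hQa hX
    exact eq_of_interior_meets_cell hL hQa hX hP₀ hx (hs (interior_subset hx))
  exact hF.ne ((hsub _ hF.left hF.left_subset).trans (hsub _ hF.right hF.right_subset).symm)

/-- The vertices of a class of facets inside `P₀` are the vertices of `P₀`. -/
lemma convexHull_classVertices (hL : IsStandardPeriodic L) (hT : ∀ Q ∈ T, Q.IsSymm)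
    (hQ : Q ∈ secondaryCone L T D) (hW : IsWall L T D D' N Q₀) (hP₀ : P₀ ∈ cells (Del L Q₀))
    {C : Set (Set (Fin d → ℝ))} (hC : ∀ F, F ∈ C ↔ ∃ P₁ P₂, IsInnerFacet D P₀ P₁ P₂ F)
    (hne : C.Nonempty) : convexHull ℝ (classVertices L D C) = P₀ := by
  have heq : classVertices L D C = L ∩ P₀ := by
    ext v
    constructor
    · rintro ⟨hv, P, hP, hvP, F, hF, hfac⟩
      obtain ⟨P₁, P₂, hin⟩ := (hC F).1 hF
      have hFP : F ⊆ P := by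
        obtain ⟨l, hl⟩ := hfac.2.1 hfac.1
        rw [hl]; exact fun x hx => hx.1
      exact ⟨hv, hin.subset_of_subset hL hT hQ hP hFP hvP⟩
    · rintro ⟨hv, hvP₀⟩
      obtain ⟨P, hP, hvP⟩ := exists_subcell_of_mem hL hT hQ hW hP₀ hvP₀
      obtain ⟨F, hF⟩ := hne
      obtain ⟨P₁, P₂, hin⟩ := (hC F).1 hF
      -- The facet F shows that P₀ is properly subdivided, so the subcell containing v has an inner
      -- facet of its own.
      obtain ⟨P', hadj⟩ := exists_adjacent hL hT hQ hW hP₀ (hin.not_mem_cells hL hT hQ) hP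
      exact ⟨hv, P, hP.1, hvP, P ∩ P', (hC _).2 ⟨_, _, hadj⟩, IsInnerFacet.isFacet hL hT hQ hadj⟩
  rw [heq, ← eq_convexHull_inter_of_mem_cells hL hW.admissible hP₀]

/-- The repartitioning polyhedra are the cells of the wall form that are not cells of `D`. -/
lemma repartitioningPolyhedra_eq (hL : IsStandardPeriodic L) (hT : ∀ Q ∈ T, Q.IsSymm)
    (hD : IsGeneric L T D) (hQ : Q ∈ secondaryCone L T D) (hW : IsWall L T D D' N Q₀)
    {𝓕 : Set (Mat d)} (hN : IsWallNormal L T D D' 𝓕 N)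
    (hn : ∀ N', IsWallNormal L T D D' 𝓕 N' → ip N' Q₀ = 0) :
    repartitioningPolyhedra L T D D' 𝓕 = {P₀ ∈ cells (Del L Q₀) | P₀ ∉ cells D} := by
  have hR : ∀ F ∈ wallFacets L T D D' 𝓕,
      ∃ P₀ ∈ cells (Del L Q₀), ∃ P₁ P₂, IsInnerFacet D P₀ P₁ P₂ F := fun F hF =>
    exists_isInnerFacet_of_mem_wallFacets hL hT hD hQ hW hn hF
  have hmem : ∀ {P₀}, P₀ ∈ cells (Del L Q₀) → ∀ {P₁ P₂ F}, IsInnerFacet D P₀ P₁ P₂ F →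
      F ∈ wallFacets L T D D' 𝓕 := fun hP₀ _ _ _ hF =>
    mem_wallFacets_of_isInnerFacet hL hT hD hW hN hP₀ hF
  have hull : ∀ {P₀}, P₀ ∈ cells (Del L Q₀) → ∀ {P₁ P₂ F}, IsInnerFacet D P₀ P₁ P₂ F →
      convexHull ℝ (classVertices L D {F' ∈ wallFacets L T D D' 𝓕 |
        Chained D (wallFacets L T D D' 𝓕) F F'}) = P₀ := by
    intro P₀ hP₀ P₁ P₂ F hF
    apply convexHull_classVertices hL hT hQ hW hP₀
    · intro F'
      constructor
      · rintro ⟨-, hch⟩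
        exact isInnerFacet_of_chained hL hT hQ hW.admissible hP₀ hR hF hch
      · rintro ⟨P₁', P₂', hF'⟩
        exact ⟨hmem hP₀ hF', chained_of_isInnerFacet hL hT hQ hW hP₀ (hmem hP₀) hF hF'⟩
    · exact ⟨F, hmem hP₀ hF, chained_of_isInnerFacet hL hT hQ hW hP₀ (hmem hP₀) hF hF⟩
  ext P₀
  constructor
  · rintro ⟨F, hF, rfl⟩
    obtain ⟨X, hX, P₁, P₂, hin⟩ := hR F hF
    rw [hull hX hin]
    exact ⟨hX, hin.not_mem_cells hL hT hQ⟩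
  · rintro ⟨hP₀, hP₀D⟩
    obtain ⟨P, hP, hs⟩ := exists_subcell hL hT hQ hW hP₀
    obtain ⟨P', hadj⟩ := exists_adjacent hL hT hQ hW hP₀ hP₀D ⟨hP, hs⟩
    exact ⟨P ∩ P', hmem hP₀ hadj, (hull hP₀ hadj).symm⟩

end Repartitioning

/-! ### Lower and upper facets of lifted polyhedra -/

section Lifting

variable {d : ℕ} {V : Set (Fin d → ℝ)} {f g : (Fin d → ℝ) → ℝ} {ℓ : (Fin d → ℝ) →ᵃ[ℝ] ℝ}

/-- The convex hull of the graph of `f` over `V`. -/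
def graphHull (V : Set (Fin d → ℝ)) (f : (Fin d → ℝ) → ℝ) : Set ((Fin d → ℝ) × ℝ) :=
  convexHull ℝ ((fun v => (v, f v)) '' V)

/-- The graph of an affine map. -/
def graphMap (ℓ : (Fin d → ℝ) →ᵃ[ℝ] ℝ) : (Fin d → ℝ) →ᵃ[ℝ] (Fin d → ℝ) × ℝ :=
  (AffineMap.id ℝ (Fin d → ℝ)).prod ℓ

lemma graphMap_apply (x : Fin d → ℝ) : graphMap ℓ x = (x, ℓ x) := rfl

lemma fst_image_graphMap (A : Set (Fin d → ℝ)) : Prod.fst '' (graphMap ℓ '' A) = A := by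
  rw [Set.image_image]
  simp [graphMap_apply]

lemma dim_image_graphMap (A : Set (Fin d → ℝ)) : dim (graphMap ℓ '' A) = dim A := by
  unfold dim
  rw [← AffineMap.map_vectorSpan]
  have hinj : Function.Injective (graphMap ℓ).linear := by
    intro x y h
    exact congrArg Prod.fst h
  exact (LinearEquiv.finrank_eq (Submodule.equivMapOfInjective _ hinj _)).symm

/-- The functional with coefficient vector `n` on `ℝᵈ × ℝ`. -/
def pairing (n : (Fin d → ℝ) × ℝ) : (Fin d → ℝ) × ℝ →ₗ[ℝ] ℝ :=
  (dotProductBilin ℝ ℝ n.1).coprod (n.2 • LinearMap.id)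

lemma pairing_apply (n x : (Fin d → ℝ) × ℝ) : pairing n x = n.1 ⬝ᵥ x.1 + n.2 * x.2 := by
  simp [pairing]

/-- A hyperplane through the graph would be either vertical, against the spanning of V, or the graph
of an affine map, against `hf`. -/
lemma dim_graphHull (hV : affineSpan ℝ V = ⊤) (hf : ¬ ∃ ℓ : (Fin d → ℝ) →ᵃ[ℝ] ℝ, ∀ v ∈ V, f v = ℓ v) :
    dim (graphHull V f) = d + 1 := by
  have htop : vectorSpan ℝ ((fun v => (v, f v)) '' V) = ⊤ := by
    by_contra hne
    obtain ⟨φ, hφ0, hφ⟩ := Submodule.exists_le_ker_of_lt_top _ (lt_top_iff_ne_top.2 hne)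
    obtain ⟨v₀, hv₀⟩ : V.Nonempty := by
      by_contra hcon
      rw [Set.not_nonempty_iff_eq_empty] at hcon
      exact hf ⟨0, by rw [hcon]; simp⟩
    have hsplit : ∀ x y, φ (x, y) = φ (x, 0) + y * φ (0, 1) := by
      intro x y
      rw [← smul_eq_mul, ← map_smul, ← map_add]
      simp
    have hconst : ∀ v ∈ V, φ (v, f v) = φ (v₀, f v₀) := by
      intro v hv
      have := hφ (vsub_mem_vectorSpan ℝ (Set.mem_image_of_mem (fun v => (v, f v)) hv)
        (Set.mem_image_of_mem (fun v => (v, f v)) hv₀))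
      rw [LinearMap.mem_ker, vsub_eq_sub, map_sub, sub_eq_zero] at this
      exact this
    by_cases hs : φ (0, 1) = 0
    · set h : (Fin d → ℝ) →ᵃ[ℝ] ℝ := (φ ∘ₗ LinearMap.inl ℝ _ _).toAffineMap with hh
      have hval : ∀ x, h x = φ (x, 0) := fun x => by simp [hh]
      have e : h = AffineMap.const ℝ _ (φ (v₀, f v₀)) := eq_of_eqOn_spanning hV fun v hv => by
        rw [hval, AffineMap.const_apply, ← hconst v hv, hsplit v (f v), hs, mul_zero, add_zero]
      have e' : ∀ x, φ (x, 0) = φ (v₀, f v₀) := fun x => by rw [← hval, e]; rfl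
      apply hφ0
      ext x
      · simp only [LinearMap.comp_apply, LinearMap.inl_apply, LinearMap.zero_apply]
        have h0 : φ ((0 : Fin d → ℝ), (0 : ℝ)) = 0 := map_zero φ
        exact (e' _).trans ((e' 0).symm.trans h0)
      · simpa using hs
    · apply hf
      refine ⟨(φ (0, 1))⁻¹ • (AffineMap.const ℝ _ (φ (v₀, f v₀)) -
        (φ ∘ₗ LinearMap.inl ℝ _ _).toAffineMap), fun v hv => ?_⟩
      have := hconst v hv
      rw [hsplit v] at this
      simp only [AffineMap.coe_smul, AffineMap.coe_sub, Pi.smul_apply, Pi.sub_apply,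
        AffineMap.const_apply, LinearMap.coe_toAffineMap, LinearMap.comp_apply,
        LinearMap.inl_apply, smul_eq_mul]
      rw [← this]
      field_simp
      ring
  rw [graphHull, dim_convexHull, dim, htop, finrank_top]
  simp

/-- The level hyperplane of a non-vertical normal is the graph of ℓ, so the face over it is the
lifted hull of the contact points. -/
lemma level_eq {n : (Fin d → ℝ) × ℝ} {m : ℝ} (hn : n.2 ≠ 0)
    (hℓ : ∀ x, n.1 ⬝ᵥ x + n.2 * ℓ x = m) (hle : ∀ v ∈ V, pairing n (v, f v) ≤ m) :
    {x ∈ graphHull V f | pairing n x = m} = graphMap ℓ '' convexHull ℝ {v ∈ V | f v = ℓ v} := by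
  have h1 := convexHull_inter_level ((fun v => (v, f v)) '' V) (pairing n).toAffineMap m (by
    rintro _ ⟨v, hv, rfl⟩
    exact hle v hv)
  have h2 : {s ∈ (fun v => (v, f v)) '' V | (pairing n).toAffineMap s = m} =
      graphMap ℓ '' {v ∈ V | f v = ℓ v} := by
    ext s
    constructor
    · rintro ⟨⟨v, hv, rfl⟩, hs⟩
      have h3 : n.1 ⬝ᵥ v + n.2 * f v = m := by rw [← hs]; exact (pairing_apply n (v, f v)).symm
      have h4 : f v = ℓ v := mul_left_cancel₀ hn (by linarith [hℓ v])
      exact ⟨v, ⟨hv, h4⟩, by simp only [graphMap_apply, h4]⟩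
    · rintro ⟨v, ⟨hv, he⟩, rfl⟩
      refine ⟨⟨v, hv, by simp only [graphMap_apply, he]⟩, ?_⟩
      rw [LinearMap.coe_toAffineMap, pairing_apply]
      exact hℓ v
  rw [AffineMap.image_convexHull, ← h2, ← h1]
  rfl

lemma pairing_le_on_graphHull {n : (Fin d → ℝ) × ℝ} {m : ℝ}
    (hle : ∀ v ∈ V, pairing n (v, f v) ≤ m) {x : (Fin d → ℝ) × ℝ} (hx : x ∈ graphHull V f) :
    pairing n x ≤ m := by
  have : graphHull V f ⊆ {x | pairing n x ≤ m} := by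
    apply convexHull_min
    · rintro _ ⟨v, hv, rfl⟩
      exact hle v hv
    · exact convex_halfSpace_le (pairing n).isLinear m
  exact this hx

/-- Non-vertical supporting hyperplanes are graphs of affine maps above or below f. The sign s
treats both cases at once: 1 for upper facets, -1 for lower ones. -/
lemma isFacet_graphHull_iff (hdim : dim (graphHull V f) = d + 1) {s : ℝ} (hs : s ≠ 0)
    {F : Set ((Fin d → ℝ) × ℝ)} :
    (IsFacet (graphHull V f) F ∧ ∃ n, IsOuterNormal (graphHull V f) F n ∧ 0 < s * n.2) ↔
      ∃ ℓ : (Fin d → ℝ) →ᵃ[ℝ] ℝ, (∀ v ∈ V, 0 ≤ s * (ℓ v - f v)) ∧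
        affineSpan ℝ {v ∈ V | f v = ℓ v} = ⊤ ∧
        F = graphMap ℓ '' convexHull ℝ {v ∈ V | f v = ℓ v} := by
  constructor
  · rintro ⟨⟨⟨p, hp⟩, -, hd⟩, n, ⟨-, hF⟩, hsn⟩
    have hn : n.2 ≠ 0 := by
      intro h; rw [h, mul_zero] at hsn; exact lt_irrefl _ hsn
    set m := pairing n p with hm
    have hp' := hp
    rw [hF] at hp'
    have hmax : ∀ y ∈ graphHull V f, pairing n y ≤ m := by
      intro y hy
      rw [hm, pairing_apply, pairing_apply]
      exact hp'.2 y hy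
    have hle : ∀ v ∈ V, pairing n (v, f v) ≤ m := fun v hv =>
      hmax _ (subset_convexHull ℝ _ ⟨v, hv, rfl⟩)
    set ℓ := affMap (-(n.2⁻¹ • n.1)) (n.2⁻¹ * m) with hℓdef
    have hℓ : ∀ x, n.1 ⬝ᵥ x + n.2 * ℓ x = m := by
      intro x
      rw [hℓdef, affMap_apply, neg_dotProduct, smul_dotProduct, smul_eq_mul]
      field_simp
      ring
    have hFeq : F = graphMap ℓ '' convexHull ℝ {v ∈ V | f v = ℓ v} := by
      rw [← level_eq hn hℓ hle, hF]
      ext x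
      constructor
      · rintro ⟨hx, h⟩
        refine ⟨hx, le_antisymm (hmax x hx) ?_⟩
        rw [hm, pairing_apply, pairing_apply]
        exact h p hp'.1
      · rintro ⟨hx, h⟩
        refine ⟨hx, fun y hy => ?_⟩
        have h' : pairing n x = m := h
        rw [← pairing_apply, ← pairing_apply, h']
        exact hmax y hy
    refine ⟨ℓ, ?_, ?_, hFeq⟩
    · intro v hv
      have h1 := hle v hv
      rw [pairing_apply] at h1
      have h2 := hℓ v
      simp only at h1
      have h3 : 0 ≤ (s * n.2) * (n.2 * (ℓ v - f v)) := mul_nonneg hsn.le (by linarith)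
      have h4 : (s * n.2) * (n.2 * (ℓ v - f v)) = n.2 ^ 2 * (s * (ℓ v - f v)) := by ring
      rw [h4] at h3
      exact nonneg_of_mul_nonneg_right h3 (by positivity)
    · have hne : {v ∈ V | f v = ℓ v}.Nonempty := by
        rw [hFeq] at hp
        obtain ⟨x, hx, -⟩ := hp
        exact convexHull_nonempty_iff.1 ⟨x, hx⟩
      rw [affineSpan_eq_top_iff_dim hne, finrank_fin_fun]
      rw [hdim, hFeq, dim_image_graphMap, dim_convexHull] at hd
      omega
  · rintro ⟨ℓ, hle, hsp, rfl⟩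
    obtain ⟨a, b, hab⟩ := exists_eq_affMap ℓ
    -- Normal to the graph of ℓ, with the sign of its last coordinate given by s.
    set n : (Fin d → ℝ) × ℝ := (-(s • a), s) with hn
    have hℓ : ∀ x, n.1 ⬝ᵥ x + n.2 * ℓ x = s * b := by
      intro x
      rw [hab, affMap_apply, hn]
      simp only [neg_dotProduct, smul_dotProduct, smul_eq_mul]
      ring
    have hle' : ∀ v ∈ V, pairing n (v, f v) ≤ s * b := by
      intro v hv
      have h1 := hle v hv
      rw [pairing_apply, ← hℓ v]
      show n.1 ⬝ᵥ v + s * f v ≤ n.1 ⬝ᵥ v + s * ℓ v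
      linarith
    have hlev := level_eq hs hℓ hle'
    have hne : (convexHull ℝ {v ∈ V | f v = ℓ v}).Nonempty := by
      obtain ⟨x, hx⟩ := interior_convexHull_nonempty_iff_affineSpan_eq_top.2 hsp
      exact ⟨x, interior_subset hx⟩
    obtain ⟨p, hp⟩ := hne.image (graphMap ℓ)
    have hmaxset : graphMap ℓ '' convexHull ℝ {v ∈ V | f v = ℓ v} =
        {x ∈ graphHull V f | ∀ y ∈ graphHull V f, pairing n y ≤ pairing n x} := by
      rw [← hlev] at hp ⊢
      have hp2 : pairing n p = s * b := hp.2
      ext x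
      constructor
      · rintro ⟨hx, h⟩
        have h' : pairing n x = s * b := h
        exact ⟨hx, fun y hy => by rw [h']; exact pairing_le_on_graphHull hle' hy⟩
      · rintro ⟨hx, h⟩
        refine ⟨hx, le_antisymm (pairing_le_on_graphHull hle' hx) ?_⟩
        rw [← hp2]
        exact h p hp.1
    refine ⟨⟨⟨p, hp⟩, fun _ => ⟨LinearMap.toContinuousLinearMap (pairing n), hmaxset⟩, ?_⟩, n,
      ⟨?_, ?_⟩, mul_self_pos.2 hs⟩
    · have hne' := convexHull_nonempty_iff.1 hne
      rw [dim_image_graphMap, dim_convexHull, hdim,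
        (affineSpan_eq_top_iff_dim hne').1 hsp, finrank_fin_fun]
    · intro h
      exact hs (congrArg Prod.snd h)
    · rw [hmaxset]
      simp only [pairing_apply]

/-- The polyhedra cut out by the cell maps of `f` on `V`. -/
def cellsOf (V : Set (Fin d → ℝ)) (f : (Fin d → ℝ) → ℝ) : Set (Set (Fin d → ℝ)) :=
  {X | ∃ ℓ, CellMap V f ℓ ∧ X = hull V f ℓ}

lemma lowerCells_eq {L P : Set (Fin d → ℝ)} {Q : Mat d}
    (hdim : dim (graphHull (L ∩ P) (qval Q)) = d + 1) :
    lowerCells L Q P = cellsOf (L ∩ P) (qval Q) := by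
  have key : ∀ F, IsLowerFacet (lifted L P Q) F ↔ ∃ ℓ, CellMap (L ∩ P) (qval Q) ℓ ∧
      F = graphMap ℓ '' hull (L ∩ P) (qval Q) ℓ := by
    intro F
    have h1 := isFacet_graphHull_iff hdim (s := -1) (by norm_num) (F := F)
    constructor
    · rintro ⟨hF, n, hn, hneg⟩
      obtain ⟨ℓ, h2, h3, h4⟩ := h1.1 ⟨hF, n, hn, by linarith⟩
      exact ⟨ℓ, ⟨fun v hv => by linarith [h2 v hv], h3⟩, h4⟩
    · rintro ⟨ℓ, ⟨h2, h3⟩, h4⟩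
      obtain ⟨hF, n, hn, hneg⟩ := h1.2 ⟨ℓ, fun v hv => by linarith [h2 v hv], h3, h4⟩
      exact ⟨hF, n, hn, by linarith⟩
  ext X
  constructor
  · rintro ⟨F, hF, rfl⟩
    obtain ⟨ℓ, h, rfl⟩ := (key F).1 hF
    exact ⟨ℓ, h, fst_image_graphMap _⟩
  · rintro ⟨ℓ, h, rfl⟩
    exact ⟨_, (key _).2 ⟨ℓ, h, rfl⟩, (fst_image_graphMap _).symm⟩

/-- Reflecting the last coordinate turns the upper hull of Q into the lower hull of -Q. -/
lemma upperCells_eq {L P : Set (Fin d → ℝ)} {Q : Mat d}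
    (hdim : dim (graphHull (L ∩ P) (qval Q)) = d + 1) :
    upperCells L Q P = cellsOf (L ∩ P) (fun v => -qval Q v) := by
  have hcon : ∀ ℓ, contact (L ∩ P) (fun v => -qval Q v) (-ℓ) = {v ∈ L ∩ P | qval Q v = ℓ v} := by
    intro ℓ; ext v; simp [contact]
  have key : ∀ F, IsUpperFacet (lifted L P Q) F ↔
      ∃ ℓ, CellMap (L ∩ P) (fun v => -qval Q v) (-ℓ) ∧
        F = graphMap ℓ '' hull (L ∩ P) (fun v => -qval Q v) (-ℓ) := by
    intro F
    have h1 := isFacet_graphHull_iff hdim (s := 1) (by norm_num) (F := F)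
    constructor
    · rintro ⟨hF, n, hn, hneg⟩
      obtain ⟨ℓ, h2, h3, h4⟩ := h1.1 ⟨hF, n, hn, by linarith⟩
      refine ⟨ℓ, ⟨fun v hv => ?_, by rw [hcon]; exact h3⟩, by rw [hull, hcon]; exact h4⟩
      have := h2 v hv
      simp only [AffineMap.coe_neg, Pi.neg_apply]
      linarith
    · rintro ⟨ℓ, ⟨h2, h3⟩, h4⟩
      rw [hcon] at h3
      rw [hull, hcon] at h4
      obtain ⟨hF, n, hn, hneg⟩ := h1.2 ⟨ℓ, fun v hv => by
        have := h2 v hv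
        simp only [AffineMap.coe_neg, Pi.neg_apply] at this
        linarith, h3, h4⟩
      exact ⟨hF, n, hn, by linarith⟩
  ext X
  constructor
  · rintro ⟨F, hF, rfl⟩
    obtain ⟨ℓ, h, rfl⟩ := (key F).1 hF
    exact ⟨-ℓ, h, fst_image_graphMap _⟩
  · rintro ⟨ℓ, h, rfl⟩
    refine ⟨graphMap (-ℓ) '' hull (L ∩ P) (fun v => -qval Q v) ℓ, (key _).2 ⟨-ℓ, ?_, ?_⟩,
      (fst_image_graphMap _).symm⟩
    · rwa [neg_neg]
    · rw [neg_neg]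

lemma cellsOf_subset_of_affine {c : ℝ} (hc : 0 < c) {A : (Fin d → ℝ) →ᵃ[ℝ] ℝ}
    (h : ∀ v ∈ V, g v = c * f v + A v) : cellsOf V f ⊆ cellsOf V g := by
  rintro _ ⟨ℓ, ⟨hℓ, hsp⟩, rfl⟩
  have hval : ∀ v, (c • ℓ + A) v = c * ℓ v + A v := fun v => by simp
  have hcon : contact V g (c • ℓ + A) = contact V f ℓ := by
    ext v
    simp only [contact, Set.mem_ofPred_eq, hval]
    refine and_congr_right fun hv => ?_
    rw [h v hv, add_left_inj]
    exact ⟨fun e => mul_left_cancel₀ hc.ne' e, fun e => by rw [e]⟩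
  refine ⟨c • ℓ + A, ⟨fun v hv => ?_, by rw [hcon]; exact hsp⟩, by rw [hull, hull, hcon]⟩
  rw [hval, h v hv]
  have := mul_le_mul_of_nonneg_left (hℓ v hv) hc.le
  linarith

lemma cellsOf_eq_of_affine {c : ℝ} (hc : 0 < c) {A : (Fin d → ℝ) →ᵃ[ℝ] ℝ}
    (h : ∀ v ∈ V, g v = c * f v + A v) : cellsOf V f = cellsOf V g := by
  refine (cellsOf_subset_of_affine hc h).antisymm
    (cellsOf_subset_of_affine (c := c⁻¹) (A := -(c⁻¹ • A)) (inv_pos.2 hc) fun v hv => ?_)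
  simp only [AffineMap.coe_neg, AffineMap.coe_smul, Pi.neg_apply, Pi.smul_apply, smul_eq_mul]
  rw [h v hv]
  field_simp
  ring

end Lifting

/-! ### The flip -/

section Flip

variable {d : ℕ} {L : Set (Fin d → ℝ)} {T : Submodule ℝ (Mat d)}
  {D D' : Set (Set (Fin d → ℝ))} {N Q₀ Q Q' : Mat d} {P P₀ : Set (Fin d → ℝ)}

/-- Cell maps of D inside P₀ remain cell maps when only the vertices of P₀ are kept. No others
arise, because these subcells already cover P₀. -/
lemma cellsOf_inter_eq_subcells (hL : IsStandardPeriodic L) (hT : ∀ Q ∈ T, Q.IsSymm)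
    (hQ : Q ∈ secondaryCone L T D) (hW : IsWall L T D D' N Q₀) (hP₀ : P₀ ∈ cells (Del L Q₀)) :
    cellsOf (L ∩ P₀) (qval Q) = subcells D P₀ := by
  have hQa := admissible_of_mem hT hQ
  have hsub : ∀ P ∈ subcells D P₀, ∃ ℓ, CellMap (L ∩ P₀) (qval Q) ℓ ∧
      P = hull (L ∩ P₀) (qval Q) ℓ := by
    rintro P ⟨hP, hs⟩
    rw [← Del_eq_of_mem hQ] at hP
    obtain ⟨ℓ, hℓ, e, hint⟩ := hQa.exists_of_mem_cells hL hP
    have hcon : contact (L ∩ P₀) (qval Q) ℓ = contact L (qval Q) ℓ := by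
      apply Set.Subset.antisymm
      · exact fun v hv => ⟨hv.1.1, hv.2⟩
      · intro v hv
        have h1 : v ∈ L ∩ P := by rw [hint]; exact hv
        exact ⟨⟨hv.1, hs h1.2⟩, hv.2⟩
    exact ⟨ℓ, ⟨fun v hv => hℓ.1 v hv.1, by rw [hcon]; exact hℓ.2⟩, by rw [hull, hcon]; exact e⟩
  apply Set.Subset.antisymm
  · rintro _ ⟨ℓ, hℓ, rfl⟩
    obtain ⟨x, hx⟩ := hℓ.interior_nonempty
    have hxP₀ : x ∈ P₀ := by
      rw [eq_convexHull_inter_of_mem_cells hL hW.admissible hP₀]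
      exact convexHull_mono contact_subset (interior_subset hx)
    obtain ⟨P, hP, hxP⟩ := exists_subcell_of_mem hL hT hQ hW hP₀ hxP₀
    obtain ⟨ℓ₁, hℓ₁, rfl⟩ := hsub P hP
    rw [eq_of_interior_meets hℓ.1 hℓ₁.1 hx hxP]
    exact hP
  · intro P hP
    exact hsub P hP

/-- N has opposite signs on Q and Q', so a positive c makes Q' + c Q orthogonal to N, hence affine
on the vertices of P₀. This turns the hull of Q upside down. -/
lemma IsWall.exists_reversal (hL : IsStandardPeriodic L) (hT : ∀ Q ∈ T, Q.IsSymm)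
    (hQ : Q ∈ secondaryCone L T D) (hQ' : Q' ∈ secondaryCone L T D')
    (hW : IsWall L T D D' N Q₀) (hP₀ : P₀ ∈ cells (Del L Q₀)) :
    ∃ (c : ℝ) (A : (Fin d → ℝ) →ᵃ[ℝ] ℝ), 0 < c ∧
      ∀ v ∈ L ∩ P₀, qval Q' v = c * -qval Q v + A v := by
  have h1 := hW.pos Q hQ
  have h2 := hW.neg Q' hQ'
  set c := -ip N Q' / ip N Q with hc
  obtain ⟨A, hA⟩ := hW.exists_affine hL hT hQ hP₀ (C := Q' + c • Q)
    (T.add_mem hQ'.2 (T.smul_mem c hQ.2)) (by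
      rw [ip_add_right, ip_smul_right, hc, div_mul_cancel₀ _ h1.ne']; ring)
  refine ⟨c, A, div_pos (by linarith) h1, fun v hv => ?_⟩
  have := hA v hv
  rw [qval_add_form, qval_smul_form] at this
  linarith

lemma dim_graphHull_of_not_mem_cells (hL : IsStandardPeriodic L) (hT : ∀ Q ∈ T, Q.IsSymm)
    (hQ : Q ∈ secondaryCone L T D) (hW : IsWall L T D D' N Q₀) (hP₀ : P₀ ∈ cells (Del L Q₀))
    (hP₀D : P₀ ∉ cells D) : dim (graphHull (L ∩ P₀) (qval Q)) = d + 1 :=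
  dim_graphHull (affineSpan_inter_of_mem_cells hL hW.admissible hP₀) fun ⟨_, hℓ⟩ =>
    hP₀D (mem_cells_of_affine hL hT hQ hW hP₀ hℓ)

lemma lowerCells_eq_subcells (hL : IsStandardPeriodic L) (hT : ∀ Q ∈ T, Q.IsSymm)
    (hQ : Q ∈ secondaryCone L T D) (hW : IsWall L T D D' N Q₀) (hP₀ : P₀ ∈ cells (Del L Q₀))
    (hP₀D : P₀ ∉ cells D) : lowerCells L Q P₀ = subcells D P₀ := by
  rw [lowerCells_eq (dim_graphHull_of_not_mem_cells hL hT hQ hW hP₀ hP₀D),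
    cellsOf_inter_eq_subcells hL hT hQ hW hP₀]

lemma upperCells_eq_subcells (hL : IsStandardPeriodic L) (hT : ∀ Q ∈ T, Q.IsSymm)
    (hQ : Q ∈ secondaryCone L T D) (hQ' : Q' ∈ secondaryCone L T D')
    (hW : IsWall L T D D' N Q₀) (hP₀ : P₀ ∈ cells (Del L Q₀))
    (hP₀D : P₀ ∉ cells D) : upperCells L Q P₀ = subcells D' P₀ := by
  obtain ⟨c, A, hc, h⟩ := hW.exists_reversal hL hT hQ hQ' hP₀
  rw [upperCells_eq (dim_graphHull_of_not_mem_cells hL hT hQ hW hP₀ hP₀D),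
    cellsOf_eq_of_affine hc h, cellsOf_inter_eq_subcells hL hT hQ' hW.symm hP₀]

/-- The two subdivisions of a repartitioning polyhedron have no common cell. -/
lemma disjoint_subcells (hL : IsStandardPeriodic L) (hT : ∀ Q ∈ T, Q.IsSymm)
    (hQ : Q ∈ secondaryCone L T D) (hQ' : Q' ∈ secondaryCone L T D')
    (hW : IsWall L T D D' N Q₀) (hP₀ : P₀ ∈ cells (Del L Q₀))
    (hP₀D : P₀ ∉ cells D) : Disjoint (subcells D' P₀) (cells D) := by
  rw [Set.disjoint_left]
  rintro X ⟨hX', hs⟩ hX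
  obtain ⟨c, A, hc, h⟩ := hW.exists_reversal hL hT hQ hQ' hP₀
  have hQa := admissible_of_mem hT hQ
  have hQa' := admissible_of_mem hT hQ'
  rw [← Del_eq_of_mem hQ] at hX
  rw [← Del_eq_of_mem hQ'] at hX'
  obtain ⟨ℓ, hℓ, -, hint⟩ := hQa.exists_of_mem_cells hL hX
  obtain ⟨ℓ', hℓ', -, hint'⟩ := hQa'.exists_of_mem_cells hL hX'
  -- On a common cell the reversal relates the two supporting maps. Then ℓ' ≤ Q' becomes Q ≤ ℓ at
  -- the vertices of P₀, so Q is affine there and P₀ would be a cell of D.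
  have e : ℓ' = A - c • ℓ :=
    eq_of_eqOn_spanning (affineSpan_inter_of_mem_cells hL hQa hX) fun v hv => by
      have h1 := h v ⟨hv.1, hs hv.2⟩
      have h2 := hv
      rw [hint] at hv
      rw [hint'] at h2
      simp only [AffineMap.coe_sub, AffineMap.coe_smul, Pi.sub_apply, Pi.smul_apply, smul_eq_mul]
      rw [← h2.2, ← hv.2, h1]
      ring
  refine hP₀D (mem_cells_of_affine hL hT hQ hW hP₀ (ℓ := ℓ) fun v hv => ?_)
  have h1 := h v hv
  have h2 := hℓ.1 v hv.1
  have h3 := hℓ'.1 v hv.1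
  rw [e] at h3
  simp only [AffineMap.coe_sub, AffineMap.coe_smul, Pi.sub_apply, Pi.smul_apply,
    smul_eq_mul] at h3
  have h4 : c * qval Q v ≤ c * ℓ v := by linarith
  exact le_antisymm (le_of_mul_le_mul_left h4 hc) h2

end Flip

end Delone

end

/-! ### The flip theorem -/

theorem theorem3p6 (d : ℕ) (L : Set (Fin d → ℝ)) (hL : Delone.IsStandardPeriodic L)
    (T : Submodule ℝ (Delone.Mat d)) (hT : ∀ Q ∈ T, Q.IsSymm)
    (D D' : Set (Set (Fin d → ℝ)))
    (hD : Delone.IsGeneric L T D) (hD' : Delone.IsGeneric L T D') (hne : D ≠ D')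
    (𝓕 : Set (Delone.Mat d)) (hF : Delone.IsCommonFacet L T D D' 𝓕)
    (Q : Delone.Mat d) (hQ : Q ∈ Delone.secondaryCone L T D) :
    (∀ P ∈ Delone.repartitioningPolyhedra L T D D' 𝓕,
      Delone.lowerCells L Q P ⊆ Delone.cells D ∧
      Disjoint (Delone.upperCells L Q P) (Delone.cells D)) ∧
    Delone.cells D' =
      (Delone.cells D \ ⋃ P ∈ Delone.repartitioningPolyhedra L T D D' 𝓕,
        Delone.lowerCells L Q P) ∪
      ⋃ P ∈ Delone.repartitioningPolyhedra L T D D' 𝓕, Delone.upperCells L Q P := by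
  obtain ⟨N, Q₀, hW, hN, hn⟩ := Delone.exists_wall hL hT hD hD' hne hF
  obtain ⟨Q', hQ'⟩ := hD'.1
  rw [Delone.repartitioningPolyhedra_eq hL hT hD hQ hW hN hn]
  have hlow : ∀ P ∈ Delone.cells (Delone.Del L Q₀), P ∉ Delone.cells D →
      Delone.lowerCells L Q P = Delone.subcells D P := fun P h1 h2 =>
    Delone.lowerCells_eq_subcells hL hT hQ hW h1 h2
  have hup : ∀ P ∈ Delone.cells (Delone.Del L Q₀), P ∉ Delone.cells D →
      Delone.upperCells L Q P = Delone.subcells D' P := fun P h1 h2 =>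
    Delone.upperCells_eq_subcells hL hT hQ hQ' hW h1 h2
  have heq : ∀ {E : Set (Set (Fin d → ℝ))} {A X Y}, A ∈ Delone.secondaryCone L T E →
      X ∈ Delone.cells E → Y ∈ Delone.cells E → X ⊆ Y → X = Y := by
    intro E A X Y hA hX hY hs
    rw [← Delone.Del_eq_of_mem hA] at hX hY
    have hAa := Delone.admissible_of_mem hT hA
    obtain ⟨x, hx⟩ := Delone.interior_nonempty_of_mem_cells hL hAa hX
    exact Delone.eq_of_interior_meets_cell hL hAa hX hY hx (hs (interior_subset hx))
  constructor
  · rintro P ⟨hP, hPD⟩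
    rw [hlow P hP hPD, hup P hP hPD]
    exact ⟨fun X hX => hX.1, Delone.disjoint_subcells hL hT hQ hQ' hW hP hPD⟩
  · ext X
    simp only [Set.mem_union, Set.mem_sdiff, Set.mem_iUnion, exists_prop]
    constructor
    · intro hX
      obtain ⟨P, hP, hs⟩ := Delone.exists_cell_superset hL hT hQ' hW.symm hX
      by_cases hPD : P ∈ Delone.cells D
      · have hXP := heq hQ' hX (Delone.mem_cells_of_mem_cells hL hT hD hD' hW hP hPD) hs
        subst hXP
        refine Or.inl ⟨hPD, ?_⟩
        -- A removed cell lies in a repartitioning polyhedron P₁, but X lies in only one cell of Q₀,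
        -- namely itself, and that one belongs to D.
        rintro ⟨P₁, ⟨hP₁, hP₁D⟩, hlowX⟩
        rw [hlow P₁ hP₁ hP₁D] at hlowX
        have := Delone.eq_of_cell_subset hL hT hQ hW.admissible hPD hP hP₁ subset_rfl hlowX.2
        exact hP₁D (this ▸ hPD)
      · refine Or.inr ⟨P, ⟨hP, hPD⟩, ?_⟩
        rw [hup P hP hPD]
        exact ⟨hX, hs⟩
    · rintro (⟨hX, hnot⟩ | ⟨P, ⟨hP, hPD⟩, hX⟩)
      · obtain ⟨P, hP, hs⟩ := Delone.exists_cell_superset hL hT hQ hW hX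
        by_cases hPD : P ∈ Delone.cells D
        · rw [heq hQ hX hPD hs]
          exact Delone.mem_cells_of_mem_cells hL hT hD hD' hW hP hPD
        · refine absurd ⟨P, ⟨hP, hPD⟩, ?_⟩ hnot
          rw [hlow P hP hPD]
          exact ⟨hX, hs⟩
      · rw [hup P hP hPD] at hX
        exact hX.1
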